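/- Consider a non-tilted Bianchi VII$_0$ cosmological model filled with radiation, that is, a spacetime with line element $ds^2=-dt^2+\sum_{i,j} g_{ij}(t)\,\omega^i\omega^j$ for $t>t_0$, where $g(t)$ is a $C^2$ family of symmetric positive definite $3\times 3$ matrices and the invariant one-forms satisfy $d\omega^1=0$, $d\omega^2=\omega^3\wedge\omega^1$, $d\omega^3=\omega^1\wedge\omega^2$, which solves the Einstein field equations $G_{ab}=T_{ab}$ (units $8\pi G=c=1$) with $T_{ab}=\mu u_au_b+p(g_{ab}+u_au_b)$, $u=\partial_t$, $\mu>0$ and $p=\tfrac13\mu$. Suppose that the model is not locally rotationally symmetric (LRS), where LRS means that there is a nonzero derivation of the Bianchi VII$_0$ Lie algebra that is skew-symmetric with respect to $g(t)$ for all $t>t_0$ (for a diagonal metric: $g_{22}=g_{33}$ at all times). Let $H=\tfrac13\nabla_au^a$ be the Hubble parameter, let $\tau$ be a Hubble time, $d\tau/dt=H$, and define the density parameter $\Omega=\mu/(3H^2)$ and the scalars $\Sigma,\mathcal S,\mathcal W\ge 0$ by $$\Sigma^2=\frac{\sigma_{ab}\sigma^{ab}}{6H^2},\qquad \mathcal S^2=\frac{{}^3S_{ab}\,{}^3S^{ab}}{6H^4},\qquad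 \mathcal W^2=\frac{E_{ab}E^{ab}+H_{ab}H^{ab}}{6H^4},$$ where $\sigma_{ab}$ is the rate of shear tensor of the fluid, ${}^3S_{ab}$ is the trace-free Ricci tensor of the hypersurfaces $t=\text{const}$, and $E_{ab}$, $H_{ab}$ are the electric and magnetic parts of the Weyl tensor with respect to $u$. Then $\tau\to+\infty$ as $t\to+\infty$, and $$\lim_{\tau\to+\infty}\Omega=1,\qquad \lim_{\tau\to+\infty}\Sigma=0,\qquad \lim_{\tau\to+\infty}\mathcal W=+\infty,\qquad \limsup_{\tau\to+\infty}\mathcal S=+\infty,\qquad \liminf_{\tau\to+\infty}\mathcal S=0.$$ -/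

import Mathlib

open Filter Set

noncomputable section

namespace BianchiRadiation

/-! ## Curvature in an invariant frame

A frame field `e_a` whose commutators `[e_a, e_b] = ∑ c, C c a b • e_c` have constant coefficients,
on a space where all invariant functions depend on one parameter `t` only:
`e_a f = D a * f'`. The metric components in the frame are `G t a b = g(e_a, e_b)`. -/

/-- An invariant frame together with the components of an invariant metric. -/
structure InvFrame (ι : Type) where
  /-- `D a` is the `∂_t`-component of `e_a`. -/
  D : ι → ℝ
  /-- `C c a b` is the component of `[e_a, e_b]` along `e_c`. -/
  C : ι → ι → ι → ℝ
  /-- The metric components. -/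
  G : ℝ → Matrix ι ι ℝ

namespace InvFrame

variable {ι : Type} [Fintype ι] [DecidableEq ι] (F : InvFrame ι)

/-- The derivative `e_a f` of an invariant function. -/
def ed (a : ι) (f : ℝ → ℝ) (t : ℝ) : ℝ := F.D a * deriv f t

/-- `g(∇_{e_a} e_b, e_c)` for the Levi-Civita connection (the Koszul formula). -/
def connLow (c a b : ι) (t : ℝ) : ℝ :=
  (1 / 2) * (F.ed a (fun s => F.G s b c) t + F.ed b (fun s => F.G s a c) t
      - F.ed c (fun s => F.G s a b) t
    + (∑ d, F.C d a b * F.G t d c) - (∑ d, F.C d a c * F.G t d b)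
      - (∑ d, F.C d b c * F.G t d a))

/-- The connection coefficients, `∇_{e_a} e_b = ∑ c, conn c a b • e_c`. -/
def conn (c a b : ι) (t : ℝ) : ℝ := ∑ d, (F.G t)⁻¹ c d * F.connLow d a b t

/-- The Riemann tensor, `R(e_c, e_d) e_b = ∑ a, riem a b c d • e_a`, where
`R(X, Y) Z = ∇_X ∇_Y Z - ∇_Y ∇_X Z - ∇_{[X, Y]} Z`. -/
def riem (a b c d : ι) (t : ℝ) : ℝ :=
  F.ed c (F.conn a d b) t - F.ed d (F.conn a c b) t
    + (∑ e, F.conn e d b t * F.conn a c e t) - (∑ e, F.conn e c b t * F.conn a d e t)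
    - (∑ e, F.C e c d * F.conn a e b t)

/-- The Riemann tensor with all indices lowered. -/
def riemLow (a b c d : ι) (t : ℝ) : ℝ := ∑ e, F.G t a e * F.riem e b c d t

/-- The Ricci tensor. -/
def ricci (b d : ι) (t : ℝ) : ℝ := ∑ a, F.riem a b a d t

/-- The scalar curvature. -/
def scalar (t : ℝ) : ℝ := ∑ a, ∑ b, (F.G t)⁻¹ a b * F.ricci a b t

/-- The full contraction `T_{ab} T^{ab}`. -/
def normSq (T : ι → ι → ℝ) (t : ℝ) : ℝ :=
  ∑ a, ∑ b, ∑ c, ∑ d, (F.G t)⁻¹ a c * (F.G t)⁻¹ b d * T a b * T c d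

/-- The Einstein tensor. -/
def einstein (a b : ι) (t : ℝ) : ℝ := F.ricci a b t - (1 / 2) * F.scalar t * F.G t a b

/-- The Weyl tensor of a four-dimensional metric, with all indices lowered. -/
def weyl (F : InvFrame (Fin 4)) (a b c d : Fin 4) (t : ℝ) : ℝ :=
  F.riemLow a b c d t
    - (1 / 2) * (F.G t a c * F.ricci b d t - F.G t a d * F.ricci b c t
        - F.G t b c * F.ricci a d t + F.G t b d * F.ricci a c t)
    + (1 / 6) * F.scalar t * (F.G t a c * F.G t b d - F.G t a d * F.G t b c)

/-- The volume form of a four-dimensional metric. The determinant is the alternating symbol. -/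
def vol (F : InvFrame (Fin 4)) (a b c d : Fin 4) (t : ℝ) : ℝ :=
  Real.sqrt |(F.G t).det| *
    Matrix.det (Matrix.of fun i j : Fin 4 => if ![a, b, c, d] i = j then (1 : ℝ) else 0)

/-- The left dual `*C_{abcd} = (1/2) η_{ab}{}^{ef} C_{efcd}` of the Weyl tensor. -/
def dualWeyl (F : InvFrame (Fin 4)) (a b c d : Fin 4) (t : ℝ) : ℝ :=
  (1 / 2) * ∑ e, ∑ f, ∑ k, ∑ l,
    F.vol a b e f t * (F.G t)⁻¹ e k * (F.G t)⁻¹ f l * F.weyl k l c d t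

end InvFrame

/-! ## Bianchi VII₀ spacetimes -/

/-- The structure constants of the Bianchi VII₀ Lie algebra:
`[e₀, e₁] = -e₂`, `[e₂, e₀] = -e₁`, `[e₁, e₂] = 0`. For the dual one-forms this says
`dω⁰ = 0`, `dω¹ = ω² ∧ ω⁰`, `dω² = ω⁰ ∧ ω¹`. -/
def structVII0 (k i j : Fin 3) : ℝ :=
  if (k = 2 ∧ i = 0 ∧ j = 1) ∨ (k = 1 ∧ i = 2 ∧ j = 0) then -1
  else if (k = 2 ∧ i = 1 ∧ j = 0) ∨ (k = 1 ∧ i = 0 ∧ j = 2) then 1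
  else 0

/-- The homogeneous hypersurface of constant `t`, with metric `∑ g_{ij}(t) ω^i ω^j`. -/
def spaceFrame (g : ℝ → Matrix (Fin 3) (Fin 3) ℝ) : InvFrame (Fin 3) where
  D := fun _ => 0
  C := structVII0
  G := g

/-- The spacetime with metric `-dt² + ∑ g_{ij}(t) ω^i ω^j`, in the frame `∂_t, e₀, e₁, e₂`;
the spacetime index `0` is `∂_t`, and `i + 1` is the spatial index `i`. -/
def spacetimeFrame (g : ℝ → Matrix (Fin 3) (Fin 3) ℝ) : InvFrame (Fin 4) where
  D := fun a => if a = 0 then 1 else 0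
  C := fun c a b =>
    if (c = 3 ∧ a = 1 ∧ b = 2) ∨ (c = 2 ∧ a = 3 ∧ b = 1) then -1
    else if (c = 3 ∧ a = 2 ∧ b = 1) ∨ (c = 2 ∧ a = 1 ∧ b = 3) then 1
    else 0
  G := fun t =>
    !![-1, 0, 0, 0;
       0, g t 0 0, g t 0 1, g t 0 2;
       0, g t 1 0, g t 1 1, g t 1 2;
       0, g t 2 0, g t 2 1, g t 2 2]

/-- The fluid four-velocity `u^a`, for a fluid that moves orthogonally to the
homogeneous hypersurfaces: `u = ∂_t`. -/
def fluidU (a : Fin 4) : ℝ := if a = 0 then 1 else 0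

/-- The covector `u_a` of the fluid four-velocity. -/
def fluidULow (g : ℝ → Matrix (Fin 3) (Fin 3) ℝ) (a : Fin 4) (t : ℝ) : ℝ :=
  ∑ c, (spacetimeFrame g).G t a c * fluidU c

/-- A non-tilted Bianchi VII₀ cosmological model filled with radiation: an invariant metric
`-dt² + ∑ g_{ij}(t) ω^i ω^j` on `t > t₀` that solves the Einstein field equations
`G_{ab} = T_{ab}` (units with `8πG = c = 1`) for the perfect fluid
`T_{ab} = μ u_a u_b + p (g_{ab} + u_a u_b)` with `u = ∂_t`, `p = μ/3` and `μ > 0`. -/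
structure Model where
  t₀ : ℝ
  g : ℝ → Matrix (Fin 3) (Fin 3) ℝ
  μ : ℝ → ℝ
  contDiffOn : ∀ i j, ContDiffOn ℝ 2 (fun t => g t i j) (Ioi t₀)
  posDef : ∀ t, t₀ < t → (g t).PosDef
  mu_pos : ∀ t, t₀ < t → 0 < μ t
  einstein_eq : ∀ t, t₀ < t → ∀ a b : Fin 4,
    (spacetimeFrame g).einstein a b t =
      μ t * fluidULow g a t * fluidULow g b t
        + (μ t / 3) * ((spacetimeFrame g).G t a b + fluidULow g a t * fluidULow g b t)

namespace Model

variable (m : Model)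

/-- The spacetime of the model. -/
def frame : InvFrame (Fin 4) := spacetimeFrame m.g

/-- The homogeneous hypersurfaces of the model. -/
def space : InvFrame (Fin 3) := spaceFrame m.g

/-- The covector `u_a`. -/
def uLow (a : Fin 4) (t : ℝ) : ℝ := fluidULow m.g a t

/-- The covariant derivative `∇_a u_b`. -/
def gradU (a b : Fin 4) (t : ℝ) : ℝ :=
  m.frame.ed a (m.uLow b) t - ∑ c, m.frame.conn c a b t * m.uLow c t

/-- The Hubble parameter: one third of the expansion `∇_a u^a`. -/
def H (t : ℝ) : ℝ := (1 / 3) * ∑ a, ∑ b, (m.frame.G t)⁻¹ a b * m.gradU a b t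

/-- The projection `h^a_b = δ^a_b + u^a u_b` to the rest spaces of the fluid. -/
def proj (a b : Fin 4) (t : ℝ) : ℝ := (if a = b then 1 else 0) + fluidU a * m.uLow b t

/-- The rate of shear tensor `σ_{ab}` of the fluid congruence. -/
def shear (a b : Fin 4) (t : ℝ) : ℝ :=
  (∑ c, ∑ d, m.proj c a t * m.proj d b t * ((1 / 2) * (m.gradU c d t + m.gradU d c t)))
    - m.H t * (m.frame.G t a b + m.uLow a t * m.uLow b t)

/-- The trace-free spatial Ricci tensor `³S_{ij}`. -/
def ricciTF (i j : Fin 3) (t : ℝ) : ℝ :=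
  m.space.ricci i j t - (1 / 3) * m.space.scalar t * m.g t i j

/-- The electric part `E_{ab} = C_{acbd} u^c u^d` of the Weyl tensor. -/
def elWeyl (a b : Fin 4) (t : ℝ) : ℝ :=
  ∑ c, ∑ d, m.frame.weyl a c b d t * fluidU c * fluidU d

/-- The magnetic part `H_{ab} = *C_{acbd} u^c u^d` of the Weyl tensor. -/
def magWeyl (a b : Fin 4) (t : ℝ) : ℝ :=
  ∑ c, ∑ d, m.frame.dualWeyl a c b d t * fluidU c * fluidU d

/-- The density parameter `Ω = μ / (3 H²)`. -/
def Omega (t : ℝ) : ℝ := m.μ t / (3 * m.H t ^ 2)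

/-- The shear scalar, `Σ² = σ_{ab} σ^{ab} / (6 H²)`. -/
def shearScalar (t : ℝ) : ℝ :=
  Real.sqrt (m.frame.normSq (fun a b => m.shear a b t) t / (6 * m.H t ^ 2))

/-- The spatial curvature anisotropy scalar, `𝒮² = ³S_{ab} ³S^{ab} / (6 H⁴)`. -/
def curvScalar (t : ℝ) : ℝ :=
  Real.sqrt (m.space.normSq (fun i j => m.ricciTF i j t) t / (6 * m.H t ^ 4))

/-- The Weyl scalar, `𝒲² = (E_{ab} E^{ab} + H_{ab} H^{ab}) / (6 H⁴)`. -/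
def weylScalar (t : ℝ) : ℝ :=
  Real.sqrt ((m.frame.normSq (fun a b => m.elWeyl a b t) t
    + m.frame.normSq (fun a b => m.magWeyl a b t) t) / (6 * m.H t ^ 4))

/-- The model is locally rotationally symmetric: there is a one-parameter group of rotations of
the tangent spaces, acting by automorphisms of the symmetry algebra and preserving the metric at
all times. The matrix `A` is its generator, a nonzero derivation `e_i ↦ ∑ k, A k i • e_k` that is
skew for `g t`. In a frame in which `g` is diagonal this says `g₁₁ = g₂₂` at all times. -/
def IsLRS : Prop :=
  ∃ A : Matrix (Fin 3) (Fin 3) ℝ, A ≠ 0 ∧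
    (∀ n i j, ∑ k, A n k * structVII0 k i j
      = (∑ k, A k i * structVII0 n k j) + ∑ k, A k j * structVII0 n i k) ∧
    ∀ t, m.t₀ < t → A.transpose * m.g t + m.g t * A = 0

/-- `τ` is a Hubble time of the model: `dτ/dt = H`. -/
def IsHubbleTime (τ : ℝ → ℝ) : Prop := ∀ t, m.t₀ < t → HasDerivAt τ (m.H t) t

/-- The filter of late times: instants `t > t₀` with `τ(t) → +∞`. -/
def late (τ : ℝ → ℝ) : Filter ℝ := comap τ atTop ⊓ 𝓟 (Ioi m.t₀)

end Model

end BianchiRadiation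

end

/-!
Non-LRS Bianchi VII₀ radiation models isotropize in the shear but not in the Weyl curvature.

**Reduction to a diagonal metric.** The momentum constraint gives `extr_zero_one`,
`extr_zero_two` and `extr_two_one`, and these make the projection of `e₀` to the span of `e₁`, `e₂`
constant in time (`Model.exists_shift`). A constant automorphism of the Lie algebra therefore makes
`e₀` orthogonal to `e₁` and `e₂` at all times. If the metric in the remaining plane were isotropic
at all times, the model would be LRS (`Model.isLRS_of_isotropic`). Otherwise it is anisotropic at
some time, a rotation diagonalizes it there, and it stays diagonal because the off-diagonal
component solves a homogeneous linear second order equation (`IsBlock.g_one_two_eq_zero`). All the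
scalars of the theorem are invariant under such a change of frame, which is proved for general
invariant frames (`InvFrame.IsChange`). The result is `Model.exists_isDiagonal`.

**The flow.** A diagonal model is described by the expansion-normalized variables `s`, `x`, `y`,
`N` of the structure `Flow`. With `'` for the derivative with respect to the Hubble time and
`q = 1 + s² + (x² - y²) / 3` they satisfy
`s' = (q - 2) s - 2 y² / 3`, `x' = (q - 2) x - 2 N y`, `y' = (q + 2 s) y + 2 N x`,
`N' = (q + 2 s) N + 2 x y`, with `Ω = 1 - s² - (x² + y²) / 3 > 0` and `y² < N²`. Only `N` is
unbounded, and `(x, y)` rotates at the rate `2 N`. In terms of these variables `Σ² = s² + x² / 3`,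
`𝒮² = 4 y⁴ / 9 + 4 N² y² / 3`, and `𝒲²` is at least a multiple of `N² (x² + y²)` minus a
constant.

**Growth of `N`.** The logarithm of `√(N² - y²) Ω / (1 + s / 2)³` has the derivative
`(x² + (1 + 2 s)²) / (1 + s / 2) ≥ 0`. Where this is small, `s - x y / (4 N)` increases at a rate
bounded below, so a combination of the two quantities grows linearly in the Hubble time, and `N`
grows exponentially (`Flow.exists_inv_N_le`).

**Averaging.** The quantity `ζ = x y / N` is `O(1 / N)`, and `ζ' = 2 (x² - y²) + O(1 / N)`.
Subtracting multiples of `ζ` therefore removes the oscillating term `x² - y²` from an equation, at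
the price of an error that is integrable because `N` grows exponentially. Applied to
`(log Ω)' = 2 s² + 2 (x² - y²) / 3` this gives a bounded monotone quantity with derivative at least
`2 s²`; hence `s → 0` and `Ω` has a positive limit (`Flow.exists_tendsto_avgLogOm`). Then
`x² + y²` converges too, and the averaged equation for `s` forces its limit to be `0`
(`Flow.tendsto_Om`). So `Ω → 1` and `Σ → 0`.

**Oscillation.** In the same way `log (N² (x² + y²))` has an averaged derivative that tends to `2`, hence
`N² (x² + y²) → ∞` and `𝒲 → ∞` (`Flow.tendsto_N_sq_mul_amp`). Since `(x, y)` keeps rotating, `y`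
vanishes at arbitrarily late times, where `𝒮 = 0`; and `N² y²` is unbounded, as otherwise
`x² - y²` would not average out (`Flow.frequently_y_eq_zero`,
`Flow.frequently_lt_N_sq_mul_y_sq`).
-/

noncomputable section

namespace BianchiRadiation

/-! ### Covariance under a change of the invariant frame -/

namespace InvFrame

variable {ι : Type} [Fintype ι]

/-- The pull-back of a tensor with three lower indices by the frame matrix `B`. -/
def pull₃ (B : Matrix ι ι ℝ) (f : ι → ι → ι → ℝ) (c a b : ι) : ℝ :=
  ∑ k, ∑ i, ∑ j, B k c * B i a * B j b * f k i j

theorem pull₃_swap₂₃ (B : Matrix ι ι ℝ) (f : ι → ι → ι → ℝ) (c a b : ι) :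
    pull₃ B (fun k i j => f k j i) c a b = pull₃ B f c b a := by
  unfold pull₃
  refine Finset.sum_congr rfl fun k _ => ?_
  rw [Finset.sum_comm]
  exact Finset.sum_congr rfl fun j _ => Finset.sum_congr rfl fun i _ => by ring

theorem pull₃_swap₁₂ (B : Matrix ι ι ℝ) (f : ι → ι → ι → ℝ) (c a b : ι) :
    pull₃ B (fun k i j => f i k j) c a b = pull₃ B f a c b := by
  unfold pull₃
  rw [Finset.sum_comm]
  exact Finset.sum_congr rfl fun j _ => Finset.sum_congr rfl fun i _ =>
    Finset.sum_congr rfl fun k _ => by ring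

variable [DecidableEq ι]

/-- The metric components are `C²` on the open set `U`, and the metric is nondegenerate there. -/
structure IsRegularOn (F : InvFrame ι) (U : Set ℝ) : Prop where
  isOpen : IsOpen U
  contDiffOn : ∀ i j, ContDiffOn ℝ 2 (fun t => F.G t i j) U
  det_ne_zero : ∀ t ∈ U, (F.G t).det ≠ 0

/-- `F'` is the frame `e'_a = ∑ i, B i a • e_i` with constant coefficients; `B'` is the inverse
of `B`. -/
structure IsChange (F F' : InvFrame ι) (B B' : Matrix ι ι ℝ) : Prop where
  mul_inv : B * B' = 1
  D_eq : ∀ a, F'.D a = ∑ i, B i a * F.D i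
  C_eq : ∀ k a b, ∑ c, B k c * F'.C c a b = ∑ i, ∑ j, B i a * B j b * F.C k i j
  G_eq : ∀ t, F'.G t = B.transpose * F.G t * B

section Regular

variable {F : InvFrame ι} {U : Set ℝ}

theorem IsRegularOn.differentiableAt (h : F.IsRegularOn U) {t : ℝ} (ht : t ∈ U) (i j : ι) :
    DifferentiableAt ℝ (fun s => F.G s i j) t :=
  ((h.contDiffOn i j).differentiableOn (by norm_num)).differentiableAt (h.isOpen.mem_nhds ht)

theorem IsRegularOn.differentiableAt_deriv (h : F.IsRegularOn U) {t : ℝ} (ht : t ∈ U) (i j : ι) :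
    DifferentiableAt ℝ (deriv fun s => F.G s i j) t :=
  (((h.contDiffOn i j).deriv_of_isOpen (m := 1) h.isOpen (by norm_num)).differentiableOn
    (by norm_num)).differentiableAt (h.isOpen.mem_nhds ht)

theorem _root_.Matrix.differentiableAt_det {M : ℝ → Matrix ι ι ℝ} {t : ℝ}
    (h : ∀ i j, DifferentiableAt ℝ (fun s => M s i j) t) :
    DifferentiableAt ℝ (fun s => (M s).det) t := by
  simp only [Matrix.det_apply]
  fun_prop

theorem _root_.Matrix.differentiableAt_inv {M : ℝ → Matrix ι ι ℝ} {t : ℝ}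
    (h : ∀ i j, DifferentiableAt ℝ (fun s => M s i j) t) (ht : (M t).det ≠ 0) (i j : ι) :
    DifferentiableAt ℝ (fun s => (M s)⁻¹ i j) t := by
  simp only [Matrix.inv_def, Ring.inverse_eq_inv', Matrix.smul_apply, Matrix.adjugate_apply,
    smul_eq_mul]
  refine ((Matrix.differentiableAt_det h).inv ht).mul (Matrix.differentiableAt_det fun a b => ?_)
  simp only [Matrix.updateRow_apply]
  split_ifs
  · exact differentiableAt_const _
  · exact h a b

theorem IsRegularOn.differentiableAt_conn (h : F.IsRegularOn U) {t : ℝ} (ht : t ∈ U) (c a b : ι) :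
    DifferentiableAt ℝ (F.conn c a b) t := by
  have h1 := fun i j => h.differentiableAt ht i j
  have h2 := fun i j => h.differentiableAt_deriv ht i j
  have h3 := Matrix.differentiableAt_inv h1 (h.det_ne_zero t ht)
  have h4 : ∀ d, DifferentiableAt ℝ (F.connLow d a b) t := fun d =>
    (((((((h2 b d).const_mul _).add ((h2 a d).const_mul _)).sub ((h2 a b).const_mul _)).add
      (DifferentiableAt.fun_sum fun e _ => (h1 e d).const_mul _)).sub
      (DifferentiableAt.fun_sum fun e _ => (h1 e b).const_mul _)).sub
      (DifferentiableAt.fun_sum fun e _ => (h1 e a).const_mul _)).const_mul _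
  exact DifferentiableAt.fun_sum fun d _ => (h3 c d).mul (h4 d)

end Regular

section Change

variable {F F' : InvFrame ι} {B B' : Matrix ι ι ℝ}

theorem IsChange.G_apply (h : IsChange F F' B B') (t : ℝ) (a b : ι) :
    F'.G t a b = ∑ i, ∑ j, B i a * B j b * F.G t i j := by
  rw [h.G_eq, Matrix.mul_assoc, Matrix.mul_apply]
  refine Finset.sum_congr rfl fun i _ => ?_
  rw [Matrix.mul_apply, Finset.mul_sum]
  exact Finset.sum_congr rfl fun j _ => by rw [Matrix.transpose_apply]; ring

theorem IsChange.inv_G (h : IsChange F F' B B') (t : ℝ) :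
    (F'.G t)⁻¹ = B' * (F.G t)⁻¹ * B'.transpose := by
  have h1 : B⁻¹ = B' := Matrix.inv_eq_right_inv h.mul_inv
  rw [h.G_eq, Matrix.mul_inv_rev, Matrix.mul_inv_rev, h1, ← Matrix.transpose_nonsing_inv, h1,
    Matrix.mul_assoc]

variable {U : Set ℝ} {t : ℝ}

theorem IsChange.deriv_G (h : IsChange F F' B B') (hF : F.IsRegularOn U) (ht : t ∈ U) (a b : ι) :
    deriv (fun s => F'.G s a b) t = ∑ i, ∑ j, B i a * B j b * deriv (fun s => F.G s i j) t := by
  simp only [h.G_apply]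
  refine HasDerivAt.deriv ?_
  refine HasDerivAt.fun_sum fun i _ => HasDerivAt.fun_sum fun j _ => ?_
  exact ((hF.differentiableAt ht i j).hasDerivAt).const_mul _

theorem IsChange.ed (h : IsChange F F' B B') (a : ι) (f : ℝ → ℝ) (t : ℝ) :
    F'.ed a f t = ∑ i, B i a * F.ed i f t := by
  simp only [InvFrame.ed, h.D_eq, Finset.sum_mul, mul_assoc]

theorem IsChange.ed_G (h : IsChange F F' B B') (hF : F.IsRegularOn U) (ht : t ∈ U) (c a b : ι) :
    F'.ed a (fun s => F'.G s b c) t =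
      pull₃ B (fun k i j => F.ed i (fun s => F.G s j k) t) c a b := by
  rw [h.ed, pull₃, Finset.sum_comm]
  refine Finset.sum_congr rfl fun i _ => ?_
  rw [Finset.sum_comm]
  simp only [InvFrame.ed, h.deriv_G hF ht, Finset.mul_sum]
  exact Finset.sum_congr rfl fun j _ => Finset.sum_congr rfl fun k _ => by ring

theorem IsChange.sum_C_mul_G (h : IsChange F F' B B') (t : ℝ) (c a b : ι) :
    ∑ d, F'.C d a b * F'.G t d c =
      pull₃ B (fun k i j => ∑ d, F.C d i j * F.G t d k) c a b := by
  have h1 : ∀ d, F'.C d a b * F'.G t d c =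
      ∑ k, ∑ m, B m d * F'.C d a b * (B k c * F.G t m k) := fun d => by
    rw [h.G_apply, Finset.mul_sum, Finset.sum_comm]
    simp only [Finset.mul_sum]
    exact Finset.sum_congr rfl fun k _ => Finset.sum_congr rfl fun m _ => by ring
  simp only [h1, pull₃]
  rw [Finset.sum_comm]
  refine Finset.sum_congr rfl fun k _ => ?_
  rw [Finset.sum_comm]
  simp only [← Finset.sum_mul, h.C_eq]
  simp only [Finset.sum_mul, Finset.mul_sum]
  rw [Finset.sum_comm]
  refine Finset.sum_congr rfl fun i _ => ?_
  rw [Finset.sum_comm]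
  exact Finset.sum_congr rfl fun j _ => Finset.sum_congr rfl fun m _ => by ring

theorem IsChange.connLow (h : IsChange F F' B B') (hF : F.IsRegularOn U) (ht : t ∈ U)
    (c a b : ι) : F'.connLow c a b t = pull₃ B (fun k i j => F.connLow k i j t) c a b := by
  have e1 := h.ed_G hF ht c a b
  have e2 := h.ed_G hF ht c b a
  have e3 := h.ed_G hF ht b c a
  have s1 := h.sum_C_mul_G t c a b
  have s2 := h.sum_C_mul_G t b a c
  have s3 := h.sum_C_mul_G t a b c
  rw [← pull₃_swap₂₃] at e2
  rw [← pull₃_swap₁₂, ← pull₃_swap₂₃, ] at e3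
  rw [← pull₃_swap₁₂, ← pull₃_swap₂₃, ← pull₃_swap₁₂] at s2
  rw [← pull₃_swap₂₃, ← pull₃_swap₁₂] at s3
  unfold InvFrame.connLow
  rw [e1, e2, e3, s1, s2, s3]
  simp only [pull₃, Finset.mul_sum, ← Finset.sum_add_distrib, ← Finset.sum_sub_distrib]
  exact Finset.sum_congr rfl fun k _ => Finset.sum_congr rfl fun i _ =>
    Finset.sum_congr rfl fun j _ => by simp only [mul_assoc, ← Finset.mul_sum]; ring

/-- The connection matrix `(Γ_a)^k_b`. -/
def connMat (F : InvFrame ι) (a : ι) (t : ℝ) : Matrix ι ι ℝ := Matrix.of fun k b => F.conn k a b t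

/-- The curvature matrix `(R_{cd})^a_b`. -/
def riemMat (F : InvFrame ι) (c d : ι) (t : ℝ) : Matrix ι ι ℝ :=
  Matrix.of fun a b => F.riem a b c d t

theorem riemMat_eq (F : InvFrame ι) (c d : ι) (t : ℝ) :
    F.riemMat c d t = F.D c • Matrix.of (fun a b => deriv (F.conn a d b) t)
      - F.D d • Matrix.of (fun a b => deriv (F.conn a c b) t)
      + F.connMat c t * F.connMat d t - F.connMat d t * F.connMat c t
      - ∑ e, F.C e c d • F.connMat e t := by
  ext a b
  simp only [riemMat, riem, InvFrame.ed, connMat, Matrix.of_apply, Matrix.sub_apply,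
    Matrix.add_apply, Matrix.smul_apply, smul_eq_mul, Matrix.mul_apply, Matrix.sum_apply]
  simp only [mul_comm]

theorem IsChange.connMat (h : IsChange F F' B B') (hF : F.IsRegularOn U) (ht : t ∈ U) (a : ι) :
    F'.connMat a t = ∑ i, B i a • (B' * F.connMat i t * B) := by
  have h1 : ∀ F : InvFrame ι, ∀ a, F.connMat a t =
      (F.G t)⁻¹ * Matrix.of fun c b => F.connLow c a b t := fun F a => by
    ext k b
    simp [InvFrame.connMat, InvFrame.conn, Matrix.mul_apply]
  have h2 : (Matrix.of fun c b => F'.connLow c a b t) =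
      ∑ i, B i a • (B.transpose * (Matrix.of fun c b => F.connLow c i b t) * B) := by
    ext c b
    simp only [h.connLow hF ht, pull₃, Matrix.of_apply, Matrix.sum_apply, Matrix.smul_apply,
      Matrix.mul_apply, Matrix.transpose_apply, smul_eq_mul, Finset.mul_sum, Finset.sum_mul]
    rw [Finset.sum_comm]
    refine Finset.sum_congr rfl fun i _ => ?_
    rw [Finset.sum_comm]
    exact Finset.sum_congr rfl fun j _ => Finset.sum_congr rfl fun k _ => by ring
  have h3 : B'.transpose * B.transpose = 1 := by
    rw [← Matrix.transpose_mul, h.mul_inv, Matrix.transpose_one]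
  rw [h1, h2, h.inv_G, Finset.mul_sum]
  refine Finset.sum_congr rfl fun i _ => ?_
  rw [h1, Matrix.mul_smul]
  simp only [Matrix.mul_assoc]
  rw [← Matrix.mul_assoc B'.transpose, h3, Matrix.one_mul]

theorem IsChange.deriv_conn (h : IsChange F F' B B') (hF : F.IsRegularOn U) (ht : t ∈ U) (a : ι) :
    Matrix.of (fun k b => deriv (F'.conn k a b) t) =
      ∑ i, B i a • (B' * Matrix.of (fun k b => deriv (F.conn k i b) t) * B) := by
  ext k b
  have h1 : F'.conn k a b =ᶠ[nhds t]
      fun s => ∑ i, B i a * ∑ l, (∑ j, B' k j * F.conn j i l s) * B l b := by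
    filter_upwards [hF.isOpen.mem_nhds ht] with s hs
    have := congrFun (congrFun (h.connMat hF hs a) k) b
    simpa [InvFrame.connMat, Matrix.sum_apply, Matrix.mul_apply] using this
  simp only [Matrix.of_apply, h1.deriv_eq, Matrix.sum_apply, Matrix.smul_apply, Matrix.mul_apply,
    smul_eq_mul]
  refine HasDerivAt.deriv ?_
  refine HasDerivAt.fun_sum fun i _ => HasDerivAt.const_mul _ (HasDerivAt.fun_sum fun l _ =>
    HasDerivAt.mul_const (HasDerivAt.fun_sum fun j _ => HasDerivAt.const_mul _ ?_) _)
  exact (hF.differentiableAt_conn ht _ _ _).hasDerivAt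

/-- The curvature matrices are conjugated by a change of frame. -/
theorem IsChange.riemMat (h : IsChange F F' B B') (hF : F.IsRegularOn U) (ht : t ∈ U) (c d : ι) :
    F'.riemMat c d t = ∑ i, ∑ j, (B i c * B j d) • (B' * F.riemMat i j t * B) := by
  have hmul : ∀ c d, F'.connMat c t * F'.connMat d t =
      ∑ i, ∑ j, (B i c * B j d) • (B' * (F.connMat i t * F.connMat j t) * B) := fun c d => by
    rw [h.connMat hF ht, h.connMat hF ht, Finset.sum_mul_sum]
    refine Finset.sum_congr rfl fun i _ => Finset.sum_congr rfl fun j _ => ?_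
    rw [smul_mul_smul_comm]
    congr 1
    simp only [Matrix.mul_assoc]
    rw [← Matrix.mul_assoc B, h.mul_inv, Matrix.one_mul]
  have hC : ∑ e, F'.C e c d • F'.connMat e t =
      ∑ i, ∑ j, (B i c * B j d) • (B' * (∑ e, F.C e i j • F.connMat e t) * B) := by
    simp only [h.connMat hF ht, Finset.smul_sum, smul_smul, Finset.mul_sum, Finset.sum_mul,
      Matrix.mul_smul, Matrix.smul_mul]
    rw [Finset.sum_comm]
    have : ∀ e, ∑ e', (F'.C e' c d * B e e') • (B' * F.connMat e t * B) =
        ∑ i, ∑ j, (B i c * B j d * F.C e i j) • (B' * F.connMat e t * B) := fun e => by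
      simp only [← Finset.sum_smul, ← h.C_eq, mul_comm]
    simp only [this]
    rw [Finset.sum_comm]
    exact Finset.sum_congr rfl fun i _ => Finset.sum_comm
  have hD : ∀ c d, F'.D c • Matrix.of (fun k b => deriv (F'.conn k d b) t) =
      ∑ i, ∑ j, (B i c * B j d) •
        (B' * (F.D i • Matrix.of (fun k b => deriv (F.conn k j b) t)) * B) := fun c d => by
    rw [h.deriv_conn hF ht, h.D_eq, Finset.sum_smul]
    refine Finset.sum_congr rfl fun i _ => ?_
    rw [Finset.smul_sum]
    refine Finset.sum_congr rfl fun j _ => ?_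
    rw [Matrix.mul_smul, Matrix.smul_mul, smul_smul, smul_smul]
    congr 1
    ring
  have hswap : ∀ f : ι → ι → Matrix ι ι ℝ, ∑ i, ∑ j, (B i d * B j c) • f i j =
      ∑ i, ∑ j, (B i c * B j d) • f j i := fun f => by
    rw [Finset.sum_comm]
    simp only [mul_comm]
  rw [riemMat_eq, hC, hD c d, hD d c, hmul c d, hmul d c, hswap, hswap]
  simp only [← Finset.sum_sub_distrib, ← Finset.sum_add_distrib, ← smul_sub, ← smul_add]
  refine Finset.sum_congr rfl fun i _ => Finset.sum_congr rfl fun j _ => ?_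
  rw [riemMat_eq]
  simp only [Matrix.mul_sub, Matrix.mul_add, Matrix.sub_mul, Matrix.add_mul]

/-- The Ricci tensor is a tensor: its matrix transforms by congruence. -/
theorem IsChange.ricci (h : IsChange F F' B B') (hF : F.IsRegularOn U) (ht : t ∈ U) :
    (Matrix.of fun b d => F'.ricci b d t) =
      B.transpose * (Matrix.of fun b d => F.ricci b d t) * B := by
  ext b d
  have h1 : F'.ricci b d t = ∑ i, ∑ j, B j d * ∑ a, B i a * (B' * (F.riemMat i j t * B)) a b := by
    have : ∀ a, F'.riem a b a d t = ∑ i, ∑ j, B j d * (B i a * (B' * (F.riemMat i j t * B)) a b) :=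
      fun a => by
        have := congrFun (congrFun (h.riemMat hF ht a d) a) b
        rw [InvFrame.riemMat, Matrix.of_apply] at this
        rw [this]
        simp only [Matrix.sum_apply, Matrix.smul_apply, smul_eq_mul, Matrix.mul_assoc]
        exact Finset.sum_congr rfl fun i _ => Finset.sum_congr rfl fun j _ => by ring
    rw [InvFrame.ricci]
    simp only [this, Finset.mul_sum]
    rw [Finset.sum_comm]
    exact Finset.sum_congr rfl fun i _ => Finset.sum_comm
  have h2 : ∀ i j, ∑ a, B i a * (B' * (F.riemMat i j t * B)) a b = (F.riemMat i j t * B) i b :=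
    fun i j => by
      rw [← Matrix.mul_apply, ← Matrix.mul_assoc, h.mul_inv, Matrix.one_mul]
  rw [Matrix.of_apply, h1]
  simp only [h2]
  simp only [Matrix.mul_apply, Matrix.of_apply, Matrix.transpose_apply, InvFrame.ricci,
    InvFrame.riemMat, Finset.mul_sum, Finset.sum_mul]
  rw [Finset.sum_comm]
  refine Finset.sum_congr rfl fun j _ => ?_
  rw [Finset.sum_comm]
  exact Finset.sum_congr rfl fun l _ => Finset.sum_congr rfl fun i _ => by ring

theorem IsChange.cancel (h : IsChange F F' B B') (M : Matrix ι ι ℝ) : B * (B' * M) = M := by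
  rw [← Matrix.mul_assoc, h.mul_inv, Matrix.one_mul]

theorem IsChange.cancel_transpose (h : IsChange F F' B B') (M : Matrix ι ι ℝ) :
    B'.transpose * (B.transpose * M) = M := by
  rw [← Matrix.mul_assoc, ← Matrix.transpose_mul, h.mul_inv, Matrix.transpose_one, Matrix.one_mul]

theorem IsChange.sum_inv_mul (h : IsChange F F' B B') {T T' : ι → ι → ℝ}
    (hT : Matrix.of T' = B.transpose * Matrix.of T * B) :
    ∑ a, ∑ b, (F'.G t)⁻¹ a b * T' a b = ∑ a, ∑ b, (F.G t)⁻¹ a b * T a b := by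
  have h1 : ∀ (F : InvFrame ι) (T : ι → ι → ℝ), ∑ a, ∑ b, (F.G t)⁻¹ a b * T a b =
      ((F.G t)⁻¹.transpose * Matrix.of T).trace := fun F T => by
    simp only [Matrix.trace, Matrix.diag, Matrix.mul_apply, Matrix.transpose_apply, Matrix.of_apply]
    exact Finset.sum_comm
  rw [h1, h1, hT, h.inv_G]
  simp only [Matrix.transpose_mul, Matrix.transpose_transpose, Matrix.mul_assoc]
  rw [Matrix.trace_mul_comm]
  simp only [Matrix.mul_assoc]
  rw [h.mul_inv, Matrix.mul_one, h.cancel_transpose]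

theorem IsChange.scalar (h : IsChange F F' B B') (hF : F.IsRegularOn U) (ht : t ∈ U) :
    F'.scalar t = F.scalar t :=
  h.sum_inv_mul (h.ricci hF ht)

theorem IsChange.normSq (h : IsChange F F' B B') {T T' : ι → ι → ℝ}
    (hT : Matrix.of T' = B.transpose * Matrix.of T * B) : F'.normSq T' t = F.normSq T t := by
  have h1 : ∀ (F : InvFrame ι) (T : ι → ι → ℝ), F.normSq T t =
      ((F.G t)⁻¹.transpose * (Matrix.of T * ((F.G t)⁻¹ * (Matrix.of T).transpose))).trace := by
    intro F T
    simp only [InvFrame.normSq, Matrix.trace, Matrix.diag, Matrix.mul_apply,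
      Matrix.transpose_apply, Matrix.of_apply, Finset.mul_sum]
    have : ∀ a, ∑ b, ∑ c, ∑ d, (F.G t)⁻¹ a c * (F.G t)⁻¹ b d * T a b * T c d =
      ∑ c, ∑ b, ∑ d, (F.G t)⁻¹ a c * (F.G t)⁻¹ b d * T a b * T c d := fun a => Finset.sum_comm
    simp only [this]
    rw [Finset.sum_comm]
    exact Finset.sum_congr rfl fun c _ => Finset.sum_congr rfl fun a _ =>
      Finset.sum_congr rfl fun b _ => Finset.sum_congr rfl fun d _ => by ring
  rw [h1, h1, hT, h.inv_G]
  simp only [Matrix.transpose_mul, Matrix.transpose_transpose, Matrix.mul_assoc, h.cancel,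
    h.cancel_transpose]
  rw [Matrix.trace_mul_comm]
  simp only [Matrix.mul_assoc, h.mul_inv, Matrix.mul_one]

theorem IsChange.einstein (h : IsChange F F' B B') (hF : F.IsRegularOn U) (ht : t ∈ U) :
    (Matrix.of fun a b => F'.einstein a b t) =
      B.transpose * (Matrix.of fun a b => F.einstein a b t) * B := by
  have h1 : ∀ F : InvFrame ι, (Matrix.of fun a b => F.einstein a b t) =
      (Matrix.of fun b d => F.ricci b d t) - (1 / 2 * F.scalar t) • F.G t := fun F => by
    ext a b; simp [InvFrame.einstein]
  rw [h1, h1, h.ricci hF ht, h.scalar hF ht, h.G_eq, Matrix.mul_sub, Matrix.sub_mul,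
    Matrix.mul_smul, Matrix.smul_mul]

end Change
end InvFrame

open Matrix

/-! ### Invariance of a model under automorphisms of the Lie algebra -/

section Components

variable (g : ℝ → Matrix (Fin 3) (Fin 3) ℝ)

@[simp] theorem spacetimeFrame_G_zero_zero (t : ℝ) : (spacetimeFrame g).G t 0 0 = -1 := rfl
@[simp] theorem spacetimeFrame_G_zero_succ (t : ℝ) (j : Fin 3) :
    (spacetimeFrame g).G t 0 j.succ = 0 := by fin_cases j <;> rfl
@[simp] theorem spacetimeFrame_G_succ_zero (t : ℝ) (i : Fin 3) :
    (spacetimeFrame g).G t i.succ 0 = 0 := by fin_cases i <;> rfl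
@[simp] theorem spacetimeFrame_G_succ_succ (t : ℝ) (i j : Fin 3) :
    (spacetimeFrame g).G t i.succ j.succ = g t i j := by fin_cases i <;> fin_cases j <;> rfl
@[simp] theorem spacetimeFrame_D_zero : (spacetimeFrame g).D 0 = 1 := rfl
@[simp] theorem spacetimeFrame_D_succ (i : Fin 3) : (spacetimeFrame g).D i.succ = 0 := by
  simp [spacetimeFrame]
@[simp] theorem spacetimeFrame_C_zero (a b : Fin 4) : (spacetimeFrame g).C 0 a b = 0 := by
  simp [spacetimeFrame]
@[simp] theorem spacetimeFrame_C_fst_zero (c b : Fin 4) : (spacetimeFrame g).C c 0 b = 0 := by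
  simp [spacetimeFrame]
@[simp] theorem spacetimeFrame_C_snd_zero (c a : Fin 4) : (spacetimeFrame g).C c a 0 = 0 := by
  simp [spacetimeFrame]
@[simp] theorem spacetimeFrame_C_succ (k i j : Fin 3) :
    (spacetimeFrame g).C k.succ i.succ j.succ = structVII0 k i j := by
  fin_cases k <;> fin_cases i <;> fin_cases j <;> simp [spacetimeFrame, structVII0]

end Components

/-- The matrix `u^a u^b`. -/
def timeProj : Matrix (Fin 4) (Fin 4) ℝ := Matrix.single 0 0 1

/-- The block matrix `1 ⊕ B` of a change of the spatial frame that keeps `∂_t`. -/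
def lift (B : Matrix (Fin 3) (Fin 3) ℝ) : Matrix (Fin 4) (Fin 4) ℝ :=
  Matrix.of fun a b => Fin.cases (Fin.cases 1 (fun _ => 0) b) (fun i => Fin.cases 0 (B i) b) a

section Lift
variable (B : Matrix (Fin 3) (Fin 3) ℝ)
@[simp] theorem lift_zero_zero : lift B 0 0 = 1 := rfl
@[simp] theorem lift_zero_succ (j : Fin 3) : lift B 0 j.succ = 0 := rfl
@[simp] theorem lift_succ_zero (i : Fin 3) : lift B i.succ 0 = 0 := rfl
@[simp] theorem lift_succ_succ (i j : Fin 3) : lift B i.succ j.succ = B i j := rfl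
theorem lift_zero_left (b : Fin 4) : lift B 0 b = if b = 0 then 1 else 0 := by
  induction b using Fin.cases <;> simp
theorem lift_zero_right (a : Fin 4) : lift B a 0 = if a = 0 then 1 else 0 := by
  induction a using Fin.cases <;> simp

theorem lift_mul (B B' : Matrix (Fin 3) (Fin 3) ℝ) : lift B * lift B' = lift (B * B') := by
  ext a b
  induction a using Fin.cases <;> induction b using Fin.cases <;>
    simp [Matrix.mul_apply, Fin.sum_univ_succ]

theorem lift_one : lift 1 = 1 := by
  ext a b
  induction a using Fin.cases <;> induction b using Fin.cases <;>
    simp [Matrix.one_apply, Fin.succ_ne_zero, (Fin.succ_ne_zero _).symm]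

theorem lift_transpose : (lift B).transpose = lift B.transpose := by
  ext a b
  induction a using Fin.cases <;> induction b using Fin.cases <;> simp

theorem lift_mul_timeProj : lift B * timeProj = timeProj := by
  ext a b
  induction a using Fin.cases <;> induction b using Fin.cases <;>
    simp [Matrix.mul_apply, Fin.sum_univ_succ (n := 3), timeProj,
      (Fin.succ_ne_zero _).symm]

theorem timeProj_mul_lift : timeProj * lift B = timeProj := by
  ext a b
  induction a using Fin.cases <;> induction b using Fin.cases <;>
    simp [Matrix.mul_apply, Fin.sum_univ_succ (n := 3), timeProj,
      (Fin.succ_ne_zero _).symm]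

theorem det_lift : (lift B).det = B.det := by
  rw [Matrix.det_succ_row_zero, Fin.sum_univ_succ]
  simp
  rfl
end Lift

/-- The matrix `B`, with inverse `B'`, is a unimodular automorphism `e_a ↦ ∑ i, B i a • e_i` of the
Bianchi VII₀ Lie algebra. -/
structure IsAut (B B' : Matrix (Fin 3) (Fin 3) ℝ) : Prop where
  mul_inv : B * B' = 1
  det_eq : B.det = 1
  struct_eq : ∀ k a b, ∑ c, B k c * structVII0 c a b =
    ∑ i, ∑ j, B i a * B j b * structVII0 k i j

variable {B B' : Matrix (Fin 3) (Fin 3) ℝ} (g : ℝ → Matrix (Fin 3) (Fin 3) ℝ)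

theorem IsAut.isChange_space (h : IsAut B B') :
    (spaceFrame g).IsChange (spaceFrame fun t => B.transpose * g t * B) B B' where
  mul_inv := h.mul_inv
  D_eq := by simp [spaceFrame]
  C_eq := h.struct_eq
  G_eq _ := rfl

theorem IsAut.isChange_spacetime (h : IsAut B B') :
    (spacetimeFrame g).IsChange (spacetimeFrame fun t => B.transpose * g t * B)
      (lift B) (lift B') where
  mul_inv := by rw [lift_mul, h.mul_inv, lift_one]
  D_eq a := by induction a using Fin.cases <;> simp [Fin.sum_univ_succ (n := 3)]
  C_eq k a b := by
    induction k using Fin.cases <;> induction a using Fin.cases <;> induction b using Fin.cases <;>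
      simp [Fin.sum_univ_succ (n := 3), h.struct_eq]
  G_eq t := by
    ext a b
    induction a using Fin.cases <;> induction b using Fin.cases <;>
      simp [Fin.sum_univ_succ (n := 3), Matrix.mul_apply]

namespace Model
variable (m : Model)

theorem isRegularOn_space : (spaceFrame m.g).IsRegularOn (Ioi m.t₀) where
  isOpen := isOpen_Ioi
  contDiffOn := m.contDiffOn
  det_ne_zero t ht := (m.posDef t ht).det_pos.ne'

theorem det_spacetime_G (g : ℝ → Matrix (Fin 3) (Fin 3) ℝ) (t : ℝ) :
    ((spacetimeFrame g).G t).det = -(g t).det := by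
  rw [Matrix.det_succ_row_zero, Fin.sum_univ_succ]
  have : ((spacetimeFrame g).G t).submatrix Fin.succ Fin.succ = g t := by
    ext i j; simp
  simp [this]

theorem isRegularOn_frame : m.frame.IsRegularOn (Ioi m.t₀) where
  isOpen := isOpen_Ioi
  contDiffOn a b := by
    unfold frame
    induction a using Fin.cases <;> induction b using Fin.cases <;>
      simp [contDiffOn_const, m.contDiffOn]
  det_ne_zero t ht := by
    rw [frame, det_spacetime_G]
    exact neg_ne_zero.mpr (m.posDef t ht).det_pos.ne'

theorem uLow_eq (a : Fin 4) (t : ℝ) : m.uLow a t = if a = 0 then -1 else 0 := by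
  unfold uLow fluidULow
  induction a using Fin.cases <;> simp [fluidU]

theorem gradU_eq (a b : Fin 4) (t : ℝ) : m.gradU a b t = m.frame.conn 0 a b t := by
  have : m.uLow b = fun _ => if b = 0 then -1 else 0 := funext (m.uLow_eq b)
  simp [gradU, this, InvFrame.ed, uLow_eq]

theorem proj_eq (a b : Fin 4) (t : ℝ) :
    m.proj a b t = (1 - timeProj) a b := by
  unfold proj
  induction a using Fin.cases <;> induction b using Fin.cases <;>
    simp [fluidU, timeProj, uLow_eq, Matrix.one_apply, Fin.succ_ne_zero,
      (Fin.succ_ne_zero _).symm]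

/-- The part of a model after the time `t₁`. -/
def restrict (t₁ : ℝ) (h : m.t₀ ≤ t₁) : Model where
  t₀ := t₁
  g := m.g
  μ := m.μ
  contDiffOn i j := (m.contDiffOn i j).mono (Ioi_subset_Ioi h)
  posDef t ht := m.posDef t (h.trans_lt ht)
  mu_pos t ht := m.mu_pos t (h.trans_lt ht)
  einstein_eq t ht := m.einstein_eq t (h.trans_lt ht)

/-- The model in the invariant frame `e'_a = ∑ i, B i a • e_i`. -/
def change (h : IsAut B B') : Model where
  t₀ := m.t₀
  g := fun t => B.transpose * m.g t * B
  μ := m.μ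
  contDiffOn i j := by
    simp only [Matrix.mul_apply]
    exact ContDiffOn.sum fun l _ => (ContDiffOn.sum fun k _ =>
      contDiffOn_const.mul (m.contDiffOn k l)).mul contDiffOn_const
  posDef t ht := by
    have := (m.posDef t ht).conjTranspose_mul_mul_same (B := B) ?_
    · simpa using this
    · exact Matrix.mulVec_injective_of_isUnit
        (by rw [Matrix.isUnit_iff_isUnit_det, h.det_eq]; exact isUnit_one)
  mu_pos := m.mu_pos
  einstein_eq t ht a b := by
    have hc := h.isChange_spacetime m.g
    have h1 := congrFun (congrFun (hc.einstein m.isRegularOn_frame ht) a) b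
    have h2 : ∀ m' : ℝ → Matrix (Fin 3) (Fin 3) ℝ, (Matrix.of fun a b =>
      m.μ t * fluidULow m' a t * fluidULow m' b t
        + (m.μ t / 3) * ((spacetimeFrame m').G t a b + fluidULow m' a t * fluidULow m' b t)) =
        (4 * m.μ t / 3) • timeProj + (m.μ t / 3) • (spacetimeFrame m').G t :=
      fun m' => by
        ext a b
        unfold fluidULow
        induction a using Fin.cases <;> induction b using Fin.cases <;>
          simp [fluidU, timeProj, (Fin.succ_ne_zero _).symm] <;> ring
    have h3 : (Matrix.of fun a b => (spacetimeFrame m.g).einstein a b t) =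
        (4 * m.μ t / 3) • timeProj + (m.μ t / 3) • (spacetimeFrame m.g).G t := by
      rw [← h2]
      ext a b
      exact m.einstein_eq t ht a b
    rw [h3, Matrix.mul_add, Matrix.add_mul, Matrix.mul_smul, Matrix.smul_mul, Matrix.mul_smul,
      Matrix.smul_mul, ← hc.G_eq, lift_transpose, lift_mul_timeProj, timeProj_mul_lift] at h1
    have h4 := congrFun (congrFun (h2 (fun t => B.transpose * m.g t * B)) a) b
    simp only [Matrix.of_apply] at h1 h4
    rw [h1, h4]

section Invariance

variable (h : IsAut B B') {t : ℝ}

theorem isChange_frame : m.frame.IsChange (m.change h).frame (lift B) (lift B') :=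
  h.isChange_spacetime m.g

theorem change_gradU (ht : m.t₀ < t) :
    (Matrix.of fun a b => (m.change h).gradU a b t) =
      (lift B).transpose * (Matrix.of fun a b => m.gradU a b t) * lift B := by
  ext a b
  have h1 := congrFun (congrFun ((m.isChange_frame h).connMat m.isRegularOn_frame ht a) 0) b
  simp only [InvFrame.connMat, Matrix.of_apply, Matrix.sum_apply, Matrix.smul_apply,
    Matrix.mul_apply, lift_zero_left, smul_eq_mul] at h1
  simp only [gradU_eq, Matrix.of_apply, Matrix.mul_apply, h1, Matrix.transpose_apply]
  simp only [ite_mul, one_mul, zero_mul, Finset.sum_ite_eq', Finset.mem_univ,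
    if_true, Finset.mul_sum, Finset.sum_mul]
  rw [Finset.sum_comm]
  exact Finset.sum_congr rfl fun i _ => Finset.sum_congr rfl fun j _ => by ring

theorem change_H (ht : m.t₀ < t) : (m.change h).H t = m.H t := by
  unfold H
  rw [(m.isChange_frame h).sum_inv_mul (m.change_gradU h ht)]

theorem change_Omega (ht : m.t₀ < t) : (m.change h).Omega t = m.Omega t := by
  unfold Omega
  rw [m.change_H h ht]
  rfl

theorem shear_eq (t : ℝ) : (Matrix.of fun a b => m.shear a b t) =
    (1 - timeProj).transpose * ((1 / 2 : ℝ) • ((Matrix.of fun a b => m.gradU a b t) +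
      (Matrix.of fun a b => m.gradU a b t).transpose)) * (1 - timeProj)
      - m.H t • (m.frame.G t + timeProj) := by
  have h1 : ∀ a b, m.uLow a t * m.uLow b t = timeProj a b :=
    fun a b => by
      induction a using Fin.cases <;> induction b using Fin.cases <;>
        simp [uLow_eq, timeProj, (Fin.succ_ne_zero _).symm]
  have h2 : ∀ a b, m.proj a b t = (1 - timeProj) a b := fun a b => m.proj_eq a b t
  generalize (1 - timeProj) = P at h2 ⊢
  ext a b
  simp only [Matrix.of_apply, shear, Matrix.sub_apply, Matrix.smul_apply, Matrix.add_apply, h1,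
    smul_eq_mul, h2]
  congr 1
  rw [Matrix.mul_apply]
  simp only [Matrix.mul_apply, Finset.sum_mul, Matrix.transpose_apply, Matrix.smul_apply,
    Matrix.add_apply, Matrix.of_apply, smul_eq_mul]
  rw [Finset.sum_comm]
  exact Finset.sum_congr rfl fun i _ => Finset.sum_congr rfl fun j _ => by ring

theorem change_shearScalar (ht : m.t₀ < t) :
    (m.change h).shearScalar t = m.shearScalar t := by
  unfold shearScalar
  rw [m.change_H h ht, (m.isChange_frame h).normSq (T := fun a b => m.shear a b t)]
  have h1 : lift B * (1 - timeProj) = (1 - timeProj) * lift B := by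
    rw [Matrix.mul_sub, Matrix.sub_mul, lift_mul_timeProj, timeProj_mul_lift, Matrix.mul_one,
      Matrix.one_mul]
  have h2 := congrArg Matrix.transpose h1
  rw [Matrix.transpose_mul, Matrix.transpose_mul] at h2
  have h3 : (lift B).transpose * timeProj * lift B = timeProj := by
    rw [lift_transpose, lift_mul_timeProj, timeProj_mul_lift]
  have h4 : (Matrix.of fun a b => (m.change h).gradU a b t) +
      (Matrix.of fun a b => (m.change h).gradU a b t).transpose =
      (lift B).transpose * ((Matrix.of fun a b => m.gradU a b t) +
      (Matrix.of fun a b => m.gradU a b t).transpose) * lift B := by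
    rw [m.change_gradU h ht]
    simp only [Matrix.transpose_mul, Matrix.transpose_transpose, Matrix.mul_add, Matrix.add_mul,
      Matrix.mul_assoc]
  rw [shear_eq, shear_eq]
  generalize (1 - timeProj) = P at h1 h2 ⊢
  rw [m.change_H h ht, h4, (m.isChange_frame h).G_eq, Matrix.mul_sub,
    Matrix.sub_mul]
  congr 1
  · simp only [Matrix.mul_smul, Matrix.smul_mul, Matrix.mul_assoc, h1]
    simp only [← Matrix.mul_assoc, h2]
  · rw [Matrix.mul_smul, Matrix.smul_mul, Matrix.mul_add, Matrix.add_mul, h3]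

theorem change_curvScalar (ht : m.t₀ < t) : (m.change h).curvScalar t = m.curvScalar t := by
  have hc := h.isChange_space m.g
  have h1 := hc.ricci m.isRegularOn_space ht
  have h2 := hc.scalar m.isRegularOn_space ht
  unfold curvScalar
  rw [m.change_H h ht]
  congr 2
  refine hc.normSq ?_
  have h3 : ∀ m : Model, (Matrix.of fun i j => m.ricciTF i j t) =
      (Matrix.of fun i j => (spaceFrame m.g).ricci i j t) -
        (1 / 3 * (spaceFrame m.g).scalar t) • m.g t := fun m => by
    ext i j; simp [ricciTF, space]
  rw [h3, h3]
  erw [h1, h2]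
  rw [Matrix.mul_sub, Matrix.sub_mul, Matrix.mul_smul, Matrix.smul_mul]
  rfl

/-- The definition of `E_{ab}` in terms of matrices, with `C` expanded. -/
theorem elWeyl_eq (t : ℝ) : (Matrix.of fun a b => m.elWeyl a b t) =
    (Matrix.of fun a b => m.frame.riemLow a 0 b 0 t)
      - (1 / 2 : ℝ) • (m.frame.ricci 0 0 t • m.frame.G t
        - m.frame.G t * timeProj * (Matrix.of fun a b => m.frame.ricci a b t)
        - (Matrix.of fun a b => m.frame.ricci a b t) * timeProj * m.frame.G t
        - (Matrix.of fun a b => m.frame.ricci a b t))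
      + (1 / 6 * m.frame.scalar t) • (-m.frame.G t
        - m.frame.G t * timeProj * m.frame.G t) := by
  ext a b
  simp only [Matrix.of_apply, elWeyl, InvFrame.weyl, fluidU, mul_ite, mul_one, mul_zero,
    Finset.sum_ite_eq', Finset.mem_univ, if_true]
  have h1 : ∀ M N : Matrix (Fin 4) (Fin 4) ℝ, (M * timeProj * N) a b =
      M a 0 * N 0 b := fun M N => by
    simp [Matrix.mul_apply, Fin.sum_univ_succ (n := 3), timeProj,
      (Fin.succ_ne_zero _).symm]
  have h2 : m.frame.G t 0 0 = -1 := rfl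
  simp only [Matrix.sub_apply, Matrix.add_apply, Matrix.smul_apply, Matrix.neg_apply, smul_eq_mul,
    h1, Matrix.of_apply, h2]
  ring

theorem riemLow_eq (F : InvFrame (Fin 4)) (a b c d : Fin 4) (t : ℝ) :
    F.riemLow a b c d t = (F.G t * F.riemMat c d t) a b := by
  simp [InvFrame.riemLow, Matrix.mul_apply, InvFrame.riemMat]

theorem change_riemLow (ht : m.t₀ < t) (k l b : Fin 4) :
    (m.change h).frame.riemLow k l b 0 t =
      ∑ i, lift B i b * ∑ p, ∑ q, lift B p k * lift B q l * m.frame.riemLow p q i 0 t := by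
  have hc := m.isChange_frame h
  rw [riemLow_eq, hc.riemMat m.isRegularOn_frame ht, hc.G_eq, Finset.mul_sum, Matrix.sum_apply]
  refine Finset.sum_congr rfl fun i _ => ?_
  have h1 : ∑ j, (lift B i b * lift B j 0) • (lift B' * m.frame.riemMat i j t * lift B) =
      lift B i b • (lift B' * m.frame.riemMat i 0 t * lift B) := by
    simp [Fin.sum_univ_succ (n := 3)]
  rw [h1, Matrix.mul_smul, Matrix.smul_apply, smul_eq_mul]
  simp only [Matrix.mul_assoc, hc.cancel]
  congr 1
  rw [Matrix.mul_apply]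
  refine Finset.sum_congr rfl fun p _ => ?_
  rw [← Matrix.mul_assoc, Matrix.mul_apply, Finset.mul_sum]
  refine Finset.sum_congr rfl fun q _ => ?_
  rw [riemLow_eq, Matrix.transpose_apply]
  ring

theorem change_elWeyl (ht : m.t₀ < t) : (Matrix.of fun a b => (m.change h).elWeyl a b t) =
    (lift B).transpose * (Matrix.of fun a b => m.elWeyl a b t) * lift B := by
  have hc := m.isChange_frame h
  have h1 : (Matrix.of fun a b => (m.change h).frame.riemLow a 0 b 0 t) =
      (lift B).transpose * (Matrix.of fun a b => m.frame.riemLow a 0 b 0 t) * lift B := by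
    ext a b
    simp only [Matrix.of_apply, m.change_riemLow h ht, Matrix.mul_apply, Matrix.transpose_apply,
      Finset.sum_mul, Finset.mul_sum]
    refine Finset.sum_congr rfl fun i _ => Finset.sum_congr rfl fun p _ => ?_
    simp only [lift_zero_right, mul_ite, mul_zero, ite_mul, zero_mul, mul_one,
      Finset.sum_ite_eq', Finset.mem_univ, if_true]
    ring
  have h2 := hc.ricci m.isRegularOn_frame ht
  have h3 := hc.scalar m.isRegularOn_frame ht
  have h4 : (m.change h).frame.ricci 0 0 t = m.frame.ricci 0 0 t := by
    have := congrFun (congrFun h2 0) 0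
    simpa [Matrix.mul_apply, lift_zero_right] using this
  have hP : ∀ X Y : Matrix (Fin 4) (Fin 4) ℝ,
      (lift B).transpose * X * lift B * timeProj * ((lift B).transpose * Y * lift B) =
      (lift B).transpose * (X * timeProj * Y) * lift B := fun X Y => by
    rw [lift_transpose]
    simp only [Matrix.mul_assoc]
    rw [← Matrix.mul_assoc timeProj, timeProj_mul_lift, ← Matrix.mul_assoc (lift B),
      lift_mul_timeProj]
  rw [elWeyl_eq, elWeyl_eq, h1, h2, h3, h4, hc.G_eq]
  simp only [hP, Matrix.mul_neg, Matrix.neg_mul, Matrix.mul_smul, Matrix.smul_mul,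
    Matrix.mul_sub, Matrix.sub_mul, Matrix.mul_add, Matrix.add_mul]

/-- The transformation of the Weyl components `C_{klb0}`, which determine the magnetic part. -/
theorem change_weyl (ht : m.t₀ < t) (k l b : Fin 4) :
    (m.change h).frame.weyl k l b 0 t =
      ∑ i, lift B i b * ∑ p, ∑ q, lift B p k * lift B q l * m.frame.weyl p q i 0 t := by
  have hc := m.isChange_frame h
  have hR : ∀ a b, (m.change h).frame.ricci a b t =
      ∑ i, ∑ j, lift B i a * lift B j b * m.frame.ricci i j t := fun a b => by
    have := congrFun (congrFun (hc.ricci m.isRegularOn_frame ht) a) b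
    simp only [Matrix.of_apply, Matrix.mul_assoc] at this
    rw [this, Matrix.mul_apply]
    refine Finset.sum_congr rfl fun i _ => ?_
    rw [Matrix.mul_apply, Finset.mul_sum]
    exact Finset.sum_congr rfl fun j _ => by rw [Matrix.transpose_apply, Matrix.of_apply]; ring
  have hG := hc.G_apply t
  have hcol : ∀ (T : Fin 4 → Fin 4 → ℝ) a, ∑ i, ∑ j, lift B i a * lift B j 0 * T i j =
      ∑ i, lift B i a * T i 0 := fun T a => by
    simp [lift_zero_right]
  -- The products of the metric and the Ricci tensor in `C_{klb0}` with the index `0` on the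
  -- second factor, and then on the first.
  have hprod : ∀ S T : Fin 4 → Fin 4 → ℝ,
      (∑ i, ∑ j, lift B i k * lift B j b * S i j) * (∑ i, ∑ j, lift B i l * lift B j 0 * T i j) =
      ∑ i, lift B i b * ∑ p, ∑ q, lift B p k * lift B q l * (S p i * T q 0) := fun S T => by
    rw [hcol, Finset.sum_comm, Finset.sum_mul]
    refine Finset.sum_congr rfl fun i _ => ?_
    rw [Finset.sum_mul_sum, Finset.mul_sum]
    refine Finset.sum_congr rfl fun p _ => ?_
    rw [Finset.mul_sum]
    exact Finset.sum_congr rfl fun q _ => by ring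
  have hprod' : ∀ S T : Fin 4 → Fin 4 → ℝ,
      (∑ i, ∑ j, lift B i k * lift B j 0 * S i j) * (∑ i, ∑ j, lift B i l * lift B j b * T i j) =
      ∑ i, lift B i b * ∑ p, ∑ q, lift B p k * lift B q l * (S p 0 * T q i) := fun S T => by
    rw [hcol, Finset.sum_comm (f := fun i j => lift B i l * lift B j b * T i j), Finset.mul_sum]
    refine Finset.sum_congr rfl fun i _ => ?_
    rw [Finset.sum_mul_sum, Finset.mul_sum]
    refine Finset.sum_congr rfl fun p _ => ?_
    rw [Finset.mul_sum]
    exact Finset.sum_congr rfl fun q _ => by ring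
  simp only [InvFrame.weyl, m.change_riemLow h ht, hR, hG, hc.scalar m.isRegularOn_frame ht]
  have p1 := hprod (m.frame.G t) fun i j => m.frame.ricci i j t
  have p2 := hprod' (m.frame.G t) fun i j => m.frame.ricci i j t
  have p3 := hprod' (fun i j => m.frame.ricci i j t) (m.frame.G t)
  have p4 := hprod (fun i j => m.frame.ricci i j t) (m.frame.G t)
  have p5 := hprod (m.frame.G t) (m.frame.G t)
  have p6 := hprod' (m.frame.G t) (m.frame.G t)
  rw [mul_comm] at p3 p4
  simp only [p1, p2, p3, p4, p5, p6]
  simp only [Finset.mul_sum, ← Finset.sum_add_distrib, ← Finset.sum_sub_distrib]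
  exact Finset.sum_congr rfl fun i _ => Finset.sum_congr rfl fun p _ =>
    Finset.sum_congr rfl fun q _ => by ring

/-- The determinant with second row `∂_t` is, up to sign, a spatial triple product. -/
theorem det_rows (u v w : Fin 4 → ℝ) :
    Matrix.det (Matrix.of ![u, Pi.single 0 1, v, w]) =
      -(u 1 * (v 2 * w 3 - v 3 * w 2) - u 2 * (v 1 * w 3 - v 3 * w 1)
        + u 3 * (v 1 * w 2 - v 2 * w 1)) := by
  rw [Matrix.det_succ_row_zero]
  simp [Fin.sum_univ_succ, Matrix.det_fin_three, Fin.succAbove, Matrix.submatrix]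
  ring

theorem vol_eq (F : InvFrame (Fin 4)) (a e f : Fin 4) (t : ℝ) :
    F.vol a 0 e f t = Real.sqrt |(F.G t).det| * Matrix.det (Matrix.of
      ![(Pi.single a 1 : Fin 4 → ℝ), Pi.single 0 1, Pi.single e 1, Pi.single f 1]) := by
  unfold InvFrame.vol
  congr 2
  ext i j
  fin_cases i <;> simp [Pi.single_apply, eq_comm] <;> congr

/-- The alternating symbol is invariant under unimodular changes of the spatial frame. -/
theorem change_vol (a e f : Fin 4) :
    (m.change h).frame.vol a 0 e f t =
      ∑ i, lift B i a * ∑ p, ∑ q, lift B p e * lift B q f * m.frame.vol i 0 p q t := by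
  have hdet : ((m.change h).frame.G t).det = (m.frame.G t).det := by
    rw [(m.isChange_frame h).G_eq, Matrix.det_mul, Matrix.det_mul, Matrix.det_transpose, det_lift,
      h.det_eq, one_mul, mul_one]
  have h1 : ∑ i, lift B i a * ∑ p, ∑ q, lift B p e * lift B q f * Matrix.det (Matrix.of
      ![(Pi.single i 1 : Fin 4 → ℝ), Pi.single 0 1, Pi.single p 1, Pi.single q 1]) =
      Matrix.det (Matrix.of ![fun i => lift B i a, Pi.single 0 1, fun i => lift B i e,
        fun i => lift B i f]) := by
    simp only [det_rows, Fin.sum_univ_four]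
    simp
    ring
  have h2 : Matrix.of ![fun i => lift B i a, Pi.single 0 1, fun i => lift B i e,
        fun i => lift B i f] = Matrix.of
      ![(Pi.single a 1 : Fin 4 → ℝ), Pi.single 0 1, Pi.single e 1, Pi.single f 1] *
      (lift B).transpose := by
    ext i j
    fin_cases i <;> simp [Matrix.mul_apply, lift_zero_right, Pi.single_apply]
  rw [h2, Matrix.det_mul, Matrix.det_transpose, det_lift, h.det_eq, mul_one] at h1
  simp only [vol_eq, hdet, ← h1, Finset.mul_sum]
  exact Finset.sum_congr rfl fun i _ => Finset.sum_congr rfl fun p _ =>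
    Finset.sum_congr rfl fun q _ => by ring

theorem magWeyl_eq (a b : Fin 4) (t : ℝ) : m.magWeyl a b t =
    1 / 2 * ((Matrix.of fun e f => m.frame.vol a 0 e f t).transpose * ((m.frame.G t)⁻¹ *
      ((Matrix.of fun k l => m.frame.weyl k l b 0 t) * (m.frame.G t)⁻¹.transpose))).trace := by
  simp only [magWeyl, InvFrame.dualWeyl, fluidU, mul_ite, mul_one, mul_zero,
    Finset.sum_ite_eq', Finset.mem_univ, if_true]
  congr 1
  simp only [Matrix.trace, Matrix.diag, Matrix.mul_apply, Matrix.transpose_apply, Matrix.of_apply,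
    Finset.mul_sum]
  rw [Finset.sum_comm]
  exact Finset.sum_congr rfl fun f _ => Finset.sum_congr rfl fun e _ =>
    Finset.sum_congr rfl fun k _ => Finset.sum_congr rfl fun l _ => by ring

theorem change_magWeyl (ht : m.t₀ < t) : (Matrix.of fun a b => (m.change h).magWeyl a b t) =
    (lift B).transpose * (Matrix.of fun a b => m.magWeyl a b t) * lift B := by
  have hc := m.isChange_frame h
  have hsum : ∀ (c : Fin 4) (T : Fin 4 → Fin 4 → Fin 4 → ℝ),
      (Matrix.of fun k l => ∑ i, lift B i c * ∑ p, ∑ q, lift B p k * lift B q l * T i p q) =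
      ∑ i, lift B i c • ((lift B).transpose * Matrix.of (T i) * lift B) := fun c T => by
    ext k l
    simp only [Matrix.of_apply, Matrix.sum_apply, Matrix.smul_apply, smul_eq_mul]
    refine Finset.sum_congr rfl fun i _ => ?_
    rw [Matrix.mul_assoc, Matrix.mul_apply]
    congr 1
    refine Finset.sum_congr rfl fun p _ => ?_
    rw [Matrix.mul_apply, Finset.mul_sum]
    exact Finset.sum_congr rfl fun q _ => by rw [Matrix.transpose_apply, Matrix.of_apply]; ring
  have hV : ∀ a, (Matrix.of fun e f => (m.change h).frame.vol a 0 e f t) =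
      ∑ i, lift B i a • ((lift B).transpose * (Matrix.of fun e f => m.frame.vol i 0 e f t) *
        lift B) := fun a => by
    simp only [m.change_vol h, hsum a fun i e f => m.frame.vol i 0 e f t]
  have hW : ∀ b, (Matrix.of fun k l => (m.change h).frame.weyl k l b 0 t) =
      ∑ i, lift B i b • ((lift B).transpose * (Matrix.of fun k l => m.frame.weyl k l i 0 t) *
        lift B) := fun b => by
    simp only [m.change_weyl h ht, hsum b fun i k l => m.frame.weyl k l i 0 t]
  have hT : ∀ V W : Matrix (Fin 4) (Fin 4) ℝ, (((lift B).transpose * V * lift B).transpose *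
      (((m.change h).frame.G t)⁻¹ * (((lift B).transpose * W * lift B) *
        ((m.change h).frame.G t)⁻¹.transpose))).trace =
      (V.transpose * ((m.frame.G t)⁻¹ * (W * (m.frame.G t)⁻¹.transpose))).trace := fun V W => by
    rw [hc.inv_G]
    simp only [Matrix.transpose_mul, Matrix.transpose_transpose, Matrix.mul_assoc, hc.cancel,
      hc.cancel_transpose]
    rw [Matrix.trace_mul_comm]
    simp only [Matrix.mul_assoc]
    rw [← Matrix.transpose_mul, hc.mul_inv, Matrix.transpose_one, Matrix.mul_one]
  ext a b
  simp only [Matrix.of_apply, magWeyl_eq]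
  rw [hV, hW, Matrix.transpose_sum]
  simp only [Matrix.transpose_smul, Finset.sum_mul, Finset.mul_sum, Matrix.smul_mul,
    Matrix.mul_smul, Matrix.trace_sum, Matrix.trace_smul, hT, smul_eq_mul, Matrix.mul_apply,
    Matrix.of_apply, Matrix.transpose_apply]
  exact Finset.sum_congr rfl fun i _ => Finset.sum_congr rfl fun p _ => by ring

theorem change_weylScalar (ht : m.t₀ < t) : (m.change h).weylScalar t = m.weylScalar t := by
  have hc := m.isChange_frame h
  unfold weylScalar
  rw [m.change_H h ht, hc.normSq (m.change_elWeyl h ht), hc.normSq (m.change_magWeyl h ht)]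

end Invariance

end Model

namespace Model
variable (m : Model) {t : ℝ}

/-! ### The connection and the Ricci tensor of the spacetime -/

/-- The mixed components `K^i_j` of the extrinsic curvature of the hypersurfaces of constant `t`. -/
def extr (i j : Fin 3) (t : ℝ) : ℝ :=
  ∑ k, (m.g t)⁻¹ i k * (1 / 2 * deriv (fun s => m.g s k j) t)

theorem g_symm (ht : m.t₀ < t) (i j : Fin 3) : m.g t i j = m.g t j i := by
  have := congrFun (congrFun (m.posDef t ht).isHermitian i) j
  simpa using this.symm

theorem deriv_g_symm (ht : m.t₀ < t) (i j : Fin 3) :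
    deriv (fun s => m.g s i j) t = deriv (fun s => m.g s j i) t := by
  refine Filter.EventuallyEq.deriv_eq ?_
  filter_upwards [Ioi_mem_nhds ht] with s hs using m.g_symm hs i j

theorem inv_g_symm (ht : m.t₀ < t) (i j : Fin 3) : (m.g t)⁻¹ i j = (m.g t)⁻¹ j i := by
  have h : (m.g t).transpose = m.g t := by ext i j; exact m.g_symm ht j i
  have := congrFun (congrFun (Matrix.transpose_nonsing_inv (m.g t)) i) j
  rw [h, Matrix.transpose_apply] at this
  exact this.symm

theorem isUnit_det_g (ht : m.t₀ < t) : IsUnit (m.g t).det := (m.posDef t ht).det_pos.ne'.isUnit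

/-- The inverse of the spacetime metric. -/
theorem inv_frame_G (ht : m.t₀ < t) : (m.frame.G t)⁻¹ =
    lift (m.g t)⁻¹ - (2 : ℝ) • timeProj := by
  refine Matrix.inv_eq_right_inv ?_
  have h := Matrix.mul_nonsing_inv (m.g t) (m.isUnit_det_g ht)
  ext a b
  unfold frame
  induction a using Fin.cases <;> induction b using Fin.cases
  · simp [Matrix.mul_apply, Fin.sum_univ_succ (n := 3), timeProj]; norm_num
  · simp [Matrix.mul_apply, Fin.sum_univ_succ (n := 3), timeProj,
      (Fin.succ_ne_zero _).symm]
  · simp [Matrix.mul_apply, Fin.sum_univ_succ (n := 3), timeProj,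
      (Fin.succ_ne_zero _).symm, Fin.succ_ne_zero]
  · rename_i i j
    have := congrFun (congrFun h i) j
    simpa [Matrix.mul_apply, Fin.sum_univ_succ (n := 3), timeProj, Matrix.one_apply,
      (Fin.succ_ne_zero _).symm, Fin.succ_ne_zero] using this

theorem inv_frame_G_zero_zero (ht : m.t₀ < t) : (m.frame.G t)⁻¹ 0 0 = -1 := by
  rw [m.inv_frame_G ht]; simp [timeProj]; norm_num

theorem inv_frame_G_zero_succ (ht : m.t₀ < t) (j : Fin 3) : (m.frame.G t)⁻¹ 0 j.succ = 0 := by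
  rw [m.inv_frame_G ht]; simp [timeProj, (Fin.succ_ne_zero _).symm]

theorem inv_frame_G_succ_zero (ht : m.t₀ < t) (j : Fin 3) : (m.frame.G t)⁻¹ j.succ 0 = 0 := by
  rw [m.inv_frame_G ht]; simp [timeProj, (Fin.succ_ne_zero _).symm]

theorem inv_frame_G_succ_succ (ht : m.t₀ < t) (i j : Fin 3) :
    (m.frame.G t)⁻¹ i.succ j.succ = (m.g t)⁻¹ i j := by
  rw [m.inv_frame_G ht]; simp [timeProj, (Fin.succ_ne_zero _).symm]

theorem connLow_zero_fst (c : Fin 4) : m.frame.connLow c 0 0 t = 0 := by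
  unfold frame
  induction c using Fin.cases <;> simp [InvFrame.connLow, InvFrame.ed]

theorem connLow_zero_left (b : Fin 4) : m.frame.connLow 0 0 b t = 0 := by
  unfold frame
  induction b using Fin.cases <;> simp [InvFrame.connLow, InvFrame.ed]

theorem connLow_zero_mid (a : Fin 4) : m.frame.connLow 0 a 0 t = 0 := by
  unfold frame
  induction a using Fin.cases <;> simp [InvFrame.connLow, InvFrame.ed]

theorem connLow_zero_succ (i j : Fin 3) : m.frame.connLow 0 i.succ j.succ t =
    -(1 / 2 * deriv (fun s => m.g s i j) t) := by
  unfold frame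
  simp [InvFrame.connLow, InvFrame.ed, Fin.sum_univ_succ (n := 3)]

theorem connLow_succ_zero (ht : m.t₀ < t) (i j : Fin 3) : m.frame.connLow i.succ 0 j.succ t =
    1 / 2 * deriv (fun s => m.g s i j) t := by
  rw [m.deriv_g_symm ht]
  unfold frame
  simp [InvFrame.connLow, InvFrame.ed, Fin.sum_univ_succ (n := 3)]

theorem connLow_succ_succ_zero (ht : m.t₀ < t) (i j : Fin 3) :
    m.frame.connLow i.succ j.succ 0 t = 1 / 2 * deriv (fun s => m.g s i j) t := by
  rw [m.deriv_g_symm ht]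
  unfold frame
  simp [InvFrame.connLow, InvFrame.ed, Fin.sum_univ_succ (n := 3)]

theorem connLow_succ (i j k : Fin 3) :
    m.frame.connLow i.succ j.succ k.succ t = m.space.connLow i j k t := by
  unfold frame space
  simp [InvFrame.connLow, InvFrame.ed, Fin.sum_univ_succ (n := 3), spaceFrame]

theorem conn_zero_zero (ht : m.t₀ < t) (b : Fin 4) : m.frame.conn 0 0 b t = 0 := by
  simp [InvFrame.conn, Fin.sum_univ_succ (n := 3), connLow_zero_left, m.inv_frame_G_zero_succ ht]

theorem conn_zero_mid (ht : m.t₀ < t) (a : Fin 4) : m.frame.conn 0 a 0 t = 0 := by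
  simp [InvFrame.conn, Fin.sum_univ_succ (n := 3), connLow_zero_mid, m.inv_frame_G_zero_succ ht]

theorem conn_zero_succ (ht : m.t₀ < t) (i j : Fin 3) : m.frame.conn 0 i.succ j.succ t =
    1 / 2 * deriv (fun s => m.g s i j) t := by
  simp [InvFrame.conn, Fin.sum_univ_succ (n := 3), connLow_zero_succ, m.inv_frame_G_zero_succ ht,
    m.inv_frame_G_zero_zero ht]

theorem conn_zero_right (c : Fin 4) : m.frame.conn c 0 0 t = 0 := by
  simp [InvFrame.conn, connLow_zero_fst]

theorem conn_succ_zero (ht : m.t₀ < t) (i j : Fin 3) :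
    m.frame.conn i.succ 0 j.succ t = m.extr i j t := by
  simp [InvFrame.conn, Fin.sum_univ_succ (n := 3), m.inv_frame_G_succ_zero ht,
    m.inv_frame_G_succ_succ ht, m.connLow_succ_zero ht, extr]

theorem conn_succ_succ_zero (ht : m.t₀ < t) (i j : Fin 3) :
    m.frame.conn i.succ j.succ 0 t = m.extr i j t := by
  simp [InvFrame.conn, Fin.sum_univ_succ (n := 3), m.inv_frame_G_succ_zero ht,
    m.inv_frame_G_succ_succ ht, m.connLow_succ_succ_zero ht, extr]

theorem conn_succ (ht : m.t₀ < t) (i j k : Fin 3) :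
    m.frame.conn i.succ j.succ k.succ t = m.space.conn i j k t := by
  simp only [InvFrame.conn, Fin.sum_univ_succ (n := 3), m.inv_frame_G_succ_zero ht,
    m.inv_frame_G_succ_succ ht, m.connLow_succ, zero_mul, zero_add, space, spaceFrame]

theorem deriv_conn_zero_mid (ht : m.t₀ < t) (a : Fin 4) : deriv (m.frame.conn 0 a 0) t = 0 := by
  have : m.frame.conn 0 a 0 =ᶠ[nhds t] fun _ => 0 := by
    filter_upwards [Ioi_mem_nhds ht] with s hs using m.conn_zero_mid hs a
  rw [this.deriv_eq, deriv_const]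

theorem deriv_conn_zero_succ (ht : m.t₀ < t) (i j : Fin 3) :
    deriv (m.frame.conn 0 i.succ j.succ) t = 1 / 2 * deriv (deriv fun s => m.g s i j) t := by
  have : m.frame.conn 0 i.succ j.succ =ᶠ[nhds t] fun s => 1 / 2 * deriv (fun s => m.g s i j) s := by
    filter_upwards [Ioi_mem_nhds ht] with s hs using m.conn_zero_succ hs i j
  rw [this.deriv_eq, deriv_const_mul_field]

theorem deriv_conn_succ_succ_zero (ht : m.t₀ < t) (i j : Fin 3) :
    deriv (m.frame.conn i.succ j.succ 0) t = deriv (m.extr i j) t := by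
  refine Filter.EventuallyEq.deriv_eq ?_
  filter_upwards [Ioi_mem_nhds ht] with s hs using m.conn_succ_succ_zero hs i j

theorem deriv_conn_succ (ht : m.t₀ < t) (i j k : Fin 3) :
    deriv (m.frame.conn i.succ j.succ k.succ) t = deriv (m.space.conn i j k) t := by
  refine Filter.EventuallyEq.deriv_eq ?_
  filter_upwards [Ioi_mem_nhds ht] with s hs using m.conn_succ hs i j k

theorem frame_D_zero : m.frame.D 0 = 1 := rfl
theorem frame_D_succ (i : Fin 3) : m.frame.D i.succ = 0 := spacetimeFrame_D_succ _ i
theorem frame_C_zero (a b : Fin 4) : m.frame.C 0 a b = 0 := spacetimeFrame_C_zero _ a b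
theorem frame_C_fst (c b : Fin 4) : m.frame.C c 0 b = 0 := spacetimeFrame_C_fst_zero _ c b
theorem frame_C_snd (c a : Fin 4) : m.frame.C c a 0 = 0 := spacetimeFrame_C_snd_zero _ c a
theorem frame_C_succ (k i j : Fin 3) : m.frame.C k.succ i.succ j.succ = structVII0 k i j :=
  spacetimeFrame_C_succ _ k i j

@[simp] theorem frame_G_zero_zero : m.frame.G t 0 0 = -1 := rfl
@[simp] theorem frame_G_zero_succ (j : Fin 3) : m.frame.G t 0 j.succ = 0 :=
  spacetimeFrame_G_zero_succ _ t j
@[simp] theorem frame_G_succ_zero (j : Fin 3) : m.frame.G t j.succ 0 = 0 :=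
  spacetimeFrame_G_succ_zero _ t j
@[simp] theorem frame_G_succ_succ (i j : Fin 3) : m.frame.G t i.succ j.succ = m.g t i j :=
  spacetimeFrame_G_succ_succ _ t i j

theorem riem_zero_zero_succ_zero (ht : m.t₀ < t) (j : Fin 3) :
    m.frame.riem 0 0 j.succ 0 t = 0 := by
  simp [InvFrame.riem, InvFrame.ed, frame_D_zero, frame_D_succ, m.deriv_conn_zero_mid ht,
    m.conn_zero_zero ht, conn_zero_right, frame_C_snd]

theorem riem_zero_zero_zero_succ (ht : m.t₀ < t) (j : Fin 3) :
    m.frame.riem 0 0 0 j.succ t = 0 := by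
  simp [InvFrame.riem, InvFrame.ed, frame_D_zero, frame_D_succ, m.deriv_conn_zero_mid ht,
    m.conn_zero_zero ht, conn_zero_right, frame_C_fst]

theorem riem_last_eq (a b c : Fin 4) : m.frame.riem a b c c t =
    -∑ e, m.frame.C e c c * m.frame.conn a e b t := by
  simp [InvFrame.riem]

theorem riem_succ_zero_succ_zero (ht : m.t₀ < t) (i j : Fin 3) :
    m.frame.riem i.succ 0 j.succ 0 t =
      -deriv (m.extr i j) t - ∑ k, m.extr i k t * m.extr k j t := by
  simp [InvFrame.riem, InvFrame.ed, frame_D_zero, frame_D_succ, m.deriv_conn_succ_succ_zero ht,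
    conn_zero_right, frame_C_snd, Fin.sum_univ_succ (n := 3), m.conn_succ_succ_zero ht,
    m.conn_succ_zero ht, m.conn_zero_mid ht, mul_comm]

theorem riem_zero_succ_zero_succ (ht : m.t₀ < t) (i j : Fin 3) :
    m.frame.riem 0 i.succ 0 j.succ t = 1 / 2 * deriv (deriv fun s => m.g s i j) t
      - ∑ k, m.extr k i t * (1 / 2 * deriv (fun s => m.g s k j) t) := by
  have h : deriv (deriv fun s => m.g s i j) t = deriv (deriv fun s => m.g s j i) t := by
    refine Filter.EventuallyEq.deriv_eq ?_
    filter_upwards [Ioi_mem_nhds ht] with s hs using m.deriv_g_symm hs i j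
  simp [InvFrame.riem, InvFrame.ed, frame_D_zero, frame_D_succ, m.deriv_conn_zero_succ ht,
    frame_C_fst, Fin.sum_univ_succ (n := 3), m.conn_zero_zero ht,
    m.conn_succ_zero ht, m.conn_zero_mid ht, m.conn_zero_succ ht, h,
    fun k => m.deriv_g_symm ht j k]

theorem riem_succ (ht : m.t₀ < t) (i j k l : Fin 3) :
    m.frame.riem i.succ j.succ k.succ l.succ t = m.space.riem i j k l t
      + (1 / 2 * deriv (fun s => m.g s l j) t) * m.extr i k t
      - (1 / 2 * deriv (fun s => m.g s k j) t) * m.extr i l t := by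
  simp [InvFrame.riem, InvFrame.ed, frame_D_succ, frame_C_zero, frame_C_succ,
    Fin.sum_univ_succ (n := 3), m.conn_succ ht, m.conn_succ_succ_zero ht, m.conn_zero_succ ht]
  simp [space, spaceFrame]
  ring

theorem riem_succ_zero_succ_succ (ht : m.t₀ < t) (i k l : Fin 3) :
    m.frame.riem i.succ 0 k.succ l.succ t = ∑ e, m.extr e l t * m.space.conn i k e t
      - ∑ e, m.extr e k t * m.space.conn i l e t - ∑ e, structVII0 e k l * m.extr i e t := by
  simp [InvFrame.riem, InvFrame.ed, frame_D_succ, frame_C_zero, frame_C_succ,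
    Fin.sum_univ_succ (n := 3), m.conn_succ ht, m.conn_succ_succ_zero ht, m.conn_zero_mid ht]

theorem riem_succ_succ_succ_zero (ht : m.t₀ < t) (i j k : Fin 3) :
    m.frame.riem i.succ j.succ k.succ 0 t = -deriv (m.space.conn i k j) t
      + ∑ e, m.extr e j t * m.space.conn i k e t - ∑ e, m.extr i e t * m.space.conn e k j t := by
  simp [InvFrame.riem, InvFrame.ed, frame_D_succ, frame_D_zero, frame_C_snd,
    Fin.sum_univ_succ (n := 3), m.conn_succ ht, m.conn_succ_zero ht, m.conn_zero_zero ht,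
    m.conn_zero_right, m.deriv_conn_succ ht, mul_comm]

theorem ricci_zero_zero (ht : m.t₀ < t) : m.frame.ricci 0 0 t =
    -(∑ i, deriv (m.extr i i) t) - ∑ i, ∑ k, m.extr i k t * m.extr k i t := by
  rw [InvFrame.ricci, Fin.sum_univ_succ]
  simp only [m.riem_last_eq, frame_C_fst, m.riem_succ_zero_succ_zero ht]
  simp

theorem ricci_zero_succ (ht : m.t₀ < t) (j : Fin 3) : m.frame.ricci 0 j.succ t =
    ∑ i, (∑ e, m.extr e j t * m.space.conn i i e t - ∑ e, m.extr e i t * m.space.conn i j e t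
      - ∑ e, structVII0 e i j * m.extr i e t) := by
  rw [InvFrame.ricci, Fin.sum_univ_succ]
  simp only [m.riem_zero_zero_zero_succ ht, m.riem_succ_zero_succ_succ ht, zero_add]

theorem ricci_succ_succ (ht : m.t₀ < t) (i j : Fin 3) : m.frame.ricci i.succ j.succ t =
    m.space.ricci i j t + 1 / 2 * deriv (deriv fun s => m.g s i j) t
      + (1 / 2 * deriv (fun s => m.g s i j) t) * ∑ k, m.extr k k t
      - ∑ k, (1 / 2 * deriv (fun s => m.g s k j) t) * m.extr k i t
      - ∑ k, (1 / 2 * deriv (fun s => m.g s k i) t) * m.extr k j t := by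
  rw [InvFrame.ricci, Fin.sum_univ_succ]
  simp only [m.riem_zero_succ_zero_succ ht, m.riem_succ ht, InvFrame.ricci, Fin.sum_univ_three,
    m.deriv_g_symm ht j i]
  ring

theorem frame_einstein_eq (ht : m.t₀ < t) (a b : Fin 4) : m.frame.einstein a b t =
    (4 * m.μ t / 3) * timeProj a b + (m.μ t / 3) * m.frame.G t a b := by
  rw [frame, m.einstein_eq t ht]
  unfold fluidULow
  induction a using Fin.cases <;> induction b using Fin.cases <;>
    simp [fluidU, timeProj, (Fin.succ_ne_zero _).symm]
  ring

/-- The scalar curvature vanishes, as the energy-momentum tensor of radiation is trace-free. -/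
theorem frame_scalar_eq (ht : m.t₀ < t) : m.frame.scalar t = 0 := by
  have hG : ∑ a, ∑ b, (m.frame.G t)⁻¹ a b * m.frame.G t a b = 4 := by
    have h2 : ∀ a, ∑ b, (m.frame.G t)⁻¹ a b * m.frame.G t a b =
        ((m.frame.G t)⁻¹ * m.frame.G t) a a := fun a => by
      rw [Matrix.mul_apply]
      refine Finset.sum_congr rfl fun b _ => ?_
      congr 1
      induction a using Fin.cases <;> induction b using Fin.cases <;> simp [m.g_symm ht]
    simp only [h2]
    rw [Matrix.nonsing_inv_mul _ (m.isRegularOn_frame.det_ne_zero t ht).isUnit]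
    simp
  have h3 : ∑ a, ∑ b, (m.frame.G t)⁻¹ a b * m.frame.einstein a b t = 0 := by
    simp only [m.frame_einstein_eq ht, mul_add, Finset.sum_add_distrib]
    have : ∀ a b, (m.frame.G t)⁻¹ a b * (m.μ t / 3 * m.frame.G t a b) =
      m.μ t / 3 * ((m.frame.G t)⁻¹ a b * m.frame.G t a b) := fun a b => by ring
    simp only [this, ← Finset.mul_sum, hG]
    simp [timeProj, Fin.sum_univ_succ (n := 3), m.inv_frame_G_zero_zero ht,
      (Fin.succ_ne_zero _).symm]
    ring
  have h4 : ∑ a, ∑ b, (m.frame.G t)⁻¹ a b * m.frame.einstein a b t =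
      m.frame.scalar t - 1 / 2 * m.frame.scalar t * 4 := by
    have : ∀ a b, (m.frame.G t)⁻¹ a b * m.frame.einstein a b t =
      (m.frame.G t)⁻¹ a b * m.frame.ricci a b t -
        1 / 2 * m.frame.scalar t * ((m.frame.G t)⁻¹ a b * m.frame.G t a b) := fun a b => by
      rw [InvFrame.einstein]; ring
    simp only [this, Finset.sum_sub_distrib, ← Finset.mul_sum, hG]
    rfl
  rw [h4] at h3
  linarith

/-- The field equations in the form `R_{ab} = T_{ab}`. -/
theorem ricci_eq (ht : m.t₀ < t) (a b : Fin 4) : m.frame.ricci a b t =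
    (4 * m.μ t / 3) * timeProj a b + (m.μ t / 3) * m.frame.G t a b := by
  rw [← m.frame_einstein_eq ht, InvFrame.einstein, m.frame_scalar_eq ht]
  ring

end Model

/-! ### The momentum constraint and regularity -/

/-- A component of the Ricci tensor of a block diagonal spatial metric. -/
theorem ricci_one_two_of_block {g : ℝ → Matrix (Fin 3) (Fin 3) ℝ} {t A p y s : ℝ}
    (hg : g t = !![A, 0, 0; 0, p, y; 0, y, s]) (hA : A ≠ 0) (hd : p * s - y ^ 2 ≠ 0) :
    (spaceFrame g).ricci 1 2 t = (p + s) ^ 2 / (2 * A * (p * s - y ^ 2)) * y := by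
  have hinv : (g t)⁻¹ = !![1 / A, 0, 0; 0, s / (p * s - y ^ 2), -y / (p * s - y ^ 2);
      0, -y / (p * s - y ^ 2), p / (p * s - y ^ 2)] := by
    refine Matrix.inv_eq_right_inv ?_
    rw [hg]
    ext i j
    fin_cases i <;> fin_cases j <;> simp [Matrix.mul_apply, Fin.sum_univ_three] <;>
      field_simp <;> ring
  have hinv' : ((spaceFrame g).G t)⁻¹ = _ := hinv
  have hg' : (spaceFrame g).G t = _ := hg
  simp only [InvFrame.ricci, InvFrame.riem, InvFrame.conn, InvFrame.connLow, InvFrame.ed, hinv']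
  simp only [hg']
  simp [spaceFrame, structVII0, Fin.sum_univ_three]
  field_simp
  ring

namespace Model
variable (m : Model) {t : ℝ}

theorem inv_mul_g (ht : m.t₀ < t) (i j : Fin 3) :
    ∑ k, (m.g t)⁻¹ i k * m.g t k j = if i = j then 1 else 0 := by
  have := congrFun (congrFun (Matrix.nonsing_inv_mul (m.g t) (m.isUnit_det_g ht)) i) j
  simpa [Matrix.mul_apply, Matrix.one_apply] using this

/-- The Lie algebra is unimodular, so that the invariant fields are divergence-free. -/
theorem sum_conn_eq_zero (ht : m.t₀ < t) (e : Fin 3) : ∑ i, m.space.conn i i e t = 0 := by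
  have h := m.inv_mul_g ht
  simp only [Fin.sum_univ_three] at h
  have h00 := h 0 0
  have h01 := h 0 1
  have h02 := h 0 2
  have h10 := h 1 0
  have h11 := h 1 1
  have h12 := h 1 2
  have h20 := h 2 0
  have h21 := h 2 1
  have h22 := h 2 2
  simp only [m.inv_g_symm ht 1 0, m.inv_g_symm ht 2 0, m.inv_g_symm ht 2 1, m.g_symm ht 1 0,
    m.g_symm ht 2 0, m.g_symm ht 2 1] at *
  simp only [InvFrame.conn, InvFrame.connLow, InvFrame.ed]
  fin_cases e <;> simp [space, spaceFrame, structVII0, Fin.sum_univ_three] <;>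
    simp only [m.inv_g_symm ht 1 0, m.inv_g_symm ht 2 0, m.inv_g_symm ht 2 1, m.g_symm ht 1 0,
      m.g_symm ht 2 0, m.g_symm ht 2 1] <;>
    simp at * <;> linarith

theorem sum_extr_mul_conn (ht : m.t₀ < t) (j : Fin 3) :
    ∑ i, ∑ e, m.extr e i t * m.space.conn i j e t = 0 := by
  simp only [extr, InvFrame.conn, InvFrame.connLow, InvFrame.ed]
  fin_cases j <;> simp [space, spaceFrame, structVII0, Fin.sum_univ_three] <;>
    simp only [m.inv_g_symm ht 1 0, m.inv_g_symm ht 2 0, m.inv_g_symm ht 2 1, m.g_symm ht 1 0,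
      m.g_symm ht 2 0, m.g_symm ht 2 1, m.deriv_g_symm ht 1 0, m.deriv_g_symm ht 2 0,
      m.deriv_g_symm ht 2 1] <;> ring

/-- The momentum constraint. -/
theorem momentum (ht : m.t₀ < t) (j : Fin 3) :
    ∑ i, ∑ e, structVII0 e i j * m.extr i e t = 0 := by
  have h1 := m.ricci_zero_succ ht j
  rw [m.ricci_eq ht] at h1
  simp only [Finset.sum_sub_distrib, m.sum_extr_mul_conn ht] at h1
  rw [Finset.sum_comm] at h1
  simp only [← Finset.mul_sum, m.sum_conn_eq_zero ht] at h1
  unfold frame at h1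
  simp [timeProj, (Fin.succ_ne_zero _).symm] at h1
  exact h1

theorem extr_zero_one (ht : m.t₀ < t) : m.extr 0 1 t = 0 := by
  have := m.momentum ht 2
  simpa [Fin.sum_univ_three, structVII0] using this

theorem extr_zero_two (ht : m.t₀ < t) : m.extr 0 2 t = 0 := by
  have := m.momentum ht 1
  simpa [Fin.sum_univ_three, structVII0] using this

theorem extr_two_one (ht : m.t₀ < t) : m.extr 2 1 t = m.extr 1 2 t := by
  have := m.momentum ht 0
  simp [Fin.sum_univ_three, structVII0] at this
  linarith

theorem deriv_g_eq (ht : m.t₀ < t) (i j : Fin 3) :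
    deriv (fun s => m.g s i j) t = 2 * ∑ k, m.g t i k * m.extr k j t := by
  have h := Matrix.mul_nonsing_inv (m.g t) (m.isUnit_det_g ht)
  have h1 : ∑ k, m.g t i k * m.extr k j t =
      (m.g t * ((m.g t)⁻¹ * Matrix.of fun k j => 1 / 2 * deriv (fun s => m.g s k j) t)) i j := by
    simp [Matrix.mul_apply, extr]
  rw [h1, ← Matrix.mul_assoc, h, Matrix.one_mul, Matrix.of_apply]
  ring

theorem hasDerivAt_g (ht : m.t₀ < t) (i j : Fin 3) :
    HasDerivAt (fun s => m.g s i j) (2 * ∑ k, m.g t i k * m.extr k j t) t := by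
  rw [← m.deriv_g_eq ht]
  exact (m.isRegularOn_space.differentiableAt ht i j).hasDerivAt

end Model

/-- A solution of a homogeneous linear second order equation with vanishing data is zero. -/
theorem eq_zero_of_linear_ode {y y' α β : ℝ → ℝ} {a b : ℝ}
    (hα : ContinuousOn α (Icc a b)) (hβ : ContinuousOn β (Icc a b))
    (hy : ∀ t ∈ Icc a b, HasDerivAt y (y' t) t)
    (hy' : ∀ t ∈ Icc a b, HasDerivAt y' (α t * y' t + β t * y t) t)
    (h0 : y a = 0) (h0' : y' a = 0) {t : ℝ} (ht : t ∈ Icc a b) : y t = 0 := by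
  obtain ⟨M, hM⟩ := isCompact_Icc.exists_bound_of_continuousOn hα
  obtain ⟨N, hN⟩ := isCompact_Icc.exists_bound_of_continuousOn hβ
  set K := 1 + 2 * M + N
  have hd : ∀ t ∈ Icc a b, HasDerivAt (fun t => (y t ^ 2 + y' t ^ 2) * Real.exp (-K * t))
      ((2 * y t * y' t + 2 * y' t * (α t * y' t + β t * y t)
        - K * (y t ^ 2 + y' t ^ 2)) * Real.exp (-K * t)) t := fun t ht => by
    have h1 := ((hy t ht).pow 2).add ((hy' t ht).pow 2)
    have h2 : HasDerivAt (fun t => Real.exp (-K * t)) (Real.exp (-K * t) * (-K * 1)) t :=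
      ((hasDerivAt_id t).const_mul (-K)).exp
    refine (h1.mul h2).congr_deriv ?_
    simp
    ring
  have hanti : AntitoneOn (fun t => (y t ^ 2 + y' t ^ 2) * Real.exp (-K * t)) (Icc a b) := by
    refine antitoneOn_of_deriv_nonpos (convex_Icc a b)
      (fun t ht => (hd t ht).continuousAt.continuousWithinAt)
      (fun t ht => (hd t (interior_subset ht)).differentiableAt.differentiableWithinAt)
      fun t ht => ?_
    rw [(hd t (interior_subset ht)).deriv]
    refine mul_nonpos_of_nonpos_of_nonneg ?_ (Real.exp_pos _).le
    have h1 := abs_le.mp (hM t (interior_subset ht))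
    have h2 := abs_le.mp (hN t (interior_subset ht))
    have e1 : α t * y' t ^ 2 ≤ M * y' t ^ 2 := mul_le_mul_of_nonneg_right h1.2 (sq_nonneg _)
    have e2 : 2 * y t * y' t ≤ y t ^ 2 + y' t ^ 2 := by nlinarith [sq_nonneg (y t - y' t)]
    have e3 : 2 * (β t * (y t * y' t)) ≤ N * (y t ^ 2 + y' t ^ 2) := by
      nlinarith [mul_nonneg (sub_nonneg.mpr h2.2) (sq_nonneg (y t + y' t)),
        mul_nonneg (by linarith : 0 ≤ N + β t) (sq_nonneg (y t - y' t))]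
    have hM0 : 0 ≤ M := (norm_nonneg _).trans (hM t (interior_subset ht))
    have e4 : 0 ≤ M * y t ^ 2 := by positivity
    simp only [K]
    nlinarith
  have h1 := hanti ⟨le_rfl, ht.1.trans ht.2⟩ ht ht.1
  simp only [h0, h0'] at h1
  have h2 : y t ^ 2 + y' t ^ 2 ≤ 0 := by
    by_contra h
    have := mul_pos (not_le.mp h) (Real.exp_pos (-K * t))
    linarith [show ((0:ℝ) ^ 2 + 0 ^ 2) * Real.exp (-K * a) = 0 by ring]
  have h3 : y t ^ 2 = 0 := by nlinarith [sq_nonneg (y t), sq_nonneg (y' t)]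
  exact pow_eq_zero_iff (two_ne_zero) |>.mp h3

namespace Model
variable (m : Model) {t : ℝ}

theorem differentiableAt_extr (ht : m.t₀ < t) (i j : Fin 3) :
    DifferentiableAt ℝ (m.extr i j) t := by
  have h1 := fun i j => m.isRegularOn_space.differentiableAt ht i j
  have h3 := Matrix.differentiableAt_inv h1 (m.isRegularOn_space.det_ne_zero t ht)
  have h2 := fun i j => m.isRegularOn_space.differentiableAt_deriv ht i j
  exact DifferentiableAt.fun_sum fun k _ => (h3 i k).mul ((h2 k j).const_mul _)

theorem continuousAt_extr (ht : m.t₀ < t) (i j : Fin 3) : ContinuousAt (m.extr i j) t :=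
  (m.differentiableAt_extr ht i j).continuousAt

theorem continuousAt_g (ht : m.t₀ < t) (i j : Fin 3) : ContinuousAt (fun s => m.g s i j) t :=
  (m.isRegularOn_space.differentiableAt ht i j).continuousAt

theorem continuousAt_deriv_g (ht : m.t₀ < t) (i j : Fin 3) :
    ContinuousAt (deriv fun s => m.g s i j) t :=
  (m.isRegularOn_space.differentiableAt_deriv ht i j).continuousAt

theorem continuousAt_deriv_deriv_g (ht : m.t₀ < t) (i j : Fin 3) :
    ContinuousAt (deriv (deriv fun s => m.g s i j)) t :=
  ((((m.contDiffOn i j).deriv_of_isOpen (m := 1) isOpen_Ioi (by norm_num)).deriv_of_isOpen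
    (m := 0) isOpen_Ioi (by norm_num)).continuousOn).continuousAt (Ioi_mem_nhds ht)

theorem continuousAt_space_ricci (ht : m.t₀ < t) (i j : Fin 3) :
    ContinuousAt (m.space.ricci i j) t := by
  have h := fun a b c => (m.isRegularOn_space.differentiableAt_conn ht a b c).continuousAt
  change ContinuousAt (fun t => m.space.ricci i j t) t
  simp only [InvFrame.ricci, InvFrame.riem, InvFrame.ed, space]
  simp only [spaceFrame, zero_mul, sub_zero, zero_add] at h ⊢
  fun_prop

theorem ricci_succ_eq (ht : m.t₀ < t) (i j : Fin 3) :
    m.frame.ricci i.succ j.succ t = m.μ t / 3 * m.g t i j := by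
  rw [m.ricci_eq ht, frame, spacetimeFrame_G_succ_succ]
  simp [timeProj, (Fin.succ_ne_zero _).symm]

theorem continuousAt_mu (ht : m.t₀ < t) : ContinuousAt m.μ t := by
  have h1 : m.μ =ᶠ[nhds t] fun t => 3 / m.g t 1 1 * (
      m.space.ricci 1 1 t + 1 / 2 * deriv (deriv fun s => m.g s 1 1) t
      + (1 / 2 * deriv (fun s => m.g s 1 1) t) * ∑ k, m.extr k k t
      - ∑ k, (1 / 2 * deriv (fun s => m.g s k 1) t) * m.extr k 1 t
      - ∑ k, (1 / 2 * deriv (fun s => m.g s k 1) t) * m.extr k 1 t) := by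
    filter_upwards [Ioi_mem_nhds ht] with s hs
    have hp : m.g s 1 1 ≠ 0 := ((m.posDef s hs).diag_pos).ne'
    rw [← m.ricci_succ_succ hs, m.ricci_succ_eq hs]
    field_simp
  have hp : m.g t 1 1 ≠ 0 := ((m.posDef t ht).diag_pos).ne'
  refine ContinuousAt.congr ?_ h1.symm
  have c1 := m.continuousAt_space_ricci ht
  have c2 := m.continuousAt_deriv_deriv_g ht
  have c3 := m.continuousAt_deriv_g ht
  have c4 := m.continuousAt_extr ht
  have c5 := m.continuousAt_g ht
  refine ContinuousAt.mul (continuousAt_const.div (c5 1 1) hp) ?_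
  refine ContinuousAt.sub (ContinuousAt.sub (ContinuousAt.add (ContinuousAt.add (c1 1 1)
    (continuousAt_const.mul (c2 1 1))) (ContinuousAt.mul (continuousAt_const.mul (c3 1 1)) ?_))
    ?_) ?_
  · exact tendsto_finsetSum _ fun k _ => c4 k k
  · exact tendsto_finsetSum _ fun k _ => (continuousAt_const.mul (c3 k 1)).mul (c4 k 1)
  · exact tendsto_finsetSum _ fun k _ => (continuousAt_const.mul (c3 k 1)).mul (c4 k 1)

/-! ### Block diagonal models -/

/-- The metric is block diagonal: `e₀` is orthogonal to the commuting vectors `e₁` and `e₂`. -/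
def IsBlock : Prop := ∀ t, m.t₀ < t → m.g t 0 1 = 0 ∧ m.g t 0 2 = 0

section Block
variable {m}

theorem IsBlock.g_eq (hb : m.IsBlock) (ht : m.t₀ < t) : m.g t =
    !![m.g t 0 0, 0, 0; 0, m.g t 1 1, m.g t 1 2; 0, m.g t 1 2, m.g t 2 2] := by
  have h1 := hb t ht
  ext i j
  fin_cases i <;> fin_cases j <;> simp [h1.1, h1.2, m.g_symm ht 1 0, m.g_symm ht 2 0,
    m.g_symm ht 2 1]

theorem IsBlock.det_pos (hb : m.IsBlock) (ht : m.t₀ < t) :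
    0 < m.g t 1 1 * m.g t 2 2 - m.g t 1 2 ^ 2 := by
  have h1 := (m.posDef t ht).det_pos
  have h2 : 0 < m.g t 0 0 := (m.posDef t ht).diag_pos
  rw [hb.g_eq ht, Matrix.det_fin_three] at h1
  simp at h1
  have h3 : 0 < m.g t 0 0 * (m.g t 1 1 * m.g t 2 2 - m.g t 1 2 ^ 2) := by nlinarith
  exact (mul_pos_iff_of_pos_left h2).mp h3

/-- In a block diagonal frame the off-diagonal component satisfies a homogeneous linear equation. -/
theorem IsBlock.deriv_deriv_g_one_two (hb : m.IsBlock) (ht : m.t₀ < t) :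
    deriv (deriv fun s => m.g s 1 2) t =
      (-m.extr 0 0 t + (deriv (fun s => m.g s 1 1) t + deriv (fun s => m.g s 2 2) t)
        / (2 * m.g t 1 1)) * deriv (fun s => m.g s 1 2) t +
      (2 * (m.μ t / 3 - (m.g t 1 1 + m.g t 2 2) ^ 2 / (2 * m.g t 0 0 *
        (m.g t 1 1 * m.g t 2 2 - m.g t 1 2 ^ 2)))
        - (deriv (fun s => m.g s 1 1) t + deriv (fun s => m.g s 2 2) t) * m.extr 2 2 t
        / m.g t 1 1) * m.g t 1 2 := by
  have hA : m.g t 0 0 ≠ 0 := ((m.posDef t ht).diag_pos).ne'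
  have hp : m.g t 1 1 ≠ 0 := ((m.posDef t ht).diag_pos).ne'
  have hd := (hb.det_pos ht).ne'
  have h1 := m.ricci_succ_succ ht 1 2
  have h2 : m.space.ricci 1 2 t = _ := ricci_one_two_of_block (hb.g_eq ht) hA hd
  have h0 : ∀ j : Fin 3, j ≠ 0 → deriv (fun s => m.g s 0 j) t = 0 := fun j hj => by
    have : (fun s => m.g s 0 j) =ᶠ[nhds t] fun _ => 0 := by
      filter_upwards [Ioi_mem_nhds ht] with s hs
      fin_cases j
      · exact absurd rfl hj
      · exact (hb s hs).1
      · exact (hb s hs).2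
    rw [this.deriv_eq, deriv_const]
  have h3 := m.deriv_g_eq ht 1 2
  rw [m.ricci_succ_eq ht, h2] at h1
  simp only [Fin.sum_univ_three, h0 1 (by decide), h0 2 (by decide), m.extr_two_one ht,
    m.g_symm ht 1 0, (hb t ht).1, m.deriv_g_symm ht 2 1] at h1 h3
  have h4 : m.extr 1 2 t =
      (deriv (fun s => m.g s 1 2) t / 2 - m.g t 1 2 * m.extr 2 2 t) / m.g t 1 1 := by
    rw [eq_div_iff hp]
    linarith
  rw [h4] at h1
  generalize (m.g t 1 1 + m.g t 2 2) ^ 2 / (2 * m.g t 0 0 *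
        (m.g t 1 1 * m.g t 2 2 - m.g t 1 2 ^ 2)) = ρ at *
  field_simp at h1 ⊢
  linarith

/-- A block diagonal metric that is diagonal at one time, but not isotropic in the second block,
stays diagonal. -/
theorem IsBlock.g_one_two_eq_zero (hb : m.IsBlock) {t₁ : ℝ} (ht₁ : m.t₀ < t₁) (h12 : m.g t₁ 1 2 = 0)
    (hne : m.g t₁ 1 1 ≠ m.g t₁ 2 2) (ht : t₁ ≤ t) : m.g t 1 2 = 0 := by
  have hd0 : deriv (fun s => m.g s 1 2) t₁ = 0 := by
    have h1 := m.deriv_g_eq ht₁ 1 2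
    have h2 := m.deriv_g_eq ht₁ 2 1
    rw [m.deriv_g_symm ht₁ 2 1] at h2
    simp only [Fin.sum_univ_three, m.g_symm ht₁ 1 0, m.g_symm ht₁ 2 0, m.g_symm ht₁ 2 1, h12,
      (hb t₁ ht₁).1, (hb t₁ ht₁).2, m.extr_two_one ht₁] at h1 h2
    have h3 : (m.g t₁ 1 1 - m.g t₁ 2 2) * m.extr 1 2 t₁ = 0 := by linarith
    have h4 := (mul_eq_zero.mp h3).resolve_left (sub_ne_zero.mpr hne)
    rw [h1, h4]
    ring
  have hpos : ∀ s ∈ Icc t₁ t, m.t₀ < s := fun s hs => ht₁.trans_le hs.1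
  refine eq_zero_of_linear_ode (y := fun s => m.g s 1 2) (y' := deriv fun s => m.g s 1 2)
    (α := fun t => -m.extr 0 0 t + (deriv (fun s => m.g s 1 1) t + deriv (fun s => m.g s 2 2) t)
        / (2 * m.g t 1 1))
    (β := fun t => 2 * (m.μ t / 3 - (m.g t 1 1 + m.g t 2 2) ^ 2 / (2 * m.g t 0 0 *
        (m.g t 1 1 * m.g t 2 2 - m.g t 1 2 ^ 2)))
        - (deriv (fun s => m.g s 1 1) t + deriv (fun s => m.g s 2 2) t) * m.extr 2 2 t
        / m.g t 1 1)
    (a := t₁) (b := t) ?_ ?_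
    (fun s hs => (m.isRegularOn_space.differentiableAt (hpos s hs) 1 2).hasDerivAt)
    (fun s hs => ?_) h12 hd0 ⟨ht, le_rfl⟩
  rotate_left 2
  · have := (m.isRegularOn_space.differentiableAt_deriv (hpos s hs) 1 2).hasDerivAt
    exact this.congr_deriv (hb.deriv_deriv_g_one_two (hpos s hs))
  all_goals
    intro s hs
    have hs' := hpos s hs
    have hA : m.g s 0 0 ≠ 0 := ((m.posDef s hs').diag_pos).ne'
    have hp : m.g s 1 1 ≠ 0 := ((m.posDef s hs').diag_pos).ne'
    have hd := (hb.det_pos hs').ne'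
    have c3 := m.continuousAt_deriv_g hs'
    have c4 := m.continuousAt_extr hs'
    have c5 := m.continuousAt_g hs'
    have c6 := m.continuousAt_mu hs'
    refine ContinuousAt.continuousWithinAt ?_
  · exact ((c4 0 0).neg).add (((c3 1 1).add (c3 2 2)).div (continuousAt_const.mul (c5 1 1))
      (by simpa using hp))
  · refine ContinuousAt.sub (continuousAt_const.mul ((c6.div_const 3).sub ?_)) ?_
    · refine (((c5 1 1).add (c5 2 2)).pow 2).div ((continuousAt_const.mul (c5 0 0)).mul
        (((c5 1 1).mul (c5 2 2)).sub ((c5 1 2).pow 2))) ?_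
      simpa [hA] using hd
    · exact (((c3 1 1).add (c3 2 2)).mul (c4 2 2)).div (c5 1 1) hp

end Block

/-! ### Diagonalization -/

/-- A rotation by half the angle of `(x, y)` diagonalizes the trace-free symmetric matrix with the
entries `x`, `y`. -/
theorem exists_rotation {x y : ℝ} (h : x ≠ 0 ∨ y ≠ 0) : ∃ c s : ℝ, c ^ 2 + s ^ 2 = 1 ∧
    y * (c ^ 2 - s ^ 2) = x * (2 * c * s) ∧ x * (c ^ 2 - s ^ 2) + y * (2 * c * s) ≠ 0 := by
  set z : ℂ := ⟨x, y⟩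
  have hx : ‖z‖ * Real.cos z.arg = x := Complex.norm_mul_cos_arg z
  have hy : ‖z‖ * Real.sin z.arg = y := Complex.norm_mul_sin_arg z
  have h1 : Real.cos (z.arg / 2) ^ 2 + Real.sin (z.arg / 2) ^ 2 = 1 := Real.cos_sq_add_sin_sq _
  have hc : Real.cos z.arg = Real.cos (z.arg / 2) ^ 2 - Real.sin (z.arg / 2) ^ 2 := by
    rw [← Real.cos_two_mul', mul_div_cancel₀]
    norm_num
  have hs : Real.sin z.arg = 2 * Real.cos (z.arg / 2) * Real.sin (z.arg / 2) := by
    have := Real.sin_two_mul (z.arg / 2)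
    rw [mul_div_cancel₀ _ (two_ne_zero)] at this
    rw [this]; ring
  refine ⟨_, _, h1, ?_, fun h0 => ?_⟩
  · rw [← hc, ← hs, ← hx, ← hy]; ring
  · rw [← hc, ← hs] at h0
    have e1 : x * Real.sin z.arg = y * Real.cos z.arg := by rw [← hx, ← hy]; ring
    have e2 := Real.cos_sq_add_sin_sq z.arg
    have e3 : x = 0 := by linear_combination (Real.cos z.arg) * h0 + Real.sin z.arg * e1 - x * e2
    have e4 : y = 0 := by linear_combination (Real.sin z.arg) * h0 - Real.cos z.arg * e1 - y * e2
    exact h.elim (· e3) (· e4)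

/-- Shifting `e₀` along `e₁, e₂` and rotating `e₁, e₂` is an automorphism. -/
theorem isAut_shift_rotation (c₁ c₂ : ℝ) {c s : ℝ} (h : c ^ 2 + s ^ 2 = 1) :
    IsAut !![1, 0, 0; -c₁, c, -s; -c₂, s, c]
      !![1, 0, 0; c * c₁ + s * c₂, c, s; -s * c₁ + c * c₂, -s, c] where
  mul_inv := by
    ext i j
    fin_cases i <;> fin_cases j <;> simp [Matrix.mul_apply, Fin.sum_univ_three] <;>
      first | linear_combination h | linear_combination c₁ * h | linear_combination c₂ * h | ring
  det_eq := by
    rw [Matrix.det_fin_three]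
    simp
    linear_combination h
  struct_eq k a b := by
    fin_cases k <;> fin_cases a <;> fin_cases b <;>
      simp [Fin.sum_univ_three, structVII0]

/-- The projection of `e₀` to the span of `e₁` and `e₂` is constant. -/
theorem exists_shift : ∃ c₁ c₂ : ℝ, ∀ t, m.t₀ < t →
    m.g t 0 1 = m.g t 1 1 * c₁ + m.g t 1 2 * c₂ ∧
    m.g t 0 2 = m.g t 1 2 * c₁ + m.g t 2 2 * c₂ := by
  have hΔ : ∀ t, m.t₀ < t → 0 < m.g t 1 1 * m.g t 2 2 - m.g t 1 2 ^ 2 := fun t ht => by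
    have h1 := ((m.posDef t ht).submatrix (e := ![1, 2]) (by decide)).det_pos
    rw [Matrix.det_fin_two] at h1
    simp [m.g_symm ht 2 1] at h1
    linarith
  have hg : ∀ t, m.t₀ < t → ∀ i j, HasDerivAt (fun s => m.g s i j) _ t := fun t ht i j =>
    m.hasDerivAt_g ht i j
  set f₁ : ℝ → ℝ := fun t => (m.g t 2 2 * m.g t 0 1 - m.g t 1 2 * m.g t 0 2) /
    (m.g t 1 1 * m.g t 2 2 - m.g t 1 2 ^ 2)
  set f₂ : ℝ → ℝ := fun t => (m.g t 1 1 * m.g t 0 2 - m.g t 1 2 * m.g t 0 1) /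
    (m.g t 1 1 * m.g t 2 2 - m.g t 1 2 ^ 2)
  have hcomm : ∀ t, m.t₀ < t → (m.g t 1 1 - m.g t 2 2) * m.extr 1 2 t =
      m.g t 1 2 * (m.extr 1 1 t - m.extr 2 2 t) := fun t ht => by
    have h1 := m.deriv_g_eq ht 1 2
    have h2 := m.deriv_g_eq ht 2 1
    rw [m.deriv_g_symm ht 2 1] at h2
    simp only [Fin.sum_univ_three, m.g_symm ht 1 0, m.g_symm ht 2 0, m.g_symm ht 2 1,
      m.extr_two_one ht, m.extr_zero_one ht, m.extr_zero_two ht] at h1 h2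
    linarith
  have hden : ∀ t, m.t₀ < t → HasDerivAt (fun t => m.g t 1 1 * m.g t 2 2 - m.g t 1 2 ^ 2)
      (2 * (m.extr 1 1 t + m.extr 2 2 t) * (m.g t 1 1 * m.g t 2 2 - m.g t 1 2 ^ 2)) t :=
    fun t ht => by
      refine (((hg t ht 1 1).mul (hg t ht 2 2)).sub ((hg t ht 1 2).pow 2)).congr_deriv ?_
      simp only [Fin.sum_univ_three, m.g_symm ht 1 0, m.g_symm ht 2 0, m.g_symm ht 2 1,
        m.extr_two_one ht, m.extr_zero_one ht, m.extr_zero_two ht]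
      norm_num
      linear_combination (-2 * m.g t 1 2) * hcomm t ht
  have hd₁ : ∀ t ∈ Ioi m.t₀, HasDerivAt f₁ 0 t := fun t ht => by
    refine ((((hg t ht 2 2).mul (hg t ht 0 1)).sub ((hg t ht 1 2).mul (hg t ht 0 2))).div
      (hden t ht) (hΔ t ht).ne').congr_deriv ?_
    rw [div_eq_zero_iff]
    left
    simp only [Fin.sum_univ_three, m.g_symm ht 1 0, m.g_symm ht 2 0, m.g_symm ht 2 1,
      m.extr_two_one ht, m.extr_zero_one ht, m.extr_zero_two ht, Pi.mul_apply, Pi.sub_apply]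
    linear_combination (-2 * m.g t 0 2 * (m.g t 1 1 * m.g t 2 2 - m.g t 1 2 ^ 2)) * hcomm t ht
  have hd₂ : ∀ t ∈ Ioi m.t₀, HasDerivAt f₂ 0 t := fun t ht => by
    refine ((((hg t ht 1 1).mul (hg t ht 0 2)).sub ((hg t ht 1 2).mul (hg t ht 0 1))).div
      (hden t ht) (hΔ t ht).ne').congr_deriv ?_
    rw [div_eq_zero_iff]
    left
    simp only [Fin.sum_univ_three, m.g_symm ht 1 0,
      m.extr_two_one ht, m.extr_zero_one ht, m.extr_zero_two ht, Pi.mul_apply, Pi.sub_apply]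
    ring
  have hconst : ∀ f : ℝ → ℝ, (∀ t ∈ Ioi m.t₀, HasDerivAt f 0 t) →
      ∀ t, m.t₀ < t → f t = f (m.t₀ + 1) := fun f hf t ht =>
    isOpen_Ioi.is_const_of_deriv_eq_zero isPreconnected_Ioi
      (fun s hs => (hf s hs).differentiableAt.differentiableWithinAt)
      (fun s hs => (hf s hs).deriv) ht (by simp)
  refine ⟨f₁ (m.t₀ + 1), f₂ (m.t₀ + 1), fun t ht => ?_⟩
  rw [← hconst f₁ hd₁ t ht, ← hconst f₂ hd₂ t ht]
  have := (hΔ t ht).ne'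
  simp only [f₁, f₂]
  constructor <;>
    rw [mul_div_assoc', mul_div_assoc', ← add_div, eq_div_iff this] <;> ring

/-- The rotations of the plane of `e₁` and `e₂`, which fix the normal of this plane, are the symmetry:
the normal is a constant combination of the `e_i`, so that their generator is constant too. -/
theorem isLRS_of_isotropic (h : ∀ t, m.t₀ < t → m.g t 1 1 = m.g t 2 2 ∧ m.g t 1 2 = 0) :
    m.IsLRS := by
  obtain ⟨c₁, c₂, hc⟩ := m.exists_shift
  refine ⟨!![0, 0, 0; -c₂, 0, -1; c₁, 1, 0], fun h0 => ?_, fun n i j => ?_, fun t ht => ?_⟩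
  · have := congrFun (congrFun h0 2) 1
    simp at this
  · fin_cases n <;> fin_cases i <;> fin_cases j <;> simp [structVII0]
  · have h1 := h t ht
    have h2 := hc t ht
    ext i j
    fin_cases i <;> fin_cases j <;> simp [Matrix.mul_apply, Fin.sum_univ_three,
      m.g_symm ht 1 0, m.g_symm ht 2 0, m.g_symm ht 2 1, h1.1, h1.2, h2.1, h2.2] <;> ring

theorem change_g {B B' : Matrix (Fin 3) (Fin 3) ℝ} (h : IsAut B B') (t : ℝ) :
    (m.change h).g t = B.transpose * m.g t * B := rfl

/-- The metric is diagonal, and not isotropic in the plane of `e₁` and `e₂` at some time. -/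
structure IsDiagonal : Prop where
  g_eq : ∀ t, m.t₀ < t → m.g t = Matrix.diagonal fun i => m.g t i i
  exists_ne : ∃ t, m.t₀ < t ∧ m.g t 1 1 ≠ m.g t 2 2

/-- At late times, a model that is not locally rotationally symmetric is diagonal in a suitable
frame. -/
theorem exists_isDiagonal (h : ¬ m.IsLRS) : ∃ m' : Model, m'.IsDiagonal ∧ m.t₀ ≤ m'.t₀ ∧
    ∀ t, m'.t₀ < t → m'.H t = m.H t ∧ m'.Omega t = m.Omega t ∧
      m'.shearScalar t = m.shearScalar t ∧ m'.curvScalar t = m.curvScalar t ∧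
      m'.weylScalar t = m.weylScalar t := by
  have h1 : ∃ t₁, m.t₀ < t₁ ∧ ((m.g t₁ 1 1 - m.g t₁ 2 2) / 2 ≠ 0 ∨ m.g t₁ 1 2 ≠ 0) := by
    by_contra! hcon
    refine h (m.isLRS_of_isotropic fun t ht => ⟨?_, (hcon t ht).2⟩)
    have := (hcon t ht).1
    linarith
  obtain ⟨t₁, ht₁, hne⟩ := h1
  obtain ⟨c, s, hcs, hr₁, hr₂⟩ := exists_rotation hne
  obtain ⟨c₁, c₂, hc⟩ := m.exists_shift
  have hA := isAut_shift_rotation c₁ c₂ hcs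
  have hb : (m.change hA).IsBlock := fun t ht => by
    replace ht : m.t₀ < t := ht
    have := hc t ht
    rw [change_g]
    simp [Matrix.mul_apply, Fin.sum_univ_three, m.g_symm ht 1 0, m.g_symm ht 2 0, m.g_symm ht 2 1,
      this.1, this.2]
    constructor <;> ring
  have h12 : (m.change hA).g t₁ 1 2 = 0 := by
    rw [change_g]
    simp [Matrix.mul_apply, Fin.sum_univ_three, m.g_symm ht₁ 1 0, m.g_symm ht₁ 2 0,
      m.g_symm ht₁ 2 1]
    linear_combination hr₁
  have hne' : (m.change hA).g t₁ 1 1 ≠ (m.change hA).g t₁ 2 2 := by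
    rw [change_g, ← sub_ne_zero]
    simp [Matrix.mul_apply, Fin.sum_univ_three, m.g_symm ht₁ 1 0, m.g_symm ht₁ 2 0,
      m.g_symm ht₁ 2 1]
    intro h0
    refine hr₂ ?_
    linear_combination h0 / 2
  have hdiag : ∀ t, t₁ < t → (m.change hA).g t =
      Matrix.diagonal fun i => (m.change hA).g t i i := fun t ht => by
    rw [hb.g_eq (ht₁.trans ht), hb.g_one_two_eq_zero ht₁ h12 hne' ht.le]
    ext i j
    fin_cases i <;> fin_cases j <;> simp
  refine ⟨(m.change hA).restrict t₁ ht₁.le, ⟨hdiag, ?_⟩, ht₁.le, fun t ht => ?_⟩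
  · have h0 : ∀ i j, ContinuousAt (fun s => (m.change hA).g s i j) t₁ :=
      (m.change hA).continuousAt_g ht₁
    have h2 := ((h0 1 1).sub (h0 2 2)).eventually_ne (sub_ne_zero.mpr hne')
    obtain ⟨t, h3, h4⟩ := ((h2.filter_mono nhdsWithin_le_nhds).and
      (self_mem_nhdsWithin : Ioi t₁ ∈ nhdsWithin t₁ (Ioi t₁))).exists
    exact ⟨t, h4, sub_ne_zero.mp h3⟩
  · have ht' : m.t₀ < t := ht₁.trans ht
    exact ⟨m.change_H hA ht', m.change_Omega hA ht', m.change_shearScalar hA ht',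
      m.change_curvScalar hA ht', m.change_weylScalar hA ht'⟩

end Model

/-! ### Diagonal models -/

theorem inv_diagonal_fin_three {a b c : ℝ} (ha : a ≠ 0) (hb : b ≠ 0) (hc : c ≠ 0) :
    (!![a, 0, 0; 0, b, 0; 0, 0, c])⁻¹ = !![1 / a, 0, 0; 0, 1 / b, 0; 0, 0, 1 / c] := by
  refine Matrix.inv_eq_right_inv ?_
  ext i j
  fin_cases i <;> fin_cases j <;> simp [Matrix.mul_apply, Fin.sum_univ_three, ha, hb, hc]

/-- The Ricci tensor of a hypersurface in a frame in which the metric is diagonal. -/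
theorem ricci_of_diagonal {g : ℝ → Matrix (Fin 3) (Fin 3) ℝ} {t a b c : ℝ}
    (hg : g t = !![a, 0, 0; 0, b, 0; 0, 0, c]) (ha : a ≠ 0) (hb : b ≠ 0) (hc : c ≠ 0)
    (i j : Fin 3) : (spaceFrame g).ricci i j t =
      (!![-(b - c) ^ 2 / (2 * b * c), 0, 0; 0, (b ^ 2 - c ^ 2) / (2 * a * c), 0;
        0, 0, (c ^ 2 - b ^ 2) / (2 * a * b)] : Matrix (Fin 3) (Fin 3) ℝ) i j := by
  have hinv : ((spaceFrame g).G t)⁻¹ = _ :=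
    (congrArg (·⁻¹) hg).trans (inv_diagonal_fin_three ha hb hc)
  have hg' : (spaceFrame g).G t = _ := hg
  simp only [InvFrame.ricci, InvFrame.riem, InvFrame.conn, InvFrame.connLow, InvFrame.ed, hinv]
  simp only [hg']
  fin_cases i <;> fin_cases j <;> simp [spaceFrame, structVII0, Fin.sum_univ_three] <;>
    field_simp <;> ring

/-- The connection of a hypersurface in a frame in which the metric is diagonal. -/
theorem conn_of_diagonal {g : ℝ → Matrix (Fin 3) (Fin 3) ℝ} {t a b c : ℝ}
    (hg : g t = !![a, 0, 0; 0, b, 0; 0, 0, c]) (ha : a ≠ 0) (hb : b ≠ 0) (hc : c ≠ 0) :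
    (spaceFrame g).conn 0 1 2 t = (b - c) / (2 * a) ∧
    (spaceFrame g).conn 0 2 1 t = (b - c) / (2 * a) ∧
    (spaceFrame g).conn 2 1 0 t = (c - b) / (2 * c) ∧
    (spaceFrame g).conn 1 2 0 t = (c - b) / (2 * b) := by
  have hinv : ((spaceFrame g).G t)⁻¹ = _ :=
    (congrArg (·⁻¹) hg).trans (inv_diagonal_fin_three ha hb hc)
  have hg' : (spaceFrame g).G t = _ := hg
  simp only [InvFrame.conn, InvFrame.connLow, InvFrame.ed, hinv]
  simp only [hg']
  refine ⟨?_, ?_, ?_, ?_⟩ <;> simp [spaceFrame, structVII0, Fin.sum_univ_three] <;>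
    field_simp <;> ring

namespace Model
variable (m : Model) {t : ℝ}

theorem H_eq (ht : m.t₀ < t) : m.H t = (1 / 3) * ∑ i, m.extr i i t := by
  simp only [H, gradU_eq, Fin.sum_univ_succ (n := 3), m.inv_frame_G_zero_succ ht,
    m.inv_frame_G_succ_zero ht, m.inv_frame_G_succ_succ ht, m.conn_zero_zero ht,
    m.conn_zero_succ ht, extr]
  simp [m.deriv_g_symm ht]

theorem shear_succ_succ (ht : m.t₀ < t) (i j : Fin 3) :
    m.shear i.succ j.succ t = 1 / 2 * deriv (fun s => m.g s i j) t - m.H t * m.g t i j := by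
  simp only [shear, proj_eq, Fin.sum_univ_succ (n := 3), gradU_eq, timeProj, uLow_eq]
  simp [(Fin.succ_ne_zero _).symm, m.conn_zero_succ ht, Matrix.one_apply,
    Fin.succ_ne_zero, m.deriv_g_symm ht j i]
  ring

theorem shear_zero_left (b : Fin 4) : m.shear 0 b t = 0 := by
  have h : ∀ c, m.proj c 0 t = 0 := fun c => by
    rw [proj_eq]
    induction c using Fin.cases <;> simp [timeProj, Fin.succ_ne_zero,
      (Fin.succ_ne_zero _).symm]
  simp only [shear, h, uLow_eq]
  induction b using Fin.cases <;> simp [Fin.succ_ne_zero]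

theorem shear_zero_right (b : Fin 4) : m.shear b 0 t = 0 := by
  have h : ∀ c, m.proj c 0 t = 0 := fun c => by
    rw [proj_eq]
    induction c using Fin.cases <;> simp [timeProj, Fin.succ_ne_zero,
      (Fin.succ_ne_zero _).symm]
  simp only [shear, h, uLow_eq]
  induction b using Fin.cases <;> simp [Fin.succ_ne_zero]

theorem elWeyl_apply (ht : m.t₀ < t) (a b : Fin 4) : m.elWeyl a b t =
    m.frame.riemLow a 0 b 0 t - m.μ t / 3 * (m.frame.G t a b + timeProj a b) := by
  simp only [elWeyl, fluidU, mul_ite, mul_one, mul_zero, Finset.sum_ite_eq', Finset.mem_univ,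
    if_true, InvFrame.weyl, m.ricci_eq ht, m.frame_scalar_eq ht]
  induction a using Fin.cases <;> induction b using Fin.cases <;>
      simp [timeProj, (Fin.succ_ne_zero _).symm]
  ring

theorem riemLow_succ (i : Fin 3) (b c d : Fin 4) : m.frame.riemLow i.succ b c d t =
    ∑ k : Fin 3, m.g t i k * m.frame.riem k.succ b c d t := by
  simp [InvFrame.riemLow, Fin.sum_univ_succ (n := 3)]

theorem riemLow_zero (b c d : Fin 4) : m.frame.riemLow 0 b c d t = -m.frame.riem 0 b c d t := by
  simp [InvFrame.riemLow, Fin.sum_univ_succ (n := 3)]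

theorem elWeyl_zero_left (ht : m.t₀ < t) (b : Fin 4) : m.elWeyl 0 b t = 0 := by
  rw [m.elWeyl_apply ht, riemLow_zero]
  induction b using Fin.cases
  · simp [riem_last_eq, frame_C_fst, timeProj]
  · simp [m.riem_zero_zero_succ_zero ht, timeProj, (Fin.succ_ne_zero _).symm]

theorem elWeyl_zero_right (ht : m.t₀ < t) (b : Fin 4) : m.elWeyl b 0 t = 0 := by
  rw [m.elWeyl_apply ht]
  induction b using Fin.cases
  · simp [riemLow_zero, riem_last_eq, frame_C_fst, timeProj]
  · simp [riemLow_succ, riem_last_eq, frame_C_fst, timeProj, (Fin.succ_ne_zero _).symm]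

theorem elWeyl_succ_succ (ht : m.t₀ < t) (i j : Fin 3) : m.elWeyl i.succ j.succ t =
    ∑ k, m.g t i k * (-deriv (m.extr k j) t - ∑ l, m.extr k l t * m.extr l j t)
      - m.μ t / 3 * m.g t i j := by
  rw [m.elWeyl_apply ht, riemLow_succ]
  simp [m.riem_succ_zero_succ_zero ht, timeProj, (Fin.succ_ne_zero _).symm]

theorem magWeyl_apply (a b : Fin 4) : m.magWeyl a b t = m.frame.dualWeyl a 0 b 0 t := by
  simp only [magWeyl, fluidU, mul_ite, mul_one, mul_zero, Finset.sum_ite_eq', Finset.mem_univ,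
    if_true]

theorem magWeyl_zero_left (b : Fin 4) : m.magWeyl 0 b t = 0 := by
  have h : ∀ e f, m.frame.vol 0 0 e f t = 0 := fun e f => by
    rw [vol_eq, Matrix.det_zero_of_row_eq (M := Matrix.of _) (i := 0) (j := 1) (by decide) rfl,
      mul_zero]
  simp [magWeyl_apply, InvFrame.dualWeyl, h]

theorem magWeyl_zero_right (a : Fin 4) : m.magWeyl a 0 t = 0 := by
  have h : ∀ k l, m.frame.weyl k l 0 0 t = 0 := fun k l => by
    have : m.frame.riemLow k l 0 0 t = 0 := by
      simp [InvFrame.riemLow, riem_last_eq, frame_C_fst]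
    rw [InvFrame.weyl, this]
    ring
  simp [magWeyl_apply, InvFrame.dualWeyl, h]

theorem inv_diagonal (ht : m.t₀ < t) (hd : m.g t = Matrix.diagonal fun i => m.g t i i)
    (i j : Fin 3) : (m.g t)⁻¹ i j = if i = j then (m.g t i i)⁻¹ else 0 := by
  have : (m.g t)⁻¹ = Matrix.diagonal fun i => (m.g t i i)⁻¹ := by
    refine Matrix.inv_eq_right_inv ?_
    refine (congrArg (· * _) hd).trans ?_
    rw [Matrix.diagonal_mul_diagonal, ← Matrix.diagonal_one]
    exact congrArg Matrix.diagonal (funext fun i => mul_inv_cancel₀ (m.posDef t ht).diag_pos.ne')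
  rw [this, Matrix.diagonal_apply]

/-- The contraction of a spatial tensor in a frame in which the metric is diagonal. -/
theorem normSq_frame (ht : m.t₀ < t) (hd : m.g t = Matrix.diagonal fun i => m.g t i i)
    {T : Fin 4 → Fin 4 → ℝ} (h0 : ∀ b, T 0 b = 0) (h0' : ∀ b, T b 0 = 0) :
    m.frame.normSq T t =
      ∑ i : Fin 3, ∑ j : Fin 3, T i.succ j.succ ^ 2 / (m.g t i i * m.g t j j) := by
  simp only [InvFrame.normSq, Fin.sum_univ_succ (n := 3), h0, h0', m.inv_frame_G_succ_succ ht,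
    m.inv_diagonal ht hd]
  simp
  refine Finset.sum_congr rfl fun i _ => Finset.sum_congr rfl fun j _ => ?_
  field_simp

theorem normSq_space (ht : m.t₀ < t) (hd : m.g t = Matrix.diagonal fun i => m.g t i i)
    (T : Fin 3 → Fin 3 → ℝ) : m.space.normSq T t =
      ∑ i : Fin 3, ∑ j : Fin 3, T i j ^ 2 / (m.g t i i * m.g t j j) := by
  simp only [InvFrame.normSq, space, spaceFrame, m.inv_diagonal ht hd]
  simp
  refine Finset.sum_congr rfl fun i _ => Finset.sum_congr rfl fun j _ => ?_
  field_simp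

namespace IsDiagonal
variable {m}

theorem g_eq_of (h : m.IsDiagonal) (ht : m.t₀ < t) :
    m.g t = !![m.g t 0 0, 0, 0; 0, m.g t 1 1, 0; 0, 0, m.g t 2 2] := by
  conv_lhs => rw [h.g_eq t ht]
  ext i j
  fin_cases i <;> fin_cases j <;> simp

theorem g_ne (h : m.IsDiagonal) (ht : m.t₀ < t) {i j : Fin 3} (hij : i ≠ j) : m.g t i j = 0 := by
  rw [h.g_eq t ht, Matrix.diagonal_apply_ne _ hij]

theorem deriv_g_ne (h : m.IsDiagonal) (ht : m.t₀ < t) {i j : Fin 3} (hij : i ≠ j) :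
    deriv (fun s => m.g s i j) t = 0 := by
  have : (fun s => m.g s i j) =ᶠ[nhds t] fun _ => 0 := by
    filter_upwards [Ioi_mem_nhds ht] with s hs using h.g_ne hs hij
  rw [this.deriv_eq, deriv_const]

theorem extr_apply (h : m.IsDiagonal) (ht : m.t₀ < t) (i j : Fin 3) :
    m.extr i j t = (m.g t i i)⁻¹ * (1 / 2 * deriv (fun s => m.g s i j) t) := by
  simp [extr, m.inv_diagonal ht (h.g_eq t ht)]

theorem extr_ne (h : m.IsDiagonal) (ht : m.t₀ < t) {i j : Fin 3} (hij : i ≠ j) :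
    m.extr i j t = 0 := by
  rw [h.extr_apply ht, h.deriv_g_ne ht hij]; simp

theorem hasDerivAt_g (h : m.IsDiagonal) (ht : m.t₀ < t) (i : Fin 3) :
    HasDerivAt (fun s => m.g s i i) (2 * m.g t i i * m.extr i i t) t := by
  have hi : m.g t i i ≠ 0 := (m.posDef t ht).diag_pos.ne'
  refine (m.isRegularOn_space.differentiableAt ht i i).hasDerivAt.congr_deriv ?_
  change deriv (fun s => m.g s i i) t = _
  rw [h.extr_apply ht]
  field_simp

theorem deriv_deriv_g (h : m.IsDiagonal) (ht : m.t₀ < t) (i : Fin 3) :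
    deriv (deriv fun s => m.g s i i) t =
    2 * (2 * m.g t i i * m.extr i i t * m.extr i i t + m.g t i i * deriv (m.extr i i) t) := by
  have h1 : (deriv fun s => m.g s i i) =ᶠ[nhds t] fun s => 2 * (m.g s i i * m.extr i i s) := by
    filter_upwards [Ioi_mem_nhds ht] with s hs
    rw [(h.hasDerivAt_g hs i).deriv]; ring
  rw [h1.deriv_eq]
  have h2 := ((h.hasDerivAt_g ht i).mul (m.differentiableAt_extr ht i i).hasDerivAt).const_mul 2
  exact h2.deriv

theorem hasDerivAt_extr_of_ricci (h : m.IsDiagonal) (ht : m.t₀ < t) (i : Fin 3) :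
    HasDerivAt (m.extr i i)
    (m.μ t / 3 - m.extr i i t * (m.extr 0 0 t + m.extr 1 1 t + m.extr 2 2 t)
      - m.space.ricci i i t / m.g t i i) t := by
  have hi : m.g t i i ≠ 0 := (m.posDef t ht).diag_pos.ne'
  have h1 := m.ricci_succ_succ ht i i
  have h2 : ∀ k, 1 / 2 * deriv (fun s => m.g s k i) t * m.extr k i t =
      if k = i then m.g t i i * m.extr i i t ^ 2 else 0 := fun k => by
    split_ifs with hk
    · rw [hk, (h.hasDerivAt_g ht i).deriv]; ring
    · rw [h.extr_ne ht hk, mul_zero]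
  rw [m.ricci_succ_eq ht, h.deriv_deriv_g ht] at h1
  simp only [h2] at h1
  rw [(h.hasDerivAt_g ht i).deriv] at h1
  simp only [Finset.sum_ite_eq', Finset.mem_univ, if_true] at h1
  rw [Fin.sum_univ_three] at h1
  refine (m.differentiableAt_extr ht i i).hasDerivAt.congr_deriv ?_
  field_simp
  linarith

theorem hasDerivAt_extr (h : m.IsDiagonal) (ht : m.t₀ < t) :
    HasDerivAt (m.extr 0 0)
      (m.μ t / 3 - m.extr 0 0 t * (m.extr 0 0 t + m.extr 1 1 t + m.extr 2 2 t)
        + (m.g t 1 1 - m.g t 2 2) ^ 2 / (2 * m.g t 0 0 * m.g t 1 1 * m.g t 2 2)) t ∧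
    HasDerivAt (m.extr 1 1)
      (m.μ t / 3 - m.extr 1 1 t * (m.extr 0 0 t + m.extr 1 1 t + m.extr 2 2 t)
        - (m.g t 1 1 ^ 2 - m.g t 2 2 ^ 2) / (2 * m.g t 0 0 * m.g t 1 1 * m.g t 2 2)) t ∧
    HasDerivAt (m.extr 2 2)
      (m.μ t / 3 - m.extr 2 2 t * (m.extr 0 0 t + m.extr 1 1 t + m.extr 2 2 t)
        + (m.g t 1 1 ^ 2 - m.g t 2 2 ^ 2) / (2 * m.g t 0 0 * m.g t 1 1 * m.g t 2 2)) t := by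
  have hi : ∀ i, m.g t i i ≠ 0 := fun i => (m.posDef t ht).diag_pos.ne'
  have hR := ricci_of_diagonal (h.g_eq_of ht) (hi 0) (hi 1) (hi 2)
  refine ⟨(h.hasDerivAt_extr_of_ricci ht 0).congr_deriv ?_,
    (h.hasDerivAt_extr_of_ricci ht 1).congr_deriv ?_,
    (h.hasDerivAt_extr_of_ricci ht 2).congr_deriv ?_⟩ <;>
  · rw [space, hR]
    have := hi 0
    have := hi 1
    have := hi 2
    simp
    field_simp <;> ring

/-- The Hamiltonian constraint. -/
theorem hamiltonian (h : m.IsDiagonal) (ht : m.t₀ < t) :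
    (m.extr 0 0 t + m.extr 1 1 t + m.extr 2 2 t) ^ 2
    - (m.extr 0 0 t ^ 2 + m.extr 1 1 t ^ 2 + m.extr 2 2 t ^ 2)
    - (m.g t 1 1 - m.g t 2 2) ^ 2 / (2 * m.g t 0 0 * m.g t 1 1 * m.g t 2 2) = 2 * m.μ t := by
  have h1 := m.ricci_zero_zero ht
  rw [m.ricci_eq ht] at h1
  obtain ⟨d0, d1, d2⟩ := h.hasDerivAt_extr ht
  simp only [Fin.sum_univ_three, d0.deriv, d1.deriv, d2.deriv, frame_G_zero_zero,
    h.extr_ne ht (by decide : (0 : Fin 3) ≠ 1), h.extr_ne ht (by decide : (0 : Fin 3) ≠ 2),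
    h.extr_ne ht (by decide : (1 : Fin 3) ≠ 0), h.extr_ne ht (by decide : (1 : Fin 3) ≠ 2),
    h.extr_ne ht (by decide : (2 : Fin 3) ≠ 0), h.extr_ne ht (by decide : (2 : Fin 3) ≠ 1)] at h1
  simp [timeProj] at h1
  linarith

theorem normSq_shear (h : m.IsDiagonal) (ht : m.t₀ < t) :
    m.frame.normSq (fun a b => m.shear a b t) t =
    (m.extr 0 0 t - m.H t) ^ 2 + (m.extr 1 1 t - m.H t) ^ 2 + (m.extr 2 2 t - m.H t) ^ 2 := by
  have hi : ∀ i, m.g t i i ≠ 0 := fun i => (m.posDef t ht).diag_pos.ne'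
  rw [m.normSq_frame ht (h.g_eq t ht) (fun b => m.shear_zero_left b) fun b => m.shear_zero_right b]
  have h1 : ∀ i j : Fin 3, m.shear i.succ j.succ t ^ 2 / (m.g t i i * m.g t j j) =
      if i = j then (m.extr i i t - m.H t) ^ 2 else 0 := fun i j => by
    rw [m.shear_succ_succ ht]
    split_ifs with hij
    · subst hij
      have := hi i
      rw [(h.hasDerivAt_g ht i).deriv]
      field_simp
    · rw [h.g_ne ht hij, h.deriv_g_ne ht hij]; simp
  simp only [h1, Finset.sum_ite_eq, Finset.mem_univ, if_true, Fin.sum_univ_three]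

theorem normSq_ricciTF (h : m.IsDiagonal) (ht : m.t₀ < t) :
    m.space.normSq (fun i j => m.ricciTF i j t) t =
    2 / 3 * ((m.g t 1 1 - m.g t 2 2) ^ 2 / (2 * m.g t 0 0 * m.g t 1 1 * m.g t 2 2)) ^ 2
    + 2 * ((m.g t 1 1 ^ 2 - m.g t 2 2 ^ 2) / (2 * m.g t 0 0 * m.g t 1 1 * m.g t 2 2)) ^ 2 := by
  have hi : ∀ i, m.g t i i ≠ 0 := fun i => (m.posDef t ht).diag_pos.ne'
  have hR := ricci_of_diagonal (h.g_eq_of ht) (hi 0) (hi 1) (hi 2)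
  rw [m.normSq_space ht (h.g_eq t ht)]
  have hs : m.space.scalar t =
      -(m.g t 1 1 - m.g t 2 2) ^ 2 / (2 * m.g t 0 0 * m.g t 1 1 * m.g t 2 2) := by
    rw [InvFrame.scalar]
    have : ∀ i j, (m.space.G t)⁻¹ i j = _ := m.inv_diagonal ht (h.g_eq t ht)
    simp only [this]
    rw [space]
    simp only [hR]
    have := hi 0
    have := hi 1
    have := hi 2
    simp [Fin.sum_univ_three]
    field_simp
    ring
  have h0 := hi 0
  have h1 := hi 1
  have h2 := hi 2
  simp only [ricciTF, hs, Fin.sum_univ_three]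
  rw [space]
  simp only [hR, h.g_ne ht (by decide : (0 : Fin 3) ≠ 1), h.g_ne ht (by decide : (0 : Fin 3) ≠ 2),
    h.g_ne ht (by decide : (1 : Fin 3) ≠ 0), h.g_ne ht (by decide : (1 : Fin 3) ≠ 2),
    h.g_ne ht (by decide : (2 : Fin 3) ≠ 0), h.g_ne ht (by decide : (2 : Fin 3) ≠ 1)]
  simp
  field_simp
  ring

/-- A bound for the norm of a spatial tensor by the trace-free part of its diagonal in the plane of
`e₁` and `e₂`. -/
theorem normSq_frame_ge (h : m.IsDiagonal) (ht : m.t₀ < t) {T : Fin 4 → Fin 4 → ℝ}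
    (h0 : ∀ b, T 0 b = 0) (h0' : ∀ b, T b 0 = 0) : (T 2 2 / m.g t 1 1 - T 3 3 / m.g t 2 2) ^ 2 / 2 ≤
      m.frame.normSq T t := by
  have hi : ∀ i, 0 < m.g t i i := fun i => (m.posDef t ht).diag_pos
  rw [m.normSq_frame ht (h.g_eq t ht) h0 h0']
  have hnn : ∀ i j : Fin 3, 0 ≤ T i.succ j.succ ^ 2 / (m.g t i i * m.g t j j) := fun i j => by
    have := hi i
    have := hi j
    positivity
  have e1 : T (Fin.succ 1) (Fin.succ 1) ^ 2 / (m.g t 1 1 * m.g t 1 1) =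
      (T 2 2 / m.g t 1 1) ^ 2 := by
    rw [div_pow, sq (m.g t 1 1)]; rfl
  have e2 : T (Fin.succ 2) (Fin.succ 2) ^ 2 / (m.g t 2 2 * m.g t 2 2) =
      (T 3 3 / m.g t 2 2) ^ 2 := by
    rw [div_pow, sq (m.g t 2 2)]; rfl
  have h1 := hnn 0 0
  have h2 := hnn 0 1
  have h3 := hnn 0 2
  have h4 := hnn 1 0
  have h5 := hnn 1 2
  have h6 := hnn 2 0
  have h7 := hnn 2 1
  simp only [Fin.sum_univ_three, e1, e2]
  nlinarith [sq_nonneg (T 2 2 / m.g t 1 1 + T 3 3 / m.g t 2 2)]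

theorem elWeyl_diag (h : m.IsDiagonal) (ht : m.t₀ < t) (i : Fin 3) :
    m.elWeyl i.succ i.succ t / m.g t i i =
    -deriv (m.extr i i) t - m.extr i i t ^ 2 - m.μ t / 3 := by
  have hi : m.g t i i ≠ 0 := (m.posDef t ht).diag_pos.ne'
  have h1 : ∀ k l, m.extr k l t = if k = l then m.extr k k t else 0 := fun k l => by
    split_ifs with hkl
    · rw [hkl]
    · exact h.extr_ne ht hkl
  have h2 : ∀ k, m.g t i k = if i = k then m.g t i i else 0 := fun k => by
    split_ifs with hkl
    · rw [hkl]
    · exact h.g_ne ht hkl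
  rw [m.elWeyl_succ_succ ht, Finset.sum_eq_single i, Finset.sum_eq_single i]
  · field_simp
  · intro k _ hk
    rw [h.extr_ne ht hk, mul_zero]
  · simp
  · intro k _ hk
    rw [h.g_ne ht hk.symm, zero_mul]
  · simp

theorem weyl_succ_succ_succ_zero (h : m.IsDiagonal) (ht : m.t₀ < t) (i j k : Fin 3) :
    m.frame.weyl i.succ j.succ k.succ 0 t = m.g t i i * m.frame.riem i.succ j.succ k.succ 0 t := by
  have h1 : ∑ l, m.g t i l * m.frame.riem l.succ j.succ k.succ 0 t =
      m.g t i i * m.frame.riem i.succ j.succ k.succ 0 t :=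
    Finset.sum_eq_single i (fun l _ hl => by rw [h.g_ne ht hl.symm, zero_mul]) (by simp)
  have h2 : ∀ l : Fin 3, m.frame.ricci l.succ 0 t = 0 := fun l => by
    rw [m.ricci_eq ht]; simp [timeProj, (Fin.succ_ne_zero _).symm]
  rw [InvFrame.weyl, riemLow_succ, h1]
  simp [h2]

theorem riem_apply (h : m.IsDiagonal) (ht : m.t₀ < t) (i j k : Fin 3) :
    m.frame.riem i.succ j.succ k.succ 0 t = -deriv (m.space.conn i k j) t
      + (m.extr j j t - m.extr i i t) * m.space.conn i k j t := by
  rw [m.riem_succ_succ_succ_zero ht,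
    Finset.sum_eq_single j (fun l _ hl => by rw [h.extr_ne ht hl, zero_mul]) (by simp),
    Finset.sum_eq_single i (fun l _ hl => by rw [h.extr_ne ht hl.symm, zero_mul]) (by simp)]
  ring

theorem hasDerivAt_ratio (h : m.IsDiagonal) (ht : m.t₀ < t) (i j : Fin 3) :
    HasDerivAt (fun s => m.g s i i / m.g s j j)
      (2 * (m.extr i i t - m.extr j j t) * (m.g t i i / m.g t j j)) t := by
  have hj : m.g t j j ≠ 0 := (m.posDef t ht).diag_pos.ne'
  refine ((h.hasDerivAt_g ht i).div (h.hasDerivAt_g ht j) hj).congr_deriv ?_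
  field_simp

theorem magWeyl_diag (h : m.IsDiagonal) (ht : m.t₀ < t) :
    m.magWeyl 2 2 t / m.g t 1 1 = ((m.g t 1 1 - m.g t 2 2) * (m.extr 0 0 t + m.extr 2 2 t) / 2
        - m.g t 1 1 * m.extr 1 1 t + m.g t 2 2 * m.extr 2 2 t)
        / Real.sqrt (m.g t 0 0 * m.g t 1 1 * m.g t 2 2) ∧
    m.magWeyl 3 3 t / m.g t 2 2 = -((m.g t 1 1 - m.g t 2 2) * (m.extr 0 0 t + m.extr 1 1 t) / 2
        - m.g t 1 1 * m.extr 1 1 t + m.g t 2 2 * m.extr 2 2 t)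
        / Real.sqrt (m.g t 0 0 * m.g t 1 1 * m.g t 2 2) := by
  have hi : ∀ i, m.g t i i ≠ 0 := fun i => (m.posDef t ht).diag_pos.ne'
  have hp : ∀ i, 0 < m.g t i i := fun i => (m.posDef t ht).diag_pos
  have hconn : ∀ s, m.t₀ < s →
      m.space.conn 0 1 2 s = (m.g s 1 1 / m.g s 0 0 - m.g s 2 2 / m.g s 0 0) / 2 ∧
      m.space.conn 0 2 1 s = (m.g s 1 1 / m.g s 0 0 - m.g s 2 2 / m.g s 0 0) / 2 ∧
      m.space.conn 2 1 0 s = (1 - m.g s 1 1 / m.g s 2 2) / 2 ∧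
      m.space.conn 1 2 0 s = (m.g s 2 2 / m.g s 1 1 - 1) / 2 := fun s hs => by
    have hi : ∀ i, m.g s i i ≠ 0 := fun i => (m.posDef s hs).diag_pos.ne'
    obtain ⟨h1, h2, h3, h4⟩ := conn_of_diagonal (h.g_eq_of hs) (hi 0) (hi 1) (hi 2)
    have := hi 0
    have := hi 1
    have := hi 2
    rw [space, h1, h2, h3, h4]
    refine ⟨?_, ?_, ?_, ?_⟩ <;> field_simp
  have hnhds : Ioi m.t₀ ∈ nhds t := Ioi_mem_nhds ht
  have d1 : deriv (m.space.conn 0 1 2) t = _ := (Filter.EventuallyEq.deriv_eq (by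
    filter_upwards [hnhds] with s hs using (hconn s hs).1)).trans
    (((h.hasDerivAt_ratio ht 1 0).sub (h.hasDerivAt_ratio ht 2 0)).div_const 2).deriv
  have d2 : deriv (m.space.conn 0 2 1) t = _ := (Filter.EventuallyEq.deriv_eq (by
    filter_upwards [hnhds] with s hs using (hconn s hs).2.1)).trans
    (((h.hasDerivAt_ratio ht 1 0).sub (h.hasDerivAt_ratio ht 2 0)).div_const 2).deriv
  have d3 : deriv (m.space.conn 2 1 0) t = _ := (Filter.EventuallyEq.deriv_eq (by
    filter_upwards [hnhds] with s hs using (hconn s hs).2.2.1)).trans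
    (((h.hasDerivAt_ratio ht 1 2).const_sub 1).div_const 2).deriv
  have d4 : deriv (m.space.conn 1 2 0) t = _ := (Filter.EventuallyEq.deriv_eq (by
    filter_upwards [hnhds] with s hs using (hconn s hs).2.2.2)).trans
    (((h.hasDerivAt_ratio ht 2 1).sub_const 1).div_const 2).deriv
  have w1 : m.frame.weyl 1 3 2 0 t = _ :=
    (h.weyl_succ_succ_succ_zero ht 0 2 1).trans (congrArg _ (h.riem_apply ht 0 2 1))
  have w2 : m.frame.weyl 3 1 2 0 t = _ :=
    (h.weyl_succ_succ_succ_zero ht 2 0 1).trans (congrArg _ (h.riem_apply ht 2 0 1))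
  have w3 : m.frame.weyl 1 2 3 0 t = _ :=
    (h.weyl_succ_succ_succ_zero ht 0 1 2).trans (congrArg _ (h.riem_apply ht 0 1 2))
  have w4 : m.frame.weyl 2 1 3 0 t = _ :=
    (h.weyl_succ_succ_succ_zero ht 1 0 2).trans (congrArg _ (h.riem_apply ht 1 0 2))
  obtain ⟨c1, c2, c3, c4⟩ := hconn t ht
  rw [d1, c1] at w1
  rw [d3, c3] at w2
  rw [d2, c2] at w3
  rw [d4, c4] at w4
  have hdet : |(m.frame.G t).det| = m.g t 0 0 * m.g t 1 1 * m.g t 2 2 := by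
    rw [frame, det_spacetime_G, abs_neg, h.g_eq_of ht, Matrix.det_fin_three]
    simp
    rw [abs_of_pos (hp 0), abs_of_pos (hp 1), abs_of_pos (hp 2)]
  set ρ := Real.sqrt (m.g t 0 0 * m.g t 1 1 * m.g t 2 2) with hρ
  have hρ2 : ρ ^ 2 = m.g t 0 0 * m.g t 1 1 * m.g t 2 2 :=
    Real.sq_sqrt (by have := hp 0; have := hp 1; have := hp 2; positivity)
  have hρ0 : ρ ≠ 0 := fun h0 => by
    rw [h0] at hρ2
    exact (mul_pos (mul_pos (hp 0) (hp 1)) (hp 2)).ne (by simpa using hρ2)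
  have hinv : ∀ a b, (m.frame.G t)⁻¹ a b = if a = b then
      (![-1, (m.g t 0 0)⁻¹, (m.g t 1 1)⁻¹, (m.g t 2 2)⁻¹] : Fin 4 → ℝ) a else 0 := fun a b => by
    induction a using Fin.cases with
    | zero =>
      induction b using Fin.cases with
      | zero => simp [m.inv_frame_G_zero_zero ht]
      | succ j => simp [m.inv_frame_G_zero_succ ht, (Fin.succ_ne_zero _).symm]
    | succ i =>
      induction b using Fin.cases with
      | zero => simp [m.inv_frame_G_succ_zero ht, Fin.succ_ne_zero]
      | succ j =>
        rw [m.inv_frame_G_succ_succ ht, m.inv_diagonal ht (h.g_eq t ht)]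
        simp only [Fin.succ_inj]
        congr 1
        fin_cases i <;> rfl
  have m2 : m.magWeyl 2 2 t = ρ / (m.g t 0 0 * m.g t 2 2) * (m.frame.weyl 1 3 2 0 t
      - m.frame.weyl 3 1 2 0 t) / 2 := by
    rw [magWeyl_apply, InvFrame.dualWeyl]
    simp only [hinv, vol_eq, det_rows, hdet, Pi.single_apply, mul_ite, ite_mul, mul_zero, zero_mul,
      Finset.sum_ite_eq, Finset.mem_univ, if_true]
    simp [Fin.sum_univ_four, ← hρ]
    field_simp
    ring
  have m3 : m.magWeyl 3 3 t = ρ / (m.g t 0 0 * m.g t 1 1) * (m.frame.weyl 2 1 3 0 t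
      - m.frame.weyl 1 2 3 0 t) / 2 := by
    rw [magWeyl_apply, InvFrame.dualWeyl]
    simp only [hinv, vol_eq, det_rows, hdet, Pi.single_apply, mul_ite, ite_mul, mul_zero, zero_mul,
      Finset.sum_ite_eq, Finset.mem_univ, if_true]
    simp [Fin.sum_univ_four, ← hρ]
    field_simp
    ring
  have h0 := hi 0
  have h1 := hi 1
  have h2 := hi 2
  rw [m2, m3, w1, w2, w3, w4, div_eq_div_iff h1 hρ0, div_eq_div_iff h2 hρ0]
  constructor
  · field_simp
    rw [hρ2]
    ring
  · field_simp
    rw [hρ2]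
    ring

end IsDiagonal

end Model

/-! ### The expansion-normalized evolution equations -/

/-- A solution of the expansion-normalized evolution equations of a Bianchi VII₀ radiation model.
In the usual notation `s = Σ₊`, `x = √3 Σ₋`, `y = √3 N₋`, `N = N₊` and `Om = Ω`; the equations are
written for the clock time `t`, where `τ` with `dτ/dt = H` is the Hubble time. The field `Om_eq` is
the Hamiltonian constraint, `sq_lt` says that the metric is positive definite, and `exists_ne`
excludes the LRS solutions `x = y = 0`. -/
structure Flow where
  t₀ : ℝ
  H : ℝ → ℝ
  s : ℝ → ℝ
  x : ℝ → ℝ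
  y : ℝ → ℝ
  N : ℝ → ℝ
  Om : ℝ → ℝ
  τ : ℝ → ℝ
  H_pos : ∀ t, t₀ < t → 0 < H t
  Om_pos : ∀ t, t₀ < t → 0 < Om t
  N_pos : ∀ t, t₀ < t → 0 < N t
  sq_lt : ∀ t, t₀ < t → y t ^ 2 < N t ^ 2
  Om_eq : ∀ t, t₀ < t → Om t = 1 - s t ^ 2 - (x t ^ 2 + y t ^ 2) / 3
  deriv_H : ∀ t, t₀ < t → HasDerivAt H (-(2 + s t ^ 2 + (x t ^ 2 - y t ^ 2) / 3) * H t ^ 2) t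
  deriv_s : ∀ t, t₀ < t → HasDerivAt s
    (H t * ((s t ^ 2 + (x t ^ 2 - y t ^ 2) / 3 - 1) * s t - 2 / 3 * y t ^ 2)) t
  deriv_x : ∀ t, t₀ < t → HasDerivAt x
    (H t * ((s t ^ 2 + (x t ^ 2 - y t ^ 2) / 3 - 1) * x t - 2 * N t * y t)) t
  deriv_y : ∀ t, t₀ < t → HasDerivAt y
    (H t * ((1 + s t ^ 2 + (x t ^ 2 - y t ^ 2) / 3 + 2 * s t) * y t + 2 * N t * x t)) t
  deriv_N : ∀ t, t₀ < t → HasDerivAt N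
    (H t * ((1 + s t ^ 2 + (x t ^ 2 - y t ^ 2) / 3 + 2 * s t) * N t + 2 * x t * y t)) t
  deriv_τ : ∀ t, t₀ < t → HasDerivAt τ (H t) t
  exists_ne : ∃ t, t₀ < t ∧ y t ≠ 0

namespace Flow
variable (F : Flow) {t : ℝ}

/-- The deceleration parameter. -/
def q (t : ℝ) : ℝ := 1 + F.s t ^ 2 + (F.x t ^ 2 - F.y t ^ 2) / 3

/-- The square of the amplitude of the oscillations of `(x, y)`. -/
def amp (t : ℝ) : ℝ := F.x t ^ 2 + F.y t ^ 2

/-- The product `x y / N`, whose derivative is `2 (x² - y²)` up to a small error. Adding multiples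
of it to a slowly varying quantity replaces the oscillating terms by their averages. -/
def ζ (t : ℝ) : ℝ := F.x t * F.y t / F.N t

section Bounds

theorem amp_le (ht : F.t₀ < t) : F.s t ^ 2 + F.amp t / 3 < 1 := by
  have h1 := F.Om_eq t ht
  have h2 := F.Om_pos t ht
  unfold amp; linarith

theorem s_sq_lt (ht : F.t₀ < t) : F.s t ^ 2 < 1 := by
  have := F.amp_le ht
  unfold amp at this
  nlinarith [sq_nonneg (F.x t), sq_nonneg (F.y t)]

theorem abs_s_lt (ht : F.t₀ < t) : |F.s t| < 1 := by
  have := F.s_sq_lt ht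
  rwa [sq_lt_one_iff_abs_lt_one] at this

theorem amp_lt (ht : F.t₀ < t) : F.amp t < 3 := by
  have := F.amp_le ht
  nlinarith [sq_nonneg (F.s t)]

theorem q_nonneg (ht : F.t₀ < t) : 0 ≤ F.q t := by
  have := F.amp_le ht
  unfold amp at this; unfold q
  nlinarith [sq_nonneg (F.x t), sq_nonneg (F.y t), sq_nonneg (F.s t)]

theorem q_le (ht : F.t₀ < t) : F.q t ≤ 2 := by
  have := F.amp_le ht
  unfold amp at this; unfold q
  nlinarith [sq_nonneg (F.x t), sq_nonneg (F.y t), sq_nonneg (F.s t)]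

theorem Om_le_one (ht : F.t₀ < t) : F.Om t ≤ 1 := by
  have h1 := F.Om_eq t ht
  nlinarith [sq_nonneg (F.x t), sq_nonneg (F.y t), sq_nonneg (F.s t)]

theorem abs_y_lt (ht : F.t₀ < t) : |F.y t| < F.N t :=
  abs_lt_of_sq_lt_sq (F.sq_lt t ht) (F.N_pos t ht).le

theorem abs_ζ_le_abs_x (ht : F.t₀ < t) : |F.ζ t| ≤ |F.x t| := by
  have hN := F.N_pos t ht
  rw [ζ, abs_div, abs_mul, abs_of_pos hN, div_le_iff₀ hN]
  exact mul_le_mul_of_nonneg_left (F.abs_y_lt ht).le (abs_nonneg _)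

theorem abs_ζ_le_two (ht : F.t₀ < t) : |F.ζ t| ≤ 2 := by
  refine (F.abs_ζ_le_abs_x ht).trans ?_
  have := F.amp_lt ht
  unfold amp at this
  exact abs_le_of_sq_le_sq (by nlinarith [sq_nonneg (F.y t)]) (by norm_num)

theorem abs_ζ_le_amp (ht : F.t₀ < t) : |F.ζ t| ≤ F.amp t / (2 * F.N t) := by
  have hN := F.N_pos t ht
  rw [ζ, abs_div, abs_mul, abs_of_pos hN, div_le_div_iff₀ hN (by positivity)]
  have : 2 * (|F.x t| * |F.y t|) ≤ F.amp t := by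
    rw [amp, ← sq_abs (F.x t), ← sq_abs (F.y t)]
    nlinarith [sq_nonneg (|F.x t| - |F.y t|)]
  nlinarith

theorem abs_ζ_le (ht : F.t₀ < t) : |F.ζ t| ≤ 3 / 2 * (F.N t)⁻¹ := by
  have hN := F.N_pos t ht
  refine (F.abs_ζ_le_amp ht).trans ?_
  rw [div_le_iff₀ (by positivity)]
  have := F.amp_lt ht
  field_simp
  linarith

end Bounds

section Derivatives

theorem hasDerivAt_log_N (ht : F.t₀ < t) : HasDerivAt (fun t => Real.log (F.N t))
    (F.H t * (F.q t + 2 * F.s t + 2 * F.ζ t)) t := by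
  have hN := (F.N_pos t ht).ne'
  refine ((F.deriv_N t ht).log hN).congr_deriv ?_
  unfold q ζ
  field_simp

theorem hasDerivAt_ζ (ht : F.t₀ < t) : HasDerivAt F.ζ
    (F.H t * ((F.q t - 2) * F.ζ t + 2 * (F.x t ^ 2 - F.y t ^ 2) - 2 * F.ζ t ^ 2)) t := by
  have hN := (F.N_pos t ht).ne'
  refine (((F.deriv_x t ht).mul (F.deriv_y t ht)).div (F.deriv_N t ht) hN).congr_deriv ?_
  simp only [Pi.mul_apply, q, ζ]
  field_simp
  ring

theorem hasDerivAt_amp (ht : F.t₀ < t) : HasDerivAt F.amp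
    (F.H t * (2 * (F.q t - 2) * F.x t ^ 2 + 2 * (F.q t + 2 * F.s t) * F.y t ^ 2)) t := by
  refine (((F.deriv_x t ht).pow 2).add ((F.deriv_y t ht).pow 2)).congr_deriv ?_
  simp only [q]
  norm_num
  ring

theorem hasDerivAt_Om (ht : F.t₀ < t) : HasDerivAt F.Om
    (F.H t * (2 * (F.q t - 1) * F.Om t)) t := by
  have h1 : F.Om =ᶠ[nhds t] fun t => 1 - F.s t ^ 2 - F.amp t / 3 := by
    filter_upwards [Ioi_mem_nhds ht] with s hs using F.Om_eq s hs
  refine HasDerivAt.congr_of_eventuallyEq ?_ h1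
  refine ((((F.deriv_s t ht).pow 2).const_sub 1).sub
    ((F.hasDerivAt_amp ht).div_const 3)).congr_deriv ?_
  rw [F.Om_eq t ht]
  simp only [q]
  norm_num
  ring

theorem hasDerivAt_log_Om (ht : F.t₀ < t) : HasDerivAt (fun t => Real.log (F.Om t))
    (F.H t * (2 * (F.q t - 1))) t := by
  have hO := (F.Om_pos t ht).ne'
  refine ((F.hasDerivAt_Om ht).log hO).congr_deriv ?_
  field_simp

end Derivatives

section Comparison

theorem eventually_gt : ∀ᶠ t in atTop, F.t₀ < t := eventually_gt_atTop _

theorem monotoneOn_of_deriv {Φ φ : ℝ → ℝ} {T : ℝ} (hT : F.t₀ < T)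
    (hΦ : ∀ t, T ≤ t → HasDerivAt Φ (F.H t * φ t) t) (hφ : ∀ t, T ≤ t → 0 ≤ φ t) :
    MonotoneOn Φ (Ici T) := by
  refine monotoneOn_of_deriv_nonneg (convex_Ici T)
    (fun t ht => (hΦ t ht).continuousAt.continuousWithinAt)
    (fun t ht => (hΦ t (interior_subset ht)).differentiableAt.differentiableWithinAt) fun t ht => ?_
  have ht' : T ≤ t := interior_subset ht
  rw [(hΦ t ht').deriv]
  exact mul_nonneg (F.H_pos t (hT.trans_le ht')).le (hφ t ht')

theorem exists_tendsto_of_monotoneOn {Φ : ℝ → ℝ} {T M : ℝ} (h : MonotoneOn Φ (Ici T))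
    (hM : ∀ t, T ≤ t → Φ t ≤ M) : ∃ l, Tendsto Φ atTop (nhds l) := by
  have hmono : Monotone fun t => Φ (max t T) := fun a b hab =>
    h (mem_Ici.mpr (le_max_right _ _)) (mem_Ici.mpr (le_max_right _ _)) (max_le_max_right T hab)
  obtain h1 | ⟨l, hl⟩ := tendsto_atTop_of_monotone hmono
  · obtain ⟨t, ht⟩ := (h1.eventually_gt_atTop M).exists
    exact absurd (hM _ (le_max_right t T)) (not_le.mpr ht)
  · refine ⟨l, hl.congr' ?_⟩
    filter_upwards [eventually_ge_atTop T] with t ht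
    rw [max_eq_left ht]

theorem add_const_le_of_deriv {Φ φ : ℝ → ℝ} {T c : ℝ} (hT : F.t₀ < T)
    (hΦ : ∀ t, T ≤ t → HasDerivAt Φ (F.H t * φ t) t) (hφ : ∀ t, T ≤ t → c ≤ φ t)
    (ht : T ≤ t) : c * F.τ t + (Φ T - c * F.τ T) ≤ Φ t := by
  have h1 : MonotoneOn (fun t => Φ t - c * F.τ t) (Ici T) :=
    F.monotoneOn_of_deriv (φ := fun t => φ t - c) hT
      (fun t ht => ((hΦ t ht).sub ((F.deriv_τ t (hT.trans_le ht)).const_mul c)).congr_deriv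
        (by ring)) (fun t ht => sub_nonneg.mpr (hφ t ht))
  have h2 := h1 (mem_Ici.mpr le_rfl) (mem_Ici.mpr ht) ht
  simp only at h2
  linarith

/-- The Hubble time is unbounded, since `H ≥ 1 / (3 t + C)`. -/
theorem tendsto_τ : Tendsto F.τ atTop atTop := by
  set T := F.t₀ + 1
  have hT : F.t₀ < T := by simp [T]
  have hpos : ∀ t, T ≤ t → F.t₀ < t := fun t ht => hT.trans_le ht
  set C := (F.H T)⁻¹
  have hC : 0 < C := inv_pos.mpr (F.H_pos T hT)
  have hder : ∀ t, T ≤ t → HasDerivAt (fun t => 3 * t - (F.H t)⁻¹)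
      (F.H t * ((2 - F.q t) / F.H t)) t :=
    fun t ht => by
      have hH := (F.H_pos t (hpos t ht)).ne'
      refine (((hasDerivAt_id t).const_mul 3).sub ((F.deriv_H t (hpos t ht)).inv hH)).congr_deriv ?_
      unfold q
      field_simp
      ring
  have hmono := F.monotoneOn_of_deriv hT hder fun t ht =>
    div_nonneg (by linarith [F.q_le (hpos t ht)]) (F.H_pos t (hpos t ht)).le
  have hH : ∀ t, T ≤ t → (F.H t)⁻¹ ≤ C + 3 * (t - T) := fun t ht => by
    have := hmono (mem_Ici.mpr le_rfl) (mem_Ici.mpr ht) ht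
    simp only at this
    linarith
  have hlog : ∀ t, T ≤ t → HasDerivAt (fun t => F.τ t - 1 / 3 * Real.log (C + 3 * (t - T)))
      (F.H t * (1 - (F.H t)⁻¹ / (C + 3 * (t - T)))) t := fun t ht => by
    have hp : 0 < C + 3 * (t - T) := by linarith
    have hH := (F.H_pos t (hpos t ht)).ne'
    have h1 : HasDerivAt (fun t => C + 3 * (t - T)) (3 * 1) t :=
      (((hasDerivAt_id t).sub_const T).const_mul 3).const_add C
    refine ((F.deriv_τ t (hpos t ht)).sub ((h1.log hp.ne').const_mul (1 / 3))).congr_deriv ?_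
    field_simp
  have hmono' := F.monotoneOn_of_deriv hT hlog fun t ht => by
    have hp : 0 < C + 3 * (t - T) := by linarith
    rw [sub_nonneg, div_le_one hp]
    exact hH t ht
  have hlim : Tendsto (fun t => (F.τ T - 1 / 3 * Real.log (C + 3 * (T - T)))
      + 1 / 3 * Real.log (C + 3 * (t - T))) atTop atTop := by
    refine tendsto_atTop_add_const_left _ _ (Tendsto.const_mul_atTop (by norm_num) ?_)
    refine Real.tendsto_log_atTop.comp (tendsto_atTop_add_const_left _ _ ?_)
    exact Tendsto.const_mul_atTop (by norm_num) (tendsto_atTop_add_const_right _ _ tendsto_id)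
  refine tendsto_atTop_mono' _ ?_ hlim
  filter_upwards [eventually_ge_atTop T] with t ht
  have := hmono' (mem_Ici.mpr le_rfl) (mem_Ici.mpr ht) ht
  simp only at this
  linarith

theorem tendsto_atTop_of_deriv {Φ φ : ℝ → ℝ} {c : ℝ} (hc : 0 < c)
    (hΦ : ∀ᶠ t in atTop, HasDerivAt Φ (F.H t * φ t) t) (hφ : ∀ᶠ t in atTop, c ≤ φ t) :
    Tendsto Φ atTop atTop := by
  obtain ⟨T, hT⟩ := eventually_atTop.mp (hΦ.and (hφ.and F.eventually_gt))
  refine tendsto_atTop_mono' _ ?_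
    (tendsto_atTop_add_const_right _ (Φ T - c * F.τ T) (F.tendsto_τ.const_mul_atTop hc))
  filter_upwards [eventually_ge_atTop T] with t ht
  exact F.add_const_le_of_deriv (hT T le_rfl).2.2 (fun t ht => (hT t ht).1)
    (fun t ht => (hT t ht).2.1) ht

end Comparison

section Growth

/-- The logarithm of `√(N² - y²) Ω / (1 + s / 2)³`, which is a nondecreasing quantity. -/
def logMono (t : ℝ) : ℝ :=
  1 / 2 * Real.log (F.N t ^ 2 - F.y t ^ 2) + Real.log (F.Om t) - 3 * Real.log (1 + F.s t / 2)

theorem hasDerivAt_logMono (ht : F.t₀ < t) : HasDerivAt F.logMono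
    (F.H t * ((F.x t ^ 2 + (1 + 2 * F.s t) ^ 2) / (1 + F.s t / 2))) t := by
  have hP : F.N t ^ 2 - F.y t ^ 2 ≠ 0 := by have := F.sq_lt t ht; linarith
  have hs := abs_lt.mp (F.abs_s_lt ht)
  have h1 : 1 + F.s t / 2 ≠ 0 := by linarith
  have d1 := ((((F.deriv_N t ht).pow 2).sub ((F.deriv_y t ht).pow 2)).log hP).const_mul (1 / 2)
  have d2 := F.hasDerivAt_log_Om ht
  have d3 := ((((F.deriv_s t ht).div_const 2).const_add 1).log h1).const_mul 3
  refine ((d1.add d2).sub d3).congr_deriv ?_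
  have e1 : (2 : ℝ) * F.N t * (F.H t * ((1 + F.s t ^ 2 + (F.x t ^ 2 - F.y t ^ 2) / 3 + 2 * F.s t)
      * F.N t + 2 * F.x t * F.y t)) - 2 * F.y t * (F.H t * ((1 + F.s t ^ 2 +
      (F.x t ^ 2 - F.y t ^ 2) / 3 + 2 * F.s t) * F.y t + 2 * F.N t * F.x t)) =
      2 * F.H t * (F.q t + 2 * F.s t) * (F.N t ^ 2 - F.y t ^ 2) := by
    unfold q; ring
  have e2 : 1 / 2 * ((2 * F.H t * (F.q t + 2 * F.s t) * (F.N t ^ 2 - F.y t ^ 2)) /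
      (F.N t ^ 2 - F.y t ^ 2)) = F.H t * (F.q t + 2 * F.s t) := by field_simp
  have h2 : 2 + F.s t ≠ 0 := by linarith
  simp only [Pi.pow_apply, Pi.sub_apply, Nat.cast_ofNat, Nat.add_one_sub_one, pow_one]
  rw [e1, e2]
  unfold q
  field_simp
  ring

/-- The right-hand side is the rate of change of `s - ζ / 4`. -/
theorem deriv_s_sub_ζ_ge (ht : F.t₀ < t) : 1 / 10 - 5 * (F.x t ^ 2 + (1 + 2 * F.s t) ^ 2) ≤
    ((F.q t - 2) * F.s t - 2 / 3 * F.y t ^ 2)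
    - ((F.q t - 2) * F.ζ t + 2 * (F.x t ^ 2 - F.y t ^ 2) - 2 * F.ζ t ^ 2) / 4 := by
  have hs := abs_lt.mp (F.abs_s_lt ht)
  have hζ := F.abs_ζ_le_abs_x ht
  have hq0 := F.q_nonneg ht
  have hq2 := F.q_le ht
  have hy : F.y t ^ 2 ≤ 3 := by
    have := F.amp_lt ht
    unfold amp at this
    nlinarith [sq_nonneg (F.x t)]
  have hζ4 : (F.q t - 2) * F.ζ t ≤ 2 * |F.x t| := by
    have : (F.q t - 2) * F.ζ t ≤ (2 - F.q t) * |F.ζ t| := by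
      nlinarith [neg_abs_le (F.ζ t)]
    nlinarith [abs_nonneg (F.ζ t)]
  have hx : |F.x t| ≤ F.x t ^ 2 + 1 / 4 := by
    nlinarith [sq_abs (F.x t), sq_nonneg (|F.x t| - 1 / 2)]
  have hσ : |1 + 2 * F.s t| ≤ 3 * (1 + 2 * F.s t) ^ 2 + 1 / 12 := by
    nlinarith [sq_abs (1 + 2 * F.s t), sq_nonneg (6 * |1 + 2 * F.s t| - 1)]
  have hσ' := le_abs_self (1 + 2 * F.s t)
  have hσ'' := neg_abs_le (1 + 2 * F.s t)
  have hq : F.s t ^ 2 - F.s t / 2 - 3 / 4 ≤ 9 / 4 ∧ -(9 / 4) ≤ F.s t ^ 2 - F.s t / 2 - 3 / 4 :=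
    ⟨by nlinarith, by nlinarith [sq_nonneg (F.s t - 1 / 4)]⟩
  -- For `x = 0` and `s = -1/2` the right-hand side is `s³ - s = 3/8`: the terms in `y²` cancel.
  -- The deviation from this value is bounded in terms of `|x|` and `|1 + 2 s|`.
  have h3 : F.s t ^ 3 - F.s t - 3 / 8 ≥ -(9 / 8 * |1 + 2 * F.s t|) := by
    have e : F.s t ^ 3 - F.s t - 3 / 8 =
      (1 + 2 * F.s t) / 2 * (F.s t ^ 2 - F.s t / 2 - 3 / 4) := by ring
    rw [e]
    obtain h | h := abs_cases (1 + 2 * F.s t) <;> rw [h.1] <;> nlinarith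
  have h4 : F.y t ^ 2 / 3 * ((1 + 2 * F.s t) / 2) ≤ |1 + 2 * F.s t| / 2 := by
    nlinarith [sq_nonneg (F.y t), abs_nonneg (1 + 2 * F.s t)]
  have h5 : -(5 / 6) * F.x t ^ 2 ≤ F.s t * F.x t ^ 2 / 3 - F.x t ^ 2 / 2 := by
    nlinarith [sq_nonneg (F.x t)]
  have e : (F.q t - 2) * F.s t = F.s t ^ 3 - F.s t + F.s t * F.x t ^ 2 / 3
      - F.s t * F.y t ^ 2 / 3 := by unfold q; ring
  nlinarith [sq_nonneg (F.ζ t), sq_nonneg (F.x t), sq_nonneg (1 + 2 * F.s t)]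

/-- `N` grows exponentially in Hubble time. -/
theorem exists_inv_N_le : ∃ C T : ℝ, 0 < C ∧ F.t₀ < T ∧
    ∀ t, T ≤ t → (F.N t)⁻¹ ≤ C * Real.exp (-(F.τ t / 100)) := by
  have hT : F.t₀ < F.t₀ + 1 := by linarith
  set L : ℝ → ℝ := fun t => 10 * F.logMono t + (F.s t - F.ζ t / 4)
  set c := L (F.t₀ + 1) - 1 / 10 * F.τ (F.t₀ + 1)
  refine ⟨Real.exp (-((c - 30 * Real.log 2 - 3 / 2) / 10)), F.t₀ + 1, Real.exp_pos _, hT,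
    fun t ht => ?_⟩
  have h0 : 1 / 10 * F.τ t + c ≤ L t := by
    refine F.add_const_le_of_deriv hT (fun t ht => ?_) (fun t ht => ?_) ht
      (φ := fun t => 10 * ((F.x t ^ 2 + (1 + 2 * F.s t) ^ 2) / (1 + F.s t / 2)) +
        (((F.q t - 2) * F.s t - 2 / 3 * F.y t ^ 2)
        - ((F.q t - 2) * F.ζ t + 2 * (F.x t ^ 2 - F.y t ^ 2) - 2 * F.ζ t ^ 2) / 4))
    · have ht' := hT.trans_le ht
      refine (((F.hasDerivAt_logMono ht').const_mul 10).add
        ((F.deriv_s t ht').sub ((F.hasDerivAt_ζ ht').div_const 4))).congr_deriv ?_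
      unfold q
      ring
    · have ht' := hT.trans_le ht
      have hs := abs_lt.mp (F.abs_s_lt ht')
      have h1 := F.deriv_s_sub_ζ_ge ht'
      have h2 : 1 / 2 * (F.x t ^ 2 + (1 + 2 * F.s t) ^ 2) ≤
          (F.x t ^ 2 + (1 + 2 * F.s t) ^ 2) / (1 + F.s t / 2) := by
        rw [le_div_iff₀ (by linarith)]
        nlinarith [sq_nonneg (F.x t), sq_nonneg (1 + 2 * F.s t)]
      linarith
  have ht' := hT.trans_le ht
  have hN := F.N_pos t ht'
  have hs := abs_lt.mp (F.abs_s_lt ht')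
  have hζ := abs_le.mp (F.abs_ζ_le_two ht')
  have h1 : Real.log (F.N t ^ 2 - F.y t ^ 2) ≤ 2 * Real.log (F.N t) := by
    have : Real.log (F.N t ^ 2) = 2 * Real.log (F.N t) := by rw [Real.log_pow]; norm_num
    rw [← this]
    exact Real.log_le_log (by linarith [F.sq_lt t ht']) (by linarith [sq_nonneg (F.y t)])
  have h2 : Real.log (F.Om t) ≤ 0 := Real.log_nonpos (F.Om_pos t ht').le (F.Om_le_one ht')
  have h3 : -Real.log 2 ≤ Real.log (1 + F.s t / 2) := by
    rw [← Real.log_inv]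
    exact Real.log_le_log (by norm_num) (by linarith)
  have h4 : F.τ t / 100 + (c - 30 * Real.log 2 - 3 / 2) / 10 ≤ Real.log (F.N t) := by
    simp only [L, logMono] at h0
    linarith
  rw [← Real.exp_log (inv_pos.mpr hN), Real.log_inv, ← Real.exp_add]
  exact Real.exp_le_exp.mpr (by linarith)

end Growth

end Flow
namespace Flow
variable (F : Flow) {t : ℝ}

/-! ### Isotropization of the flow -/

section Isotropization

theorem tendsto_inv_N : Tendsto (fun t => (F.N t)⁻¹) atTop (nhds 0) := by
  obtain ⟨C, T, -, hT, h⟩ := F.exists_inv_N_le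
  have h1 : Tendsto (fun t => C * Real.exp (-(F.τ t / 100))) atTop (nhds (C * 0)) :=
    (Real.tendsto_exp_neg_atTop_nhds_zero.comp
      (F.tendsto_τ.atTop_div_const (by norm_num))).const_mul C
  rw [mul_zero] at h1
  refine tendsto_of_tendsto_of_tendsto_of_le_of_le' tendsto_const_nhds h1 ?_ ?_
  · filter_upwards [F.eventually_gt] with t ht using inv_nonneg.mpr (F.N_pos t ht).le
  · filter_upwards [eventually_ge_atTop T] with t ht using h t ht

theorem tendsto_N : Tendsto F.N atTop atTop := by
  have h : Tendsto (fun t => (F.N t)⁻¹) atTop (nhdsWithin 0 (Ioi 0)) :=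
    tendsto_nhdsWithin_iff.mpr ⟨F.tendsto_inv_N, by
      filter_upwards [F.eventually_gt] with t ht using inv_pos.mpr (F.N_pos t ht)⟩
  exact h.inv_tendsto_nhdsGT_zero.congr fun t => inv_inv _

theorem tendsto_ζ : Tendsto F.ζ atTop (nhds 0) := by
  have h : Tendsto (fun t => 3 / 2 * (F.N t)⁻¹) atTop (nhds 0) := by
    simpa using F.tendsto_inv_N.const_mul (3 / 2)
  refine squeeze_zero_norm' ?_ h
  filter_upwards [F.eventually_gt] with t ht using F.abs_ζ_le ht

/-- The logarithm of `Ω` with its oscillations removed by `ζ`; the last term makes up for the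
remaining errors, which decay exponentially, and makes the sum monotone for suitable `K`. -/
def avgLogOm (K t : ℝ) : ℝ :=
  Real.log (F.Om t) - F.ζ t / 3 - K * Real.exp (-(F.τ t / 100))

theorem exists_deriv_avgLogOm_ge : ∃ (K T : ℝ) (φ : ℝ → ℝ), 0 < K ∧ F.t₀ < T ∧
    ∀ t, T ≤ t → HasDerivAt (F.avgLogOm K) (F.H t * φ t) t ∧ 2 * F.s t ^ 2 ≤ φ t := by
  obtain ⟨C, T, hC, hT, h⟩ := F.exists_inv_N_le
  refine ⟨300 * C, T, fun t => 2 * F.s t ^ 2 - ((F.q t - 2) * F.ζ t - 2 * F.ζ t ^ 2) / 3 +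
    3 * C * Real.exp (-(F.τ t / 100)), by positivity, hT, fun t ht => ⟨?_, ?_⟩⟩
  · have ht' := hT.trans_le ht
    have h1 : HasDerivAt (fun t => -(F.τ t / 100)) (-(F.H t / 100)) t :=
      ((F.deriv_τ t ht').div_const 100).neg
    refine (((F.hasDerivAt_log_Om ht').sub ((F.hasDerivAt_ζ ht').div_const 3)).sub
      (h1.exp.const_mul (300 * C))).congr_deriv ?_
    unfold q
    ring
  · have ht' := hT.trans_le ht
    have h1 := F.abs_ζ_le ht'
    have h2 := abs_le.mp (F.abs_ζ_le_two ht')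
    have h3 := h t ht
    have hq0 := F.q_nonneg ht'
    have hq2 := F.q_le ht'
    have h4 : (F.q t - 2) * F.ζ t ≤ 2 * |F.ζ t| := by
      have : (F.q t - 2) * F.ζ t ≤ (2 - F.q t) * |F.ζ t| := by nlinarith [neg_abs_le (F.ζ t)]
      nlinarith [abs_nonneg (F.ζ t)]
    show 2 * F.s t ^ 2 ≤ 2 * F.s t ^ 2 - ((F.q t - 2) * F.ζ t - 2 * F.ζ t ^ 2) / 3 +
      3 * C * Real.exp (-(F.τ t / 100))
    have h5 := mul_pos hC (Real.exp_pos (-(F.τ t / 100)))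
    linarith [sq_nonneg (F.ζ t)]

theorem exists_tendsto_avgLogOm : ∃ K l : ℝ, Tendsto F.s atTop (nhds 0) ∧
    Tendsto (F.avgLogOm K) atTop (nhds l) := by
  obtain ⟨K, T, φ, hK, hT, h⟩ := F.exists_deriv_avgLogOm_ge
  have hbd : ∀ t, T ≤ t → F.avgLogOm K t ≤ 2 / 3 := fun t ht => by
    have ht' := hT.trans_le ht
    have h1 := abs_le.mp (F.abs_ζ_le_two ht')
    have h2 := Real.log_nonpos (F.Om_pos t ht').le (F.Om_le_one ht')
    have h3 := mul_pos hK (Real.exp_pos (-(F.τ t / 100)))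
    unfold avgLogOm
    linarith
  have hmono := F.monotoneOn_of_deriv hT (fun t ht => (h t ht).1)
    fun t ht => le_trans (by positivity) (h t ht).2
  obtain ⟨l, hl⟩ := exists_tendsto_of_monotoneOn hmono hbd
  -- A second monotone quantity: `s³` changes at a rate that `s²` controls.
  have hmono' := F.monotoneOn_of_deriv (Φ := fun t => 6 * F.avgLogOm K t - F.s t ^ 3)
    (φ := fun t => 6 * φ t -
      3 * F.s t ^ 2 * ((F.q t - 2) * F.s t - 2 / 3 * F.y t ^ 2)) hT
    (fun t ht => by
      refine (((h t ht).1.const_mul 6).sub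
        ((F.deriv_s t (hT.trans_le ht)).pow 3)).congr_deriv ?_
      unfold q
      norm_num
      ring)
    (fun t ht => by
      have ht' := hT.trans_le ht
      have h1 := (h t ht).2
      have hs := abs_lt.mp (F.abs_s_lt ht')
      have hq0 := F.q_nonneg ht'
      have hq2 := F.q_le ht'
      have h2 : (F.q t - 2) * F.s t - 2 / 3 * F.y t ^ 2 ≤ 2 := by
        nlinarith [sq_nonneg (F.y t)]
      nlinarith [sq_nonneg (F.s t)])
  obtain ⟨l', hl'⟩ := exists_tendsto_of_monotoneOn (M := 5) hmono' fun t ht => by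
    have h1 := hbd t ht
    have hs := abs_lt.mp (F.abs_s_lt (hT.trans_le ht))
    have : -1 ≤ F.s t ^ 3 := by nlinarith [sq_nonneg (F.s t), F.s_sq_lt (hT.trans_le ht)]
    linarith
  have hcube : Tendsto (fun t => F.s t ^ 3) atTop (nhds (6 * l - l')) := by
    refine ((hl.const_mul 6).sub hl').congr fun t => ?_
    ring
  have hzero : 6 * l - l' = 0 := by
    by_contra hne
    have hpos := abs_pos.mpr hne
    refine not_tendsto_nhds_of_tendsto_atTop (F.tendsto_atTop_of_deriv hpos
      (eventually_atTop.mpr ⟨T, fun t ht => (h t ht).1⟩) ?_) l hl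
    filter_upwards [eventually_ge_atTop T,
      hcube.abs.eventually (lt_mem_nhds (half_lt_self hpos))] with t ht h1
    have hs := F.abs_s_lt (hT.trans_le ht)
    have h2 := (h t ht).2
    rw [abs_pow] at h1
    have h3 : |F.s t| ^ 3 ≤ F.s t ^ 2 := by
      rw [← sq_abs (F.s t)]
      exact pow_le_pow_of_le_one (abs_nonneg _) hs.le (by norm_num)
    linarith
  rw [hzero] at hcube
  refine ⟨K, l, ?_, hl⟩
  rw [Metric.tendsto_nhds] at hcube ⊢
  intro ε hε
  filter_upwards [hcube (ε ^ 3) (by positivity)] with t ht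
  rw [Real.dist_eq, sub_zero] at ht ⊢
  rw [abs_pow] at ht
  exact lt_of_pow_lt_pow_left₀ 3 hε.le ht

theorem tendsto_s : Tendsto F.s atTop (nhds 0) := by
  obtain ⟨K, l, h, -⟩ := F.exists_tendsto_avgLogOm
  exact h

/-- The limit `ω > 0` of `Ω` is `1`: since `s → 0`, the averaged equation
`ds/dτ = (s² - 1) s - (x² + y²) / 3` forces `x² + y² → 0`. -/
theorem tendsto_Om : Tendsto F.Om atTop (nhds 1) := by
  obtain ⟨K, l, hs, hl⟩ := F.exists_tendsto_avgLogOm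
  have hlog : Tendsto (fun t => Real.log (F.Om t)) atTop (nhds l) := by
    have h1 : Tendsto (fun t => K * Real.exp (-(F.τ t / 100))) atTop (nhds (K * 0)) :=
      (Real.tendsto_exp_neg_atTop_nhds_zero.comp
        (F.tendsto_τ.atTop_div_const (by norm_num))).const_mul K
    have h2 := (hl.add (F.tendsto_ζ.div_const 3)).add h1
    simp only [zero_div, mul_zero, add_zero] at h2
    refine h2.congr fun t => ?_
    unfold avgLogOm
    ring
  have hOm : Tendsto F.Om atTop (nhds (Real.exp l)) := by
    refine ((Real.continuous_exp.tendsto l).comp hlog).congr' ?_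
    filter_upwards [F.eventually_gt] with t ht using Real.exp_log (F.Om_pos t ht)
  have hle : Real.exp l ≤ 1 := le_of_tendsto hOm (by
    filter_upwards [F.eventually_gt] with t ht using F.Om_le_one ht)
  obtain heq | hlt := hle.eq_or_lt
  · rwa [heq] at hOm
  exfalso
  have hamp : Tendsto (fun t => (1 - F.Om t - F.s t ^ 2) - |F.s t| - 3 * |F.ζ t|) atTop
      (nhds (1 - Real.exp l)) := by
    have := (((hOm.const_sub 1).sub (hs.pow 2)).sub hs.abs).sub (F.tendsto_ζ.abs.const_mul 3)
    simpa using this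
  have hG : Tendsto (fun t => (1 + F.s t) * F.ζ t / 6 - F.s t) atTop (nhds 0) := by
    simpa using (((hs.const_add 1).mul F.tendsto_ζ).div_const 6).sub hs
  refine not_tendsto_nhds_of_tendsto_atTop (F.tendsto_atTop_of_deriv
    (c := (1 - Real.exp l) / 2) (by linarith)
    (φ := fun t => ((F.q t - 2) * F.s t - 2 / 3 * F.y t ^ 2) * F.ζ t / 6 + (1 + F.s t) *
      ((F.q t - 2) * F.ζ t + 2 * (F.x t ^ 2 - F.y t ^ 2) - 2 * F.ζ t ^ 2) / 6 -
      ((F.q t - 2) * F.s t - 2 / 3 * F.y t ^ 2)) ?_ ?_) 0 hG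
  · filter_upwards [F.eventually_gt] with t ht
    refine (((((F.deriv_s t ht).const_add 1).mul (F.hasDerivAt_ζ ht)).div_const 6).sub
      (F.deriv_s t ht)).congr_deriv ?_
    unfold q
    ring
  · filter_upwards [F.eventually_gt, hamp.eventually
      (lt_mem_nhds (show (1 - Real.exp l) / 2 < 1 - Real.exp l by linarith))] with t ht h1
    have hs := abs_lt.mp (F.abs_s_lt ht)
    have hζ := F.abs_ζ_le_two ht
    have hq0 := F.q_nonneg ht
    have hq2 := F.q_le ht
    have hs2 := F.s_sq_lt ht
    have hy : F.y t ^ 2 ≤ 3 := by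
      have := F.amp_lt ht
      unfold amp at this
      nlinarith [sq_nonneg (F.x t)]
    have e : ((F.q t - 2) * F.s t - 2 / 3 * F.y t ^ 2) * F.ζ t / 6 + (1 + F.s t) *
      ((F.q t - 2) * F.ζ t + 2 * (F.x t ^ 2 - F.y t ^ 2) - 2 * F.ζ t ^ 2) / 6 -
      ((F.q t - 2) * F.s t - 2 / 3 * F.y t ^ 2) = (1 - F.Om t - F.s t ^ 2) + (1 - F.s t ^ 2) * F.s t
      + ((F.q t - 2) * F.s t - 2 / 3 * F.y t ^ 2) / 6 * F.ζ t
      + (1 + F.s t) * (F.q t - 2 - 2 * F.ζ t) / 6 * F.ζ t := by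
      rw [F.Om_eq t ht]
      unfold q
      ring
    have b1 : -|F.s t| ≤ (1 - F.s t ^ 2) * F.s t := by
      refine (abs_le.mp (?_ : |(1 - F.s t ^ 2) * F.s t| ≤ |F.s t|)).1
      rw [abs_mul, abs_of_pos (by linarith : 0 < 1 - F.s t ^ 2)]
      nlinarith [abs_nonneg (F.s t), sq_nonneg (F.s t)]
    have b2 : -|F.ζ t| ≤ ((F.q t - 2) * F.s t - 2 / 3 * F.y t ^ 2) / 6 * F.ζ t := by
      refine (abs_le.mp (?_ : |_| ≤ |F.ζ t|)).1
      rw [abs_mul]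
      refine mul_le_of_le_one_left (abs_nonneg _) (abs_le.mpr ⟨?_, ?_⟩)
      · nlinarith
      · nlinarith [sq_nonneg (F.y t)]
    have b3 : -(2 * |F.ζ t|) ≤ (1 + F.s t) * (F.q t - 2 - 2 * F.ζ t) / 6 * F.ζ t := by
      refine (abs_le.mp (?_ : |_| ≤ 2 * |F.ζ t|)).1
      rw [abs_mul]
      have := abs_le.mp hζ
      refine mul_le_mul_of_nonneg_right (abs_le.mpr ⟨?_, ?_⟩) (abs_nonneg _) <;> nlinarith
    rw [e]
    linarith

theorem tendsto_amp : Tendsto F.amp atTop (nhds 0) := by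
  have h := ((F.tendsto_Om.const_sub 1).sub (F.tendsto_s.pow 2)).const_mul 3
  norm_num at h
  refine h.congr' ?_
  filter_upwards [F.eventually_gt] with t ht
  rw [F.Om_eq t ht, amp]
  ring

theorem tendsto_q : Tendsto F.q atTop (nhds 1) := by
  have h1 : Tendsto (fun t => F.s t ^ 2 + F.amp t / 3) atTop (nhds 0) := by
    simpa using (F.tendsto_s.pow 2).add (F.tendsto_amp.div_const 3)
  have h2 : Tendsto (fun t => F.q t - 1) atTop (nhds 0) := by
    refine squeeze_zero_norm (fun t => ?_) h1
    rw [Real.norm_eq_abs, abs_le]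
    unfold q amp
    constructor <;> nlinarith [sq_nonneg (F.s t), sq_nonneg (F.x t), sq_nonneg (F.y t)]
  simpa using h2.add_const 1

end Isotropization

/-! ### Oscillations of the flow -/

section Oscillation

theorem eventually_amp_pos : ∀ᶠ t in atTop, 0 < F.amp t := by
  obtain ⟨T, hT, hy⟩ := F.exists_ne
  have hmono := F.monotoneOn_of_deriv (Φ := fun t => F.amp t * Real.exp (4 * F.τ t))
    (φ := fun t => (2 * (F.q t - 2) * F.x t ^ 2 + 2 * (F.q t + 2 * F.s t) * F.y t ^ 2
      + 4 * F.amp t) * Real.exp (4 * F.τ t)) hT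
    (fun t ht => by
      have ht' := hT.trans_le ht
      refine ((F.hasDerivAt_amp ht').mul ((F.deriv_τ t ht').const_mul 4).exp).congr_deriv ?_
      ring)
    (fun t ht => by
      have ht' := hT.trans_le ht
      refine mul_nonneg ?_ (Real.exp_pos _).le
      have hs := abs_lt.mp (F.abs_s_lt ht')
      have hq0 := F.q_nonneg ht'
      unfold amp
      nlinarith [sq_nonneg (F.x t), sq_nonneg (F.y t), mul_nonneg hq0 (sq_nonneg (F.x t)),
        mul_nonneg hq0 (sq_nonneg (F.y t)),
        mul_nonneg (by linarith : 0 ≤ 1 + F.s t) (sq_nonneg (F.y t))])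
  have h0 : 0 < F.amp T := by unfold amp; positivity
  filter_upwards [eventually_ge_atTop T] with t ht
  have h1 := hmono (mem_Ici.mpr le_rfl) (mem_Ici.mpr ht) ht
  have h2 : 0 < F.amp T * Real.exp (4 * F.τ T) := by positivity
  exact pos_of_mul_pos_left (h2.trans_le h1) (Real.exp_pos _).le

/-- The normalized product `x y / (N (x² + y²))`. -/
def η (t : ℝ) : ℝ := F.ζ t / F.amp t

/-- The logarithmic derivative of `amp` with respect to the Hubble time. -/
def ampRate (t : ℝ) : ℝ :=
  (2 * (F.q t - 2) * F.x t ^ 2 + 2 * (F.q t + 2 * F.s t) * F.y t ^ 2) / F.amp t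

theorem abs_ampRate_le (ht : F.t₀ < t) (hA : 0 < F.amp t) : |F.ampRate t| ≤ 8 := by
  have hs := abs_lt.mp (F.abs_s_lt ht)
  have hq0 := F.q_nonneg ht
  have hq2 := F.q_le ht
  have hx := sq_nonneg (F.x t)
  have hy := sq_nonneg (F.y t)
  rw [ampRate, abs_div, abs_of_pos hA, div_le_iff₀ hA, abs_le, amp]
  constructor <;> nlinarith [mul_nonneg hq0 hx, mul_nonneg hq0 hy,
    mul_nonneg (sub_nonneg.mpr hq2) hx, mul_nonneg (sub_nonneg.mpr hq2) hy,
    mul_nonneg (by linarith : 0 ≤ 1 + F.s t) hy, mul_nonneg (by linarith : 0 ≤ 1 - F.s t) hy]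

theorem tendsto_η : Tendsto F.η atTop (nhds 0) := by
  refine squeeze_zero_norm' ?_ F.tendsto_inv_N
  filter_upwards [F.eventually_gt, F.eventually_amp_pos] with t ht hA
  have hN := F.N_pos t ht
  rw [Real.norm_eq_abs, η, abs_div, abs_of_pos hA, div_le_iff₀ hA]
  refine (F.abs_ζ_le_amp ht).trans ?_
  rw [div_le_iff₀ (by positivity)]
  field_simp
  linarith

theorem hasDerivAt_η (ht : F.t₀ < t) (hA : 0 < F.amp t) : HasDerivAt F.η
    (F.H t * (2 * (F.x t ^ 2 - F.y t ^ 2) / F.amp t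
      + (F.q t - 2 - 2 * F.ζ t - F.ampRate t) * F.η t)) t := by
  refine ((F.hasDerivAt_ζ ht).div (F.hasDerivAt_amp ht) hA.ne').congr_deriv ?_
  unfold ampRate η
  field_simp
  ring

theorem abs_error_η_le (ht : F.t₀ < t) (hA : 0 < F.amp t) :
    |(F.q t - 2 - 2 * F.ζ t - F.ampRate t) * F.η t| ≤ 14 * |F.η t| := by
  have h1 := abs_le.mp (F.abs_ampRate_le ht hA)
  have h2 := abs_le.mp (F.abs_ζ_le_two ht)
  have hq0 := F.q_nonneg ht
  have hq2 := F.q_le ht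
  rw [abs_mul]
  exact mul_le_mul_of_nonneg_right (abs_le.mpr ⟨by linarith, by linarith⟩) (abs_nonneg _)

/-- After the oscillating terms are removed by means of `η`, the logarithmic derivative of
`N² (x² + y²)` with respect to the Hubble time tends to `2`. -/
theorem tendsto_N_sq_mul_amp : Tendsto (fun t => F.N t ^ 2 * F.amp t) atTop atTop := by
  have hlow : Tendsto (fun t => 4 * F.q t - 2 - 8 * |F.s t| - 4 * |F.ζ t| - 14 * |F.η t|) atTop
      (nhds 2) := by
    have := ((((F.tendsto_q.const_mul 4).sub_const 2).sub (F.tendsto_s.abs.const_mul 8)).sub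
      (F.tendsto_ζ.abs.const_mul 4)).sub (F.tendsto_η.abs.const_mul 14)
    norm_num at this
    exact this
  have hinf : Tendsto (fun t => 2 * Real.log (F.N t) + Real.log (F.amp t) + F.η t)
      atTop atTop := by
    refine F.tendsto_atTop_of_deriv one_pos (φ := fun t => 2 * (F.q t + 2 * F.s t + 2 * F.ζ t)
      + F.ampRate t + (2 * (F.x t ^ 2 - F.y t ^ 2) / F.amp t
      + (F.q t - 2 - 2 * F.ζ t - F.ampRate t) * F.η t)) ?_ ?_
    · filter_upwards [F.eventually_gt, F.eventually_amp_pos] with t ht hA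
      refine ((((F.hasDerivAt_log_N ht).const_mul 2).add
        ((F.hasDerivAt_amp ht).log hA.ne')).add (F.hasDerivAt_η ht hA)).congr_deriv ?_
      unfold ampRate
      field_simp
    · filter_upwards [F.eventually_gt, F.eventually_amp_pos,
        hlow.eventually (lt_mem_nhds (by norm_num : (1 : ℝ) < 2))] with t ht hA h1
      have e : F.ampRate t + 2 * (F.x t ^ 2 - F.y t ^ 2) / F.amp t =
          2 * (F.q t - 1) + 4 * F.s t * (F.y t ^ 2 / F.amp t) := by
        unfold ampRate
        field_simp
        unfold amp
        ring
      have h2 := (abs_le.mp (F.abs_error_η_le ht hA)).1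
      have h3 : |F.s t * (F.y t ^ 2 / F.amp t)| ≤ |F.s t| := by
        rw [abs_mul]
        refine mul_le_of_le_one_right (abs_nonneg _) ?_
        rw [abs_of_nonneg (by positivity), div_le_one hA, amp]
        linarith [sq_nonneg (F.x t)]
      have h4 := (abs_le.mp h3).1
      linarith [neg_abs_le (F.s t), neg_abs_le (F.ζ t)]
  have h1 : Tendsto (fun t => 2 * Real.log (F.N t) + Real.log (F.amp t)) atTop atTop := by
    refine (hinf.atTop_add (F.tendsto_η.neg)).congr fun t => ?_
    ring
  refine (Real.tendsto_exp_atTop.comp h1).congr' ?_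
  filter_upwards [F.eventually_gt, F.eventually_amp_pos] with t ht hA
  have hN := F.N_pos t ht
  simp only [Function.comp_apply]
  rw [Real.exp_add, Real.exp_log hA, two_mul, Real.exp_add, Real.exp_log hN, sq]

/-- If `N² y²` stayed bounded, `x² / (x² + y²)` would tend to `1` and `η` would grow without
bound. -/
theorem frequently_lt_N_sq_mul_y_sq (K : ℝ) : ∃ᶠ t in atTop, K < F.N t ^ 2 * F.y t ^ 2 := by
  by_contra hcon
  rw [not_frequently] at hcon
  have hlow : Tendsto (fun t => 2 - 4 * (|K| * (F.N t ^ 2 * F.amp t)⁻¹) - 14 * |F.η t|) atTop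
      (nhds 2) := by
    have := ((F.tendsto_N_sq_mul_amp.inv_tendsto_atTop.const_mul |K|).const_mul 4).const_sub 2
      |>.sub (F.tendsto_η.abs.const_mul 14)
    simpa using this
  refine not_tendsto_nhds_of_tendsto_atTop (F.tendsto_atTop_of_deriv one_pos
    (φ := fun t => 2 * (F.x t ^ 2 - F.y t ^ 2) / F.amp t
      + (F.q t - 2 - 2 * F.ζ t - F.ampRate t) * F.η t) ?_ ?_) 0 F.tendsto_η
  · filter_upwards [F.eventually_gt, F.eventually_amp_pos] with t ht hA using F.hasDerivAt_η ht hA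
  · filter_upwards [F.eventually_gt, F.eventually_amp_pos, hcon,
      hlow.eventually (lt_mem_nhds (by norm_num : (1 : ℝ) < 2))] with t ht hA h0 h1
    have hN := F.N_pos t ht
    have h2 := (abs_le.mp (F.abs_error_η_le ht hA)).1
    have e : 2 * (F.x t ^ 2 - F.y t ^ 2) / F.amp t = 2 - 4 * (F.y t ^ 2 / F.amp t) := by
      field_simp
      unfold amp
      ring
    have h3 : F.y t ^ 2 / F.amp t ≤ |K| * (F.N t ^ 2 * F.amp t)⁻¹ := by
      rw [div_le_iff₀ hA, mul_inv, mul_assoc, mul_assoc, inv_mul_cancel₀ hA.ne', mul_one,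
        ← div_eq_mul_inv, le_div_iff₀ (by positivity)]
      linarith [le_abs_self K]
    linarith

/-- The point `(x, y)` rotates at the unbounded rate `2 N`; without zeros of `y`, the angle
`arctan (x / y)` would be unbounded. -/
theorem frequently_y_eq_zero : ∃ᶠ t in atTop, F.y t = 0 := by
  by_contra hcon
  rw [not_frequently] at hcon
  have h : Tendsto (fun t => -Real.arctan (F.x t / F.y t)) atTop atTop := by
    refine F.tendsto_atTop_of_deriv one_pos
      (φ := fun t => 2 * F.N t + (1 + F.s t) * (2 * F.x t * F.y t / F.amp t)) ?_ ?_
    · filter_upwards [F.eventually_gt, hcon] with t ht hy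
      have hA : F.x t ^ 2 + F.y t ^ 2 ≠ 0 := by positivity
      refine (((F.deriv_x t ht).div (F.deriv_y t ht) hy).arctan.neg).congr_deriv ?_
      have e : 1 + (F.x t / F.y t) ^ 2 = (F.x t ^ 2 + F.y t ^ 2) / F.y t ^ 2 := by
        field_simp
        ring
      simp only [Pi.div_apply]
      rw [e]
      unfold amp
      field_simp
      ring
    · filter_upwards [F.eventually_gt, F.eventually_amp_pos, F.tendsto_N.eventually_ge_atTop 2]
        with t ht hA hN
      have hs := abs_lt.mp (F.abs_s_lt ht)
      have h1 : -1 ≤ 2 * F.x t * F.y t / F.amp t := by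
        rw [le_div_iff₀ hA, amp]
        nlinarith [sq_nonneg (F.x t + F.y t)]
      nlinarith
  obtain ⟨t, ht⟩ := (h.eventually_gt_atTop (Real.pi / 2)).exists
  linarith [Real.neg_pi_div_two_lt_arctan (F.x t / F.y t)]

end Oscillation

end Flow
namespace Model
variable (m : Model) {t : ℝ}

/-! ### The Hubble parameter -/

/-- The Raychaudhuri equation, as an inequality. -/
theorem exists_hasDerivAt_H (ht : m.t₀ < t) : ∃ d, HasDerivAt m.H d t ∧ d < -m.H t ^ 2 := by
  have h1 : m.H =ᶠ[nhds t] fun t => 1 / 3 * (m.extr 0 0 t + m.extr 1 1 t + m.extr 2 2 t) := by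
    filter_upwards [Ioi_mem_nhds ht] with s hs
    rw [m.H_eq hs, Fin.sum_univ_three]
  have hd : ∀ i, HasDerivAt (m.extr i i) (deriv (m.extr i i) t) t := fun i =>
    (m.differentiableAt_extr ht i i).hasDerivAt
  refine ⟨_, ((((hd 0).add (hd 1)).add (hd 2)).const_mul (1 / 3)).congr_of_eventuallyEq h1, ?_⟩
  have h2 := m.ricci_zero_zero ht
  rw [m.ricci_eq ht] at h2
  simp only [Fin.sum_univ_three, m.extr_zero_one ht, m.extr_zero_two ht, m.extr_two_one ht,
    frame_G_zero_zero] at h2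
  simp [timeProj] at h2
  have h3 := m.mu_pos t ht
  rw [m.H_eq ht, Fin.sum_univ_three]
  nlinarith [sq_nonneg (m.extr 0 0 t - m.extr 1 1 t), sq_nonneg (m.extr 0 0 t - m.extr 2 2 t),
    sq_nonneg (m.extr 1 1 t - m.extr 2 2 t), sq_nonneg (m.extr 1 2 t)]

theorem strictAntiOn_H : StrictAntiOn m.H (Ioi m.t₀) := by
  refine strictAntiOn_of_deriv_neg (convex_Ioi _) (fun t ht => ?_) fun t ht => ?_
  · obtain ⟨d, hd, -⟩ := m.exists_hasDerivAt_H ht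
    exact hd.continuousAt.continuousWithinAt
  · rw [interior_Ioi] at ht
    obtain ⟨d, hd, hlt⟩ := m.exists_hasDerivAt_H ht
    rw [hd.deriv]
    linarith [sq_nonneg (m.H t)]

/-- The model expands: otherwise `1 / H`, which increases at least as fast as `t`, would vanish
at some time. -/
theorem H_pos (ht : m.t₀ < t) : 0 < m.H t := by
  by_contra! hle
  have hneg : ∀ s, t + 1 ≤ s → m.H s < 0 := fun s hs =>
    (m.strictAntiOn_H ht (ht.trans (by linarith : t < s)) (by linarith)).trans_le hle
  have hmono : MonotoneOn (fun s => (m.H s)⁻¹ - s) (Ici (t + 1)) := by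
    have hder : ∀ s, t + 1 ≤ s → ∃ d, HasDerivAt (fun s => (m.H s)⁻¹ - s) d s ∧ 0 ≤ d :=
      fun s hs => by
        obtain ⟨d, hd, hlt⟩ := m.exists_hasDerivAt_H (ht.trans (by linarith : t < s))
        refine ⟨_, (hd.inv (hneg s hs).ne).sub (hasDerivAt_id s), ?_⟩
        have := pow_pos (neg_pos.mpr (hneg s hs)) 2
        rw [sub_nonneg, le_div_iff₀ (by nlinarith)]
        linarith
    refine monotoneOn_of_deriv_nonneg (convex_Ici _) (fun s hs => ?_) (fun s hs => ?_)
      fun s hs => ?_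
    · obtain ⟨d, hd, -⟩ := hder s hs
      exact hd.continuousAt.continuousWithinAt
    · obtain ⟨d, hd, -⟩ := hder s (interior_subset hs)
      exact hd.differentiableAt.differentiableWithinAt
    · obtain ⟨d, hd, h0⟩ := hder s (interior_subset hs)
      rw [hd.deriv]
      exact h0
  set s := t + 1 - (m.H (t + 1))⁻¹
  have h1 := inv_neg''.mpr (hneg (t + 1) le_rfl)
  have hs : t + 1 ≤ s := by simp only [s]; linarith
  have h2 := hmono (mem_Ici.mpr le_rfl) (mem_Ici.mpr hs) hs
  have h3 := inv_neg''.mpr (hneg s hs)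
  simp only [s] at h2 h3
  linarith

variable {m} in
theorem IsHubbleTime.strictMonoOn {τ : ℝ → ℝ} (hτ : m.IsHubbleTime τ) :
    StrictMonoOn τ (Ioi m.t₀) := by
  refine strictMonoOn_of_deriv_pos (convex_Ioi _)
    (fun t ht => (hτ t ht).continuousAt.continuousWithinAt) fun t ht => ?_
  rw [interior_Ioi] at ht
  rw [(hτ t ht).deriv]
  exact m.H_pos ht

variable {m} in
/-- As `τ` increases, it is bounded above on every interval `(t₀, c]`, so that `τ → ∞` only for
`t → ∞`. -/
theorem IsHubbleTime.late_eq {τ : ℝ → ℝ} (hτ : m.IsHubbleTime τ) (h : Tendsto τ atTop atTop) :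
    m.late τ = atTop := by
  refine le_antisymm (fun s hs => ?_)
    (le_inf (map_le_iff_le_comap.mp h) (le_principal_iff.mpr (Ioi_mem_atTop _)))
  obtain ⟨c, hc⟩ := mem_atTop_sets.mp hs
  have hc' : m.t₀ < max c (m.t₀ + 1) := lt_max_of_lt_right (by linarith)
  have h1 : τ ⁻¹' Ioi (τ (max c (m.t₀ + 1))) ∩ Ioi m.t₀ ∈ m.late τ :=
    inter_mem_inf (preimage_mem_comap (Ioi_mem_atTop _)) (mem_principal_self _)
  refine mem_of_superset h1 fun t ht => hc t ?_
  exact (le_max_left _ _).trans ((hτ.strictMonoOn.lt_iff_lt hc' ht.2).mp ht.1).le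

/-! ### Expansion-normalized variables -/

/-- The volume element of the hypersurfaces. -/
def volElem (t : ℝ) : ℝ := Real.sqrt (m.g t 0 0 * m.g t 1 1 * m.g t 2 2)

/-- The normalized shear along the axis `e₀`. -/
def nS (t : ℝ) : ℝ := (m.H t - m.extr 0 0 t) / (2 * m.H t)

/-- The normalized shear difference in the plane of `e₁` and `e₂`. -/
def nX (t : ℝ) : ℝ := (m.extr 1 1 t - m.extr 2 2 t) / (2 * m.H t)

/-- The normalized anisotropy of the spatial curvature. -/
def nY (t : ℝ) : ℝ := (m.g t 1 1 - m.g t 2 2) / (2 * m.volElem t * m.H t)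

/-- The normalized frequency of the oscillations. -/
def nN (t : ℝ) : ℝ := (m.g t 1 1 + m.g t 2 2) / (2 * m.volElem t * m.H t)

theorem volElem_pos (ht : m.t₀ < t) : 0 < m.volElem t := by
  have hp : ∀ i, 0 < m.g t i i := fun i => (m.posDef t ht).diag_pos
  have := hp 0
  have := hp 1
  have := hp 2
  exact Real.sqrt_pos.mpr (by positivity)

theorem volElem_sq (ht : m.t₀ < t) : m.volElem t ^ 2 = m.g t 0 0 * m.g t 1 1 * m.g t 2 2 := by
  have hp : ∀ i, 0 < m.g t i i := fun i => (m.posDef t ht).diag_pos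
  have := hp 0
  have := hp 1
  have := hp 2
  exact Real.sq_sqrt (by positivity)

theorem three_H_eq (ht : m.t₀ < t) :
    m.extr 0 0 t + m.extr 1 1 t + m.extr 2 2 t = 3 * m.H t := by
  rw [m.H_eq ht, Fin.sum_univ_three]
  ring

theorem extr_zero_eq (ht : m.t₀ < t) : m.extr 0 0 t = m.H t * (1 - 2 * m.nS t) := by
  have := (m.H_pos ht).ne'
  unfold nS
  field_simp
  ring

theorem extr_one_eq (ht : m.t₀ < t) : m.extr 1 1 t = m.H t * (1 + m.nS t + m.nX t) := by
  have := (m.H_pos ht).ne'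
  have := m.three_H_eq ht
  unfold nS nX
  field_simp
  linarith

theorem extr_two_eq (ht : m.t₀ < t) : m.extr 2 2 t = m.H t * (1 + m.nS t - m.nX t) := by
  have := (m.H_pos ht).ne'
  have := m.three_H_eq ht
  unfold nS nX
  field_simp
  linarith

theorem g_one_eq (ht : m.t₀ < t) : m.g t 1 1 = m.volElem t * m.H t * (m.nN t + m.nY t) := by
  have := (m.H_pos ht).ne'
  have := (m.volElem_pos ht).ne'
  unfold nN nY
  field_simp
  ring

theorem g_two_eq (ht : m.t₀ < t) : m.g t 2 2 = m.volElem t * m.H t * (m.nN t - m.nY t) := by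
  have := (m.H_pos ht).ne'
  have := (m.volElem_pos ht).ne'
  unfold nN nY
  field_simp
  ring

theorem mu_eq (ht : m.t₀ < t) : m.μ t = 3 * m.H t ^ 2 * m.Omega t := by
  have := (m.H_pos ht).ne'
  unfold Omega
  field_simp

theorem curv_axis_eq (ht : m.t₀ < t) :
    (m.g t 1 1 - m.g t 2 2) ^ 2 / (2 * m.g t 0 0 * m.g t 1 1 * m.g t 2 2) =
      2 * m.H t ^ 2 * m.nY t ^ 2 := by
  have h1 := (m.H_pos ht).ne'
  have h2 := (m.volElem_pos ht).ne'
  have e : 2 * m.g t 0 0 * m.g t 1 1 * m.g t 2 2 = 2 * m.volElem t ^ 2 := by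
    rw [m.volElem_sq ht]
    ring
  rw [e, m.g_one_eq ht, m.g_two_eq ht]
  field_simp
  ring

theorem curv_plane_eq (ht : m.t₀ < t) :
    (m.g t 1 1 ^ 2 - m.g t 2 2 ^ 2) / (2 * m.g t 0 0 * m.g t 1 1 * m.g t 2 2) =
      2 * m.H t ^ 2 * (m.nN t * m.nY t) := by
  have h1 := (m.H_pos ht).ne'
  have h2 := (m.volElem_pos ht).ne'
  have e : 2 * m.g t 0 0 * m.g t 1 1 * m.g t 2 2 = 2 * m.volElem t ^ 2 := by
    rw [m.volElem_sq ht]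
    ring
  rw [e, m.g_one_eq ht, m.g_two_eq ht]
  field_simp
  ring

theorem nN_pos (ht : m.t₀ < t) : 0 < m.nN t := by
  have hp : ∀ i, 0 < m.g t i i := fun i => (m.posDef t ht).diag_pos
  have := hp 1
  have := hp 2
  have := m.H_pos ht
  have := m.volElem_pos ht
  unfold nN
  positivity

theorem nY_sq_lt (ht : m.t₀ < t) : m.nY t ^ 2 < m.nN t ^ 2 := by
  have hp : ∀ i, 0 < m.g t i i := fun i => (m.posDef t ht).diag_pos
  have h1 := hp 1
  have h2 := hp 2
  have h3 := mul_pos (m.volElem_pos ht) (m.H_pos ht)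
  rw [m.g_one_eq ht] at h1
  rw [m.g_two_eq ht] at h2
  nlinarith [mul_pos (pos_of_mul_pos_right h1 h3.le) (pos_of_mul_pos_right h2 h3.le)]

theorem Omega_pos (ht : m.t₀ < t) : 0 < m.Omega t := by
  have := m.H_pos ht
  have := m.mu_pos t ht
  unfold Omega
  positivity

namespace IsDiagonal
variable {m}

theorem Omega_eq (h : m.IsDiagonal) (ht : m.t₀ < t) :
    m.Omega t = 1 - m.nS t ^ 2 - (m.nX t ^ 2 + m.nY t ^ 2) / 3 := by
  have h1 := h.hamiltonian ht
  have hH := m.H_pos ht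
  rw [m.curv_axis_eq ht, m.mu_eq ht, m.extr_zero_eq ht, m.extr_one_eq ht, m.extr_two_eq ht] at h1
  have : m.H t ^ 2 * (6 * m.Omega t) =
      m.H t ^ 2 * (6 * (1 - m.nS t ^ 2 - (m.nX t ^ 2 + m.nY t ^ 2) / 3)) := by
    linear_combination -h1
  linarith [mul_left_cancel₀ (pow_pos hH 2).ne' this]

theorem hasDerivAt_extr_normalized (h : m.IsDiagonal) (ht : m.t₀ < t) :
    HasDerivAt (m.extr 0 0)
      (m.H t ^ 2 * (m.Omega t - 3 * (1 - 2 * m.nS t) + 2 * m.nY t ^ 2)) t ∧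
    HasDerivAt (m.extr 1 1)
      (m.H t ^ 2 * (m.Omega t - 3 * (1 + m.nS t + m.nX t) - 2 * (m.nN t * m.nY t))) t ∧
    HasDerivAt (m.extr 2 2)
      (m.H t ^ 2 * (m.Omega t - 3 * (1 + m.nS t - m.nX t) + 2 * (m.nN t * m.nY t))) t := by
  obtain ⟨h0, h1, h2⟩ := h.hasDerivAt_extr ht
  rw [m.three_H_eq ht, m.mu_eq ht, m.curv_axis_eq ht, m.extr_zero_eq ht] at h0
  rw [m.three_H_eq ht, m.mu_eq ht, m.curv_plane_eq ht, m.extr_one_eq ht] at h1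
  rw [m.three_H_eq ht, m.mu_eq ht, m.curv_plane_eq ht, m.extr_two_eq ht] at h2
  exact ⟨h0.congr_deriv (by ring), h1.congr_deriv (by ring), h2.congr_deriv (by ring)⟩

theorem hasDerivAt_H (h : m.IsDiagonal) (ht : m.t₀ < t) : HasDerivAt m.H
    (-(2 + m.nS t ^ 2 + (m.nX t ^ 2 - m.nY t ^ 2) / 3) * m.H t ^ 2) t := by
  have h1 : m.H =ᶠ[nhds t] fun t => 1 / 3 * (m.extr 0 0 t + m.extr 1 1 t + m.extr 2 2 t) := by
    filter_upwards [Ioi_mem_nhds ht] with s hs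
    rw [m.H_eq hs, Fin.sum_univ_three]
  obtain ⟨d0, d1, d2⟩ := h.hasDerivAt_extr_normalized ht
  refine HasDerivAt.congr_deriv (((d0.add d1).add d2).const_mul (1 / 3)
    |>.congr_of_eventuallyEq h1) ?_
  rw [h.Omega_eq ht]
  ring

theorem hasDerivAt_volElem (h : m.IsDiagonal) (ht : m.t₀ < t) :
    HasDerivAt m.volElem (3 * m.H t * m.volElem t) t := by
  have hp := m.volElem_pos ht
  have h0 : m.g t 0 0 * m.g t 1 1 * m.g t 2 2 ≠ 0 := by
    rw [← m.volElem_sq ht]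
    positivity
  refine ((((h.hasDerivAt_g ht 0).mul (h.hasDerivAt_g ht 1)).mul
    (h.hasDerivAt_g ht 2)).sqrt h0).congr_deriv ?_
  simp only [Pi.mul_apply]
  rw [← m.three_H_eq ht, div_eq_iff (by positivity)]
  change _ = _ * (2 * m.volElem t)
  linear_combination (-2) * (m.extr 0 0 t + m.extr 1 1 t + m.extr 2 2 t) * m.volElem_sq ht

theorem hasDerivAt_nS (h : m.IsDiagonal) (ht : m.t₀ < t) : HasDerivAt m.nS
    (m.H t * ((m.nS t ^ 2 + (m.nX t ^ 2 - m.nY t ^ 2) / 3 - 1) * m.nS t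
      - 2 / 3 * m.nY t ^ 2)) t := by
  have hH := (m.H_pos ht).ne'
  have d := h.hasDerivAt_H ht
  refine ((d.sub (h.hasDerivAt_extr_normalized ht).1).div (d.const_mul 2)
    (by simpa using hH)).congr_deriv ?_
  simp only [Pi.sub_apply]
  rw [m.extr_zero_eq ht, h.Omega_eq ht]
  field_simp
  ring

theorem hasDerivAt_nX (h : m.IsDiagonal) (ht : m.t₀ < t) : HasDerivAt m.nX
    (m.H t * ((m.nS t ^ 2 + (m.nX t ^ 2 - m.nY t ^ 2) / 3 - 1) * m.nX t
      - 2 * m.nN t * m.nY t)) t := by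
  have hH := (m.H_pos ht).ne'
  obtain ⟨-, d1, d2⟩ := h.hasDerivAt_extr_normalized ht
  refine ((d1.sub d2).div ((h.hasDerivAt_H ht).const_mul 2) (by simpa using hH)).congr_deriv ?_
  simp only [Pi.sub_apply]
  rw [m.extr_one_eq ht, m.extr_two_eq ht]
  field_simp
  ring

theorem hasDerivAt_nY (h : m.IsDiagonal) (ht : m.t₀ < t) : HasDerivAt m.nY
    (m.H t * ((1 + m.nS t ^ 2 + (m.nX t ^ 2 - m.nY t ^ 2) / 3 + 2 * m.nS t) * m.nY t
      + 2 * m.nN t * m.nX t)) t := by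
  have hH := (m.H_pos ht).ne'
  have hV := (m.volElem_pos ht).ne'
  refine (((h.hasDerivAt_g ht 1).sub (h.hasDerivAt_g ht 2)).div
    (((h.hasDerivAt_volElem ht).const_mul 2).mul (h.hasDerivAt_H ht))
    (by simp [hH, hV])).congr_deriv ?_
  simp only [Pi.sub_apply, Pi.mul_apply]
  rw [m.extr_one_eq ht, m.extr_two_eq ht, m.g_one_eq ht, m.g_two_eq ht]
  field_simp
  ring

theorem hasDerivAt_nN (h : m.IsDiagonal) (ht : m.t₀ < t) : HasDerivAt m.nN
    (m.H t * ((1 + m.nS t ^ 2 + (m.nX t ^ 2 - m.nY t ^ 2) / 3 + 2 * m.nS t) * m.nN t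
      + 2 * m.nX t * m.nY t)) t := by
  have hH := (m.H_pos ht).ne'
  have hV := (m.volElem_pos ht).ne'
  refine (((h.hasDerivAt_g ht 1).add (h.hasDerivAt_g ht 2)).div
    (((h.hasDerivAt_volElem ht).const_mul 2).mul (h.hasDerivAt_H ht))
    (by simp [hH, hV])).congr_deriv ?_
  simp only [Pi.add_apply, Pi.mul_apply]
  rw [m.extr_one_eq ht, m.extr_two_eq ht, m.g_one_eq ht, m.g_two_eq ht]
  field_simp
  ring

/-- The expansion-normalized variables of a diagonal model. -/
def toFlow (h : m.IsDiagonal) {τ : ℝ → ℝ} (hτ : m.IsHubbleTime τ) : Flow where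
  t₀ := m.t₀
  H := m.H
  s := m.nS
  x := m.nX
  y := m.nY
  N := m.nN
  Om := m.Omega
  τ := τ
  H_pos _ := m.H_pos
  Om_pos _ := m.Omega_pos
  N_pos _ := m.nN_pos
  sq_lt _ := m.nY_sq_lt
  Om_eq _ := h.Omega_eq
  deriv_H _ := h.hasDerivAt_H
  deriv_s _ := h.hasDerivAt_nS
  deriv_x _ := h.hasDerivAt_nX
  deriv_y _ := h.hasDerivAt_nY
  deriv_N _ := h.hasDerivAt_nN
  deriv_τ := hτ
  exists_ne := by
    obtain ⟨t, ht, hne⟩ := h.exists_ne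
    have h1 := (m.volElem_pos ht).ne'
    have h2 := (m.H_pos ht).ne'
    exact ⟨t, ht, div_ne_zero (sub_ne_zero.mpr hne) (by simp [h1, h2])⟩

/-! ### The scalars in terms of the normalized variables -/

theorem shearScalar_eq (h : m.IsDiagonal) (ht : m.t₀ < t) :
    m.shearScalar t = Real.sqrt (m.nS t ^ 2 + m.nX t ^ 2 / 3) := by
  have hH := (m.H_pos ht).ne'
  rw [shearScalar, h.normSq_shear ht, m.extr_zero_eq ht, m.extr_one_eq ht, m.extr_two_eq ht]
  congr 1
  field_simp
  ring

theorem curvScalar_eq (h : m.IsDiagonal) (ht : m.t₀ < t) : m.curvScalar t =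
    Real.sqrt (4 / 9 * m.nY t ^ 4 + 4 / 3 * (m.nN t ^ 2 * m.nY t ^ 2)) := by
  have hH := (m.H_pos ht).ne'
  rw [curvScalar, h.normSq_ricciTF ht, m.curv_axis_eq ht, m.curv_plane_eq ht]
  congr 1
  field_simp
  ring

theorem le_weylScalar (h : m.IsDiagonal) (ht : m.t₀ < t) :
    Real.sqrt (((2 * m.nX t * (1 - 2 * m.nS t) + 4 * (m.nN t * m.nY t)) ^ 2
      + (4 * (m.nN t * m.nX t) + 6 * (m.nS t * m.nY t)) ^ 2) / 12) ≤ m.weylScalar t := by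
  have hH := m.H_pos ht
  have hV := m.volElem_pos ht
  obtain ⟨-, d1, d2⟩ := h.hasDerivAt_extr_normalized ht
  have hE : m.elWeyl 2 2 t / m.g t 1 1 - m.elWeyl 3 3 t / m.g t 2 2 =
      m.H t ^ 2 * (2 * m.nX t * (1 - 2 * m.nS t) + 4 * (m.nN t * m.nY t)) := by
    have e1 : m.elWeyl 2 2 t / m.g t 1 1 = _ := h.elWeyl_diag ht 1
    have e2 : m.elWeyl 3 3 t / m.g t 2 2 = _ := h.elWeyl_diag ht 2
    rw [e1, e2, d1.deriv, d2.deriv, m.extr_one_eq ht, m.extr_two_eq ht]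
    ring
  have hM : m.magWeyl 2 2 t / m.g t 1 1 - m.magWeyl 3 3 t / m.g t 2 2 =
      -(m.H t ^ 2 * (4 * (m.nN t * m.nX t) + 6 * (m.nS t * m.nY t))) := by
    obtain ⟨e1, e2⟩ := h.magWeyl_diag ht
    change _ = _ / m.volElem t at e1
    change _ = _ / m.volElem t at e2
    rw [e1, e2, m.extr_zero_eq ht, m.extr_one_eq ht, m.extr_two_eq ht, m.g_one_eq ht,
      m.g_two_eq ht]
    field_simp
    ring
  have g1 := h.normSq_frame_ge ht (T := fun a b => m.elWeyl a b t) (m.elWeyl_zero_left ht)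
    (m.elWeyl_zero_right ht)
  have g2 := h.normSq_frame_ge ht (T := fun a b => m.magWeyl a b t) m.magWeyl_zero_left
    m.magWeyl_zero_right
  rw [hE] at g1
  rw [hM] at g2
  refine Real.sqrt_le_sqrt ?_
  rw [le_div_iff₀ (by positivity)]
  linarith

end IsDiagonal

/-! ### Late-time behaviour of diagonal models -/

namespace IsDiagonal
variable {m}

theorem tendsto_shearScalar (h : m.IsDiagonal) {τ : ℝ → ℝ} (hτ : m.IsHubbleTime τ) :
    Tendsto m.shearScalar atTop (nhds 0) := by
  have hs : Tendsto m.nS atTop (nhds 0) := (h.toFlow hτ).tendsto_s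
  have hA : Tendsto (fun t => m.nX t ^ 2 + m.nY t ^ 2) atTop (nhds 0) := (h.toFlow hτ).tendsto_amp
  have hx : Tendsto (fun t => m.nX t ^ 2) atTop (nhds 0) :=
    squeeze_zero (fun t => sq_nonneg _) (fun t => by linarith [sq_nonneg (m.nY t)]) hA
  have h1 := ((hs.pow 2).add (hx.div_const 3)).sqrt
  norm_num at h1
  refine h1.congr' ?_
  filter_upwards [eventually_gt_atTop m.t₀] with t ht using (h.shearScalar_eq ht).symm

theorem tendsto_weylScalar (h : m.IsDiagonal) {τ : ℝ → ℝ} (hτ : m.IsHubbleTime τ) :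
    Tendsto m.weylScalar atTop atTop := by
  have h1 : Tendsto (fun t => m.nN t ^ 2 * (m.nX t ^ 2 + m.nY t ^ 2)) atTop atTop :=
    (h.toFlow hτ).tendsto_N_sq_mul_amp
  have h2 := Real.tendsto_sqrt_atTop.comp
    (tendsto_atTop_add_const_right _ (-18) (h1.const_mul_atTop (by norm_num : (0 : ℝ) < 2 / 3)))
  refine tendsto_atTop_mono' _ ?_ h2
  filter_upwards [eventually_gt_atTop m.t₀] with t ht
  refine le_trans (Real.sqrt_le_sqrt ?_) (h.le_weylScalar ht)
  have hs : |m.nS t| < 1 := (h.toFlow hτ).abs_s_lt ht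
  have hA : m.nX t ^ 2 + m.nY t ^ 2 < 3 := (h.toFlow hτ).amp_lt ht
  have hs' := abs_lt.mp hs
  -- `(u + v)² ≥ u² / 2 - v²`, where `v` is bounded.
  have e1 : 8 * (m.nN t * m.nY t) ^ 2 - 36 * m.nX t ^ 2 ≤
      (2 * m.nX t * (1 - 2 * m.nS t) + 4 * (m.nN t * m.nY t)) ^ 2 := by
    have : (2 * m.nX t * (1 - 2 * m.nS t)) ^ 2 ≤ 36 * m.nX t ^ 2 := by
      rw [mul_pow]
      nlinarith [sq_nonneg (m.nX t),
        mul_nonneg (sq_nonneg (m.nX t)) (by nlinarith : 0 ≤ 9 - (1 - 2 * m.nS t) ^ 2)]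
    nlinarith [sq_nonneg (2 * (2 * m.nX t * (1 - 2 * m.nS t)) + 4 * (m.nN t * m.nY t))]
  have e2 : 8 * (m.nN t * m.nX t) ^ 2 - 36 * m.nY t ^ 2 ≤
      (4 * (m.nN t * m.nX t) + 6 * (m.nS t * m.nY t)) ^ 2 := by
    have : (6 * (m.nS t * m.nY t)) ^ 2 ≤ 36 * m.nY t ^ 2 := by
      nlinarith [mul_nonneg (sq_nonneg (m.nY t)) (by nlinarith : 0 ≤ 1 - m.nS t ^ 2)]
    nlinarith [sq_nonneg (2 * (6 * (m.nS t * m.nY t)) + 4 * (m.nN t * m.nX t))]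
  nlinarith

theorem frequently_lt_curvScalar (h : m.IsDiagonal) {τ : ℝ → ℝ} (hτ : m.IsHubbleTime τ) (K : ℝ) :
    ∃ᶠ t in atTop, K < m.curvScalar t := by
  have h1 : ∃ᶠ t in atTop, K ^ 2 < m.nN t ^ 2 * m.nY t ^ 2 :=
    (h.toFlow hτ).frequently_lt_N_sq_mul_y_sq (K ^ 2)
  refine (h1.and_eventually (eventually_gt_atTop m.t₀)).mono fun t ht => ?_
  rw [h.curvScalar_eq ht.2]
  refine Real.lt_sqrt_of_sq_lt ?_
  have : 0 ≤ m.nY t ^ 4 := by positivity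
  nlinarith [sq_nonneg K]

theorem frequently_curvScalar_eq_zero (h : m.IsDiagonal) {τ : ℝ → ℝ} (hτ : m.IsHubbleTime τ) :
    ∃ᶠ t in atTop, m.curvScalar t = 0 := by
  have h1 : ∃ᶠ t in atTop, m.nY t = 0 := (h.toFlow hτ).frequently_y_eq_zero
  refine (h1.and_eventually (eventually_gt_atTop m.t₀)).mono fun t ht => ?_
  rw [h.curvScalar_eq ht.2, ht.1]
  simp

end IsDiagonal

end Model
end BianchiRadiation

end

theorem theorem2 (m : BianchiRadiation.Model) (hLRS : ¬ m.IsLRS)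
    (τ : ℝ → ℝ) (hτ : m.IsHubbleTime τ) :
    Tendsto τ atTop atTop ∧
    Tendsto m.Omega (m.late τ) (nhds 1) ∧
    Tendsto m.shearScalar (m.late τ) (nhds 0) ∧
    Tendsto m.weylScalar (m.late τ) atTop ∧
    limsup (fun t => (m.curvScalar t : EReal)) (m.late τ) = ⊤ ∧
    liminf (fun t => (m.curvScalar t : EReal)) (m.late τ) = 0 := by
  obtain ⟨m', h, hle, heq⟩ := m.exists_isDiagonal hLRS
  have hτ' : m'.IsHubbleTime τ := fun t ht => by
    rw [(heq t ht).1]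
    exact hτ t (hle.trans_lt ht)
  have hlim : Tendsto τ atTop atTop := (h.toFlow hτ').tendsto_τ
  have hev : ∀ᶠ t in atTop, m'.t₀ < t := eventually_gt_atTop _
  rw [hτ.late_eq hlim]
  have hfreq : ∀ p : ℝ → Prop, (∃ᶠ t in atTop, p (m'.curvScalar t)) →
      ∃ᶠ t in atTop, p (m.curvScalar t) := fun p hp =>
    (hp.and_eventually hev).mono fun t ht => by
      rw [← (heq t ht.2).2.2.2.1]
      exact ht.1
  refine ⟨hlim, ?_, ?_, ?_, ?_, le_antisymm ?_ ?_⟩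
  · refine Tendsto.congr' ?_ (h.toFlow hτ').tendsto_Om
    filter_upwards [hev] with t ht using (heq t ht).2.1
  · refine (h.tendsto_shearScalar hτ').congr' ?_
    filter_upwards [hev] with t ht using (heq t ht).2.2.1
  · refine (h.tendsto_weylScalar hτ').congr' ?_
    filter_upwards [hev] with t ht using (heq t ht).2.2.2.2
  · refine EReal.eq_top_iff_forall_lt _ |>.mpr fun K => ?_
    have h1 := hfreq (fun c => K + 1 < c) (h.frequently_lt_curvScalar hτ' (K + 1))
    refine lt_of_lt_of_le (EReal.coe_lt_coe_iff.mpr (lt_add_one K)) ?_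
    exact le_limsup_of_frequently_le (h1.mono fun t ht => EReal.coe_le_coe_iff.mpr ht.le)
  · refine liminf_le_of_frequently_le ?_
    refine (hfreq (fun c => c = 0) (h.frequently_curvScalar_eq_zero hτ')).mono fun t ht => ?_
    rw [ht, EReal.coe_zero]
  · refine le_liminf_of_le (by isBoundedDefault) (Eventually.of_forall fun t => ?_)
    exact EReal.coe_nonneg.mpr (Real.sqrt_nonneg _)
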